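/- Let $\operatorname{Im}\tau>0$, $\Lambda=\mathbb Z+\mathbb Z\tau$, $\mathbb T=\mathbb C/\Lambda$. Let $[t]$ be the odd theta function or the Weierstrass $\sigma$-function of $\Lambda$; more generally $[t]=\kappa e^{ct^2}\vartheta(t)$ with $\kappa\in\mathbb C^\times$, $c\in\mathbb C$ and $\vartheta(t)=\sum_{n\in\mathbb Z}e^{\pi i(n+1/2)^2\tau+2\pi i(n+1/2)(t+1/2)}$. For parameters $a=(h_x,h_y,e_1,\dots,e_8)\in\mathbb C^{10}$ put $$F_{ij}(u)=\frac{[u-e_j][u+e_j-h_x]}{[u-e_i][u+e_i-h_x]},\qquad G_{ij}(u)=\frac{[u-e_j][u+e_j-h_y]}{[u-e_i][u+e_i-h_y]},$$ $\iota_a(u)=(F_{12}(u),G_{12}(u))\in\mathbb P^1\times\mathbb P^1$, and let $\mathcal X_a$ be the blowup of $\mathbb P^1\times\mathbb P^1$ at the eight points $\iota_a(e_1),\dots,\iota_a(e_8)$. Let $\operatorname{Pic}=\mathbb Z\mathcal H_x\oplus\mathbb Z\mathcal H_y\oplus\bigoplus_{i=1}^8\mathbb Z\mathcal E_i$ be its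 Picard lattice, with $\mathcal H_x\bullet\mathcal H_y=1$, $\mathcal E_i\bullet\mathcal E_j=-\delta_{ij}$ and all other products of basis elements equal to $0$, and put $\iota_a^*(l\mathcal H_x+l'\mathcal H_y+\sum m_i\mathcal E_i)=lh_x+l'h_y+\sum m_ie_i$. Let $$\alpha_0=\mathcal E_1-\mathcal E_2,\quad \alpha_1=\mathcal H_x-\mathcal H_y,\quad \alpha_2=\mathcal H_y-\mathcal E_1-\mathcal E_2,\quad \alpha_i=\mathcal E_{i-1}-\mathcal E_i\ (3\le i\le 8),$$ and let $W(E_8^{(1)})$ be the group of automorphisms of $\operatorname{Pic}$ generated by the reflections $w_i(\mathcal D)=\mathcal D+(\alpha_i\bullet\mathcal D)\alpha_i$, $0\le i\le 8$. Its real roots are the elements $g(\alpha_i)$, $g\in W(E_8^{(1)})$. Call $a$ generic if $\iota_a^*(\alpha)\notin\Lambda$ for every real root $\alpha$. Theorem. A birational representation of $W(E_8^{(1)})$ is given by the following maps (parameters that are not listed do not change): $$\begin{aligned} w_0:\ & \bar x=\tfrac1x,\ \bar y=\tfrac1y,\ \bar e_1=e_2,\ \bar e_2=e_1;\\ w_1:\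 & \bar x=y,\ \bar y=x,\ \bar h_x=h_y,\ \bar h_y=h_x;\\ w_2:\ & \bar x=\tfrac xy,\ \bar y=\tfrac1y,\ \bar h_x=h_x+h_y-e_1-e_2,\ \bar e_1=h_y-e_2,\ \bar e_2=h_y-e_1;\\ w_3:\ & \bar x=F_{23}(e_1)(x-F_{12}(e_3)),\ \bar y=G_{23}(e_1)(y-G_{12}(e_3)),\ \bar e_2=e_3,\ \bar e_3=e_2;\\ w_i:\ & \bar x=x,\ \bar y=y,\ \bar e_{i-1}=e_i,\ \bar e_i=e_{i-1}\qquad(4\le i\le 8). \end{aligned}$$ Precisely, there is a homomorphism from $W(E_8^{(1)})$ to the group of pairs consisting of a bijection $a\mapsto\bar a$ of the set of generic parameters and, for each generic $a$, a birational map $\varphi_a$ of $\mathbb P^1\times\mathbb P^1$ (the composition being $(a,p)\mapsto(\bar a,\varphi_a(p))$), which sends each $w_i$ to the maps above and is such that (i) for every $g\in W(E_8^{(1)})$ and every generic $a$, with $g$ acting by $a\mapsto\bar a$ and $\varphi_a$: $\iota_{\bar a}^*(g\mathcal D)=\iota_a^*(\mathcal D)$ for all $\mathcal D\in\operatorname{Pic}$,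 and $\varphi_a$ lifts to an isomorphism $\mathcal X_a\to\mathcal X_{\bar a}$ whose push-forward on Picard lattices is $g$; (ii) for every generator $w_i$ and every generic $a$, the map of $w_i$ carries $\iota_a(u)$ to $\iota_{\bar a}(u)$, for every $u$ at which neither $F_{12}(u)$ nor $G_{12}(u)$ is $0$ or $\infty$. -/

import Mathlib

namespace E8Bir

/-! ### The Picard lattice and the affine Weyl group of type `E₈⁽¹⁾`

All indices in `Fin 8` are shifted by one: the index `k : Fin 8` stands for `k + 1`, so that
`E 0, …, E 7` are the classes `𝓔₁, …, 𝓔₈`, and `e 0, …, e 7` are the parameters `e₁, …, e₈`. -/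

/-- The Picard lattice `ℤ 𝓗ₓ ⊕ ℤ 𝓗_y ⊕ ⨁ ℤ 𝓔ᵢ` of `ℙ¹ × ℙ¹` blown up at eight points:
`(l, l', m)` stands for `l 𝓗ₓ + l' 𝓗_y + ∑ mᵢ 𝓔ᵢ`. -/
abbrev Pic : Type := ℤ × ℤ × (Fin 8 → ℤ)

def Hx : Pic := (1, 0, 0)

def Hy : Pic := (0, 1, 0)

def E (k : Fin 8) : Pic := (0, 0, Pi.single k 1)

/-- The intersection form. -/
def inter (D D' : Pic) : ℤ :=
  D.1 * D'.2.1 + D.2.1 * D'.1 - ∑ k, D.2.2 k * D'.2.2 k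

/-- The simple roots `α₀, …, α₈`. -/
def simpleRoot : Fin 9 → Pic
  | 0 => E 0 - E 1
  | 1 => Hx - Hy
  | 2 => Hy - E 0 - E 1
  | 3 => E 1 - E 2
  | 4 => E 2 - E 3
  | 5 => E 3 - E 4
  | 6 => E 4 - E 5
  | 7 => E 5 - E 6
  | 8 => E 6 - E 7

theorem inter_simpleRoot_self (i : Fin 9) : inter (simpleRoot i) (simpleRoot i) = -2 := by
  revert i
  decide

theorem inter_add (D D₁ D₂ : Pic) : inter D (D₁ + D₂) = inter D D₁ + inter D D₂ := by
  simp only [inter, Prod.fst_add, Prod.snd_add, Pi.add_apply, mul_add, Finset.sum_add_distrib]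
  ring

theorem inter_smul (D D' : Pic) (c : ℤ) : inter D (c • D') = c * inter D D' := by
  simp only [inter, Prod.smul_fst, Prod.smul_snd, Pi.smul_apply, smul_eq_mul, mul_sub,
    Finset.mul_sum, mul_add]
  congr 1
  · ring
  · exact Finset.sum_congr rfl fun k _ => by ring

/-- The map `D ↦ D + (αᵢ • D) αᵢ`. -/
def reflFun (i : Fin 9) : Pic →ₗ[ℤ] Pic where
  toFun D := D + inter (simpleRoot i) D • simpleRoot i
  map_add' D D' := by
    rw [inter_add, add_smul]
    abel
  map_smul' c D := by
    rw [inter_smul, mul_smul, RingHom.id_apply, smul_add]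

theorem reflFun_involutive (i : Fin 9) : Function.Involutive (reflFun i) := by
  intro D
  change D + inter (simpleRoot i) D • simpleRoot i +
    inter (simpleRoot i) (D + inter (simpleRoot i) D • simpleRoot i) • simpleRoot i = D
  rw [inter_add, inter_smul, inter_simpleRoot_self, add_assoc, ← add_smul]
  ring_nf

/-- The reflection of the Picard lattice in the simple root `αᵢ`. -/
def refl (i : Fin 9) : Pic ≃ₗ[ℤ] Pic := LinearEquiv.ofInvolutive (reflFun i) (reflFun_involutive i)

/-- The affine Weyl group `W(E₈⁽¹⁾)`, generated by the nine simple reflections. -/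
def affineWeylE8 : Subgroup (Pic ≃ₗ[ℤ] Pic) := Subgroup.closure (Set.range refl)

/-- The generator `wᵢ` of `W(E₈⁽¹⁾)`. -/
def w (i : Fin 9) : affineWeylE8 := ⟨refl i, Subgroup.subset_closure ⟨i, rfl⟩⟩

/-- Real roots: the Weyl group orbits of the simple roots. -/
def IsRealRoot (α : Pic) : Prop := ∃ g ∈ affineWeylE8, ∃ i, α = g (simpleRoot i)

/-! ### The parameters -/

/-- The parameters `hₓ, h_y, e₁, …, e₈`, as complex numbers representing points of
`𝕋 = ℂ / (ℤ + ℤ τ)`. -/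
@[ext] structure Param where
  hx : ℂ
  hy : ℂ
  e : Fin 8 → ℂ

/-- The pull-back `ι^*`, with values lifted from `𝕋` to `ℂ`. -/
def period (a : Param) (D : Pic) : ℂ := D.1 * a.hx + D.2.1 * a.hy + ∑ k, D.2.2 k * a.e k

/-- Generic parameters: `ι^* α ≠ 0` in `ℂ / (ℤ + ℤ τ)` for every real root `α`. -/
def IsGeneric (τ : ℂ) (a : Param) : Prop :=
  ∀ α, IsRealRoot α → ∀ m n : ℤ, period a α ≠ m + n * τ

abbrev GenericParam (τ : ℂ) : Type := {a : Param // IsGeneric τ a}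

/-! ### The functions `[t]`, `F_{ij}`, `G_{ij}` and the embedding `ι` -/

/-- The odd theta function `∑ₙ exp (π i (n + 1/2)² τ + 2 π i (n + 1/2) (t + 1/2))`. -/
noncomputable def oddTheta (τ t : ℂ) : ℂ :=
  Complex.exp (Real.pi * Complex.I * (τ / 4 + t + 1 / 2)) *
    jacobiTheta₂ (t + 1 / 2 + τ / 2) τ

/-- The functions `κ exp (c t²) ϑ(t)`, with `ϑ` the odd theta function and `κ ≠ 0`: these comprise
the odd theta function itself, in every normalization, and the Weierstrass `σ`-function
of `ℤ + ℤ τ`. -/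
def IsBracket (τ : ℂ) (br : ℂ → ℂ) : Prop :=
  ∃ κ c : ℂ, κ ≠ 0 ∧ ∀ t, br t = κ * Complex.exp (c * t ^ 2) * oddTheta τ t

/-- `F_{ij}(u)`. -/
noncomputable def F (br : ℂ → ℂ) (a : Param) (i j : Fin 8) (u : ℂ) : ℂ :=
  br (u - a.e j) * br (u + a.e j - a.hx) / (br (u - a.e i) * br (u + a.e i - a.hx))

/-- `G_{ij}(u)`. -/
noncomputable def G (br : ℂ → ℂ) (a : Param) (i j : Fin 8) (u : ℂ) : ℂ :=
  br (u - a.e j) * br (u + a.e j - a.hy) / (br (u - a.e i) * br (u + a.e i - a.hy))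

/-- Homogeneous coordinates `(X₀, X₁, Y₀, Y₁)` of the point
`ι(u) = (F₁₂(u), G₁₂(u)) = ([X₀ : X₁], [Y₀ : Y₁])` of `ℙ¹ × ℙ¹`. -/
def embed (br : ℂ → ℂ) (a : Param) (u : ℂ) : Fin 4 → ℂ :=
  ![br (u - a.e 1) * br (u + a.e 1 - a.hx), br (u - a.e 0) * br (u + a.e 0 - a.hx),
    br (u - a.e 1) * br (u + a.e 1 - a.hy), br (u - a.e 0) * br (u + a.e 0 - a.hy)]

/-! ### The explicit maps -/

/-- The transformations `(hₓ, h_y, e) ↦ (h̄ₓ, h̄_y, ē)` of the parameters. -/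
def paramMap (i : Fin 9) (a : Param) : Param :=
  match i with
  | 0 => { a with e := a.e ∘ Equiv.swap 0 1 }
  | 1 => { a with hx := a.hy, hy := a.hx }
  | 2 => { hx := a.hx + a.hy - a.e 0 - a.e 1
           hy := a.hy
           e := Function.update (Function.update a.e 0 (a.hy - a.e 1)) 1 (a.hy - a.e 0) }
  | 3 => { a with e := a.e ∘ Equiv.swap 1 2 }
  | 4 => { a with e := a.e ∘ Equiv.swap 2 3 }
  | 5 => { a with e := a.e ∘ Equiv.swap 3 4 }
  | 6 => { a with e := a.e ∘ Equiv.swap 4 5 }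
  | 7 => { a with e := a.e ∘ Equiv.swap 5 6 }
  | 8 => { a with e := a.e ∘ Equiv.swap 6 7 }

/-- The expressions `(x, y) ↦ (x̄, ȳ)`, for `x, y` in any field extension `L` of `ℂ`: they are used
for `L = ℂ` and for the field of rational functions `L = ℂ(x, y)`. -/
noncomputable def xyMap (br : ℂ → ℂ) (L : Type) [Field L] [Algebra ℂ L] (i : Fin 9) (a : Param)
    (x y : L) : L × L :=
  match i with
  | 0 => (1 / x, 1 / y)
  | 1 => (y, x)
  | 2 => (x / y, 1 / y)
  | 3 => (algebraMap ℂ L (F br a 1 2 (a.e 0)) * (x - algebraMap ℂ L (F br a 0 1 (a.e 2))),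
          algebraMap ℂ L (G br a 1 2 (a.e 0)) * (y - algebraMap ℂ L (G br a 0 1 (a.e 2))))
  | 4 => (x, y)
  | 5 => (x, y)
  | 6 => (x, y)
  | 7 => (x, y)
  | 8 => (x, y)

/-! ### Families of birational maps -/

/-- The field `ℂ(x, y)` of rational functions on `ℙ¹ × ℙ¹`. -/
abbrev K : Type := FractionRing (MvPolynomial (Fin 2) ℂ)

noncomputable def x : K := algebraMap (MvPolynomial (Fin 2) ℂ) K (MvPolynomial.X 0)

noncomputable def y : K := algebraMap (MvPolynomial (Fin 2) ℂ) K (MvPolynomial.X 1)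

/-- A birational self-map of the family of the `ℙ¹ × ℙ¹` over the generic parameters: a bijection
`base` of the parameters and, for every parameter `a`, a birational map `φ_a` from the fibre over
`a` to the fibre over `base a`, recorded as its pull-back `φ_a^* : ℂ(x̄, ȳ) → ℂ(x, y)`. -/
@[ext] structure FamilyBir (τ : ℂ) where
  base : Equiv.Perm (GenericParam τ)
  pullback : GenericParam τ → (K ≃ₐ[ℂ] K)

namespace FamilyBir

variable {τ : ℂ}

/-- Composition of maps, `(f * g) (a, p) = f (g (a, p))`; pull-backs compose the other way. -/
noncomputable instance : Mul (FamilyBir τ) :=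
  ⟨fun f g => ⟨f.base * g.base, fun a => (f.pullback (g.base a)).trans (g.pullback a)⟩⟩

noncomputable instance : One (FamilyBir τ) := ⟨⟨1, fun _ => AlgEquiv.refl⟩⟩

noncomputable instance : Inv (FamilyBir τ) := ⟨fun f => ⟨f.base⁻¹, fun a => (f.pullback (f.base⁻¹ a)).symm⟩⟩

noncomputable instance : Group (FamilyBir τ) :=
  Group.ofLeftAxioms
    (fun _ _ _ => rfl)
    (fun _ => rfl)
    (fun f => by
      refine FamilyBir.ext (inv_mul_cancel f.base) (funext fun a => AlgEquiv.ext fun z => ?_)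
      change f.pullback a ((f.pullback (f.base⁻¹ (f.base a))).symm z) = z
      rw [show f.base⁻¹ (f.base a) = a from f.base.symm_apply_apply a]
      exact (f.pullback a).apply_symm_apply z)

end FamilyBir

/-! ### Prime divisors of the blown-up surfaces and the action on Picard lattices -/

/-- Bihomogeneous polynomials of bi-degree `(m, n)` in `(X₀, X₁; Y₀, Y₁)`. -/
def IsBihomogeneous (P : MvPolynomial (Fin 4) ℂ) (m n : ℕ) : Prop :=
  ∀ d ∈ P.support, d 0 + d 1 = m ∧ d 2 + d 3 = n

/-- Passage to affine coordinates, `P(X₀, X₁, Y₀, Y₁) ↦ P(x, 1, y, 1)`. -/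
noncomputable def dehom : MvPolynomial (Fin 4) ℂ →ₐ[ℂ] K := MvPolynomial.aeval ![x, 1, y, 1]

/-- The multiplicity of `P` at `p`: the least degree occurring in the expansion of `P` at `p`. For a
bihomogeneous `P` and homogeneous coordinates `p` of a point of `ℙ¹ × ℙ¹` this is the multiplicity
at that point of the divisor `P = 0`. -/
noncomputable def mult (p : Fin 4 → ℂ) (P : MvPolynomial (Fin 4) ℂ) : ℕ∞ :=
  MvPowerSeries.order
    ((MvPolynomial.aeval (fun j => MvPolynomial.X j + MvPolynomial.C (p j)) P :
      MvPolynomial (Fin 4) ℂ) : MvPowerSeries (Fin 4) ℂ)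

/-- The local ring in `ℂ(x, y)` of the irreducible curve `Q = 0` in `ℙ¹ × ℙ¹`: the rational functions
without pole along it. -/
def curveRing (Q : MvPolynomial (Fin 4) ℂ) : Set K :=
  {f | ∃ (m n : ℕ) (A B : MvPolynomial (Fin 4) ℂ), IsBihomogeneous A m n ∧ IsBihomogeneous B m n ∧
    ¬ Q ∣ B ∧ f * dehom B = dehom A}

/-- The local ring in `ℂ(x, y)` of the exceptional curve of the blowup of `ℙ¹ × ℙ¹` at `p`: the
rational functions without pole along it. -/
def exceptionalRing (p : Fin 4 → ℂ) : Set K :=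
  {f | ∃ (m n : ℕ) (A B : MvPolynomial (Fin 4) ℂ), IsBihomogeneous A m n ∧ IsBihomogeneous B m n ∧
    B ≠ 0 ∧ mult p B ≤ mult p A ∧ f * dehom B = dehom A}

/-- `IsPrimeDivisor br a R D`: `R ⊆ ℂ(x, y)` is the local ring of a prime divisor of class `D` on
the surface `𝓧_a`, the blowup of `ℙ¹ × ℙ¹` at the eight points `ι(e₁), …, ι(e₈)`. The prime
divisors are the proper transforms of the irreducible curves of `ℙ¹ × ℙ¹` and the eight
exceptional curves. -/
inductive IsPrimeDivisor (br : ℂ → ℂ) (a : Param) : Set K → Pic → Prop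
  | curve (Q : MvPolynomial (Fin 4) ℂ) (m n : ℕ) (hQ : Irreducible Q)
      (hmn : IsBihomogeneous Q m n) :
      IsPrimeDivisor br a (curveRing Q)
        ((m : ℤ), (n : ℤ), fun k => -((mult (embed br a (a.e k)) Q).toNat : ℤ))
  | exceptional (k : Fin 8) :
      IsPrimeDivisor br a (exceptionalRing (embed br a (a.e k))) (E k)

/-- The birational map with pull-back `φ` is an isomorphism `𝓧_a → 𝓧_b`, and its push-forward on
Picard lattices is `g`. A birational map of smooth projective surfaces is an isomorphism if and only
if neither it nor its inverse contracts a curve, that is, if it matches the prime divisors of both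
surfaces; the local ring of the image of a prime divisor is the preimage under `φ` of its
local ring. -/
def IsIsoWithPushforward (br : ℂ → ℂ) (a b : Param) (φ : K ≃ₐ[ℂ] K) (g : Pic ≃ₗ[ℤ] Pic) : Prop :=
  ∀ (R : Set K) (D : Pic), IsPrimeDivisor br a R D ↔ IsPrimeDivisor br b (φ ⁻¹' R) (g D)

end E8Bir

/-! ### The odd theta function: addition formula and zeros. -/

namespace E8Bir

/-! No Coxeter relation of `W(E₈⁽¹⁾)` is verified. Inside the product of the Weyl group and
`FamilyBir τ`, the pairs `(g, f)` such that `f` acts on periods and on Picard lattices by `g` form a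
subgroup, `compatiblePairs`. The representation is the inverse of its first projection followed by
the second, so everything reduces to that projection being bijective.

Surjectivity: it suffices that each explicit map gives a compatible pair
(`isIsoWithPushforward_generator`). An isomorphism of blown-up surfaces is tested on prime divisors,
so one follows local rings and multiplicities of bihomogeneous polynomials. For `i ≠ 2` the map
lifts to an invertible linear substitution in homogeneous coordinates. The map of `w₂` is quadratic:
it contracts the lines `y = 0` and `y = ∞` and blows up the corners `(0, 0)` and `(∞, ∞)`. Its lift
`quadMap` squares to multiplication by a power of `X 2 * X 3`, and multiplicities at the corners are
the exponents of `X 2` and `X 3` in the image polynomial.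

Injectivity: an automorphism of a generic surface acting trivially on the Picard lattice is the
identity (`IsGeneric.eq_refl`). The lines of either ruling through a blown-up point are the only
prime divisors of their classes, hence preserved. Two of them make each coordinate an eigenfunction,
since a rational function without poles is constant; a third forces the eigenvalue to be 1.

The bracket enters through two facts. The addition formula expresses `[s + t][s - t]` as a 2 × 2
determinant, whose Plücker relation is the three-term relation behind `w₃`. The zeros lie in the
lattice, so genericity makes the needed brackets nonzero. -/

open Complex in
theorem oddTheta_hasSum {τ : ℂ} (hτ : 0 < τ.im) (t : ℂ) :
    HasSum (fun n : ℤ => exp (Real.pi * I * (n + 1 / 2) ^ 2 * τ +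
      2 * Real.pi * I * (n + 1 / 2) * (t + 1 / 2))) (oddTheta τ t) := by
  have h := (hasSum_jacobiTheta₂_term (t + 1 / 2 + τ / 2) hτ).mul_left
    (exp (Real.pi * I * (τ / 4 + t + 1 / 2)))
  refine h.congr_fun ?_ 
  intro n
  rw [jacobiTheta₂_term, ← Complex.exp_add]
  congr 1
  ring

/-- The even half of the lattice sum in the addition formula of the odd theta function. -/
noncomputable def thetaEven (τ x : ℂ) : ℂ := jacobiTheta₂ (2 * x) (2 * τ)

/-- The odd half of the lattice sum in the addition formula of the odd theta function. -/
noncomputable def thetaOdd (τ x : ℂ) : ℂ :=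
  Complex.exp (Real.pi * Complex.I * (τ / 2 + 2 * x)) * jacobiTheta₂ (2 * x + τ) (2 * τ)

-- Multiply the two series over half-integers `N`, `M` and use `N + M`, `N - M` as new indices.
-- These are integers of opposite parity, since their sum is the odd number `2N`. The parity of `N +
-- M` splits the double sum into two products of theta series at `2 * τ`, and the shift by `1 / 2`
-- gives the sign.
open Complex in
theorem oddTheta_add_mul_sub {τ : ℂ} (hτ : 0 < τ.im) (x y : ℂ) :
    oddTheta τ (x + y) * oddTheta τ (x - y) =
      thetaEven τ x * thetaOdd τ y - thetaOdd τ x * thetaEven τ y := by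
  have h2τ : 0 < (2 * τ).im := by simpa using hτ
  have hE (z : ℂ) : HasSum (fun n : ℤ => jacobiTheta₂_term n (2 * z) (2 * τ)) (thetaEven τ z) :=
    hasSum_jacobiTheta₂_term _ h2τ
  have hO (z : ℂ) : HasSum (fun n : ℤ => exp (Real.pi * I * (τ / 2 + 2 * z)) *
      jacobiTheta₂_term n (2 * z + τ) (2 * τ)) (thetaOdd τ z) :=
    (hasSum_jacobiTheta₂_term _ h2τ).mul_left _
  have hmul {f g : ℤ → ℂ} {s t : ℂ} (hf : HasSum f s) (hg : HasSum g t) :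
      HasSum (fun p : ℤ × ℤ => f p.1 * g p.2) (s * t) :=
    hf.mul hg (summable_mul_of_summable_norm hf.summable.norm hg.summable.norm)
  have hL := hmul (oddTheta_hasSum hτ (x + y)) (oddTheta_hasSum hτ (x - y))
  have h1 := hmul (hE x) (hO y)
  have h2 := (hmul (hO x) (hE y)).neg
  -- For indices `(n, m)`, `N + M = n + m + 1` and `N - M = n - m`. These are `(2k, 2l + 1)` on the
  -- image of `g₁` and `(2k + 1, 2l)` on that of `g₂`.
  let g₁ : ℤ × ℤ → ℤ × ℤ := fun p => (p.1 + p.2, p.1 - p.2 - 1)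
  let g₂ : ℤ × ℤ → ℤ × ℤ := fun p => (p.1 + p.2, p.1 - p.2)
  have hg₁ : Function.Injective g₁ := by
    rintro ⟨a, b⟩ ⟨c, d⟩ h
    simp only [g₁, Prod.mk.injEq] at h ⊢
    omega
  have hg₂ : Function.Injective g₂ := by
    rintro ⟨a, b⟩ ⟨c, d⟩ h
    simp only [g₂, Prod.mk.injEq] at h ⊢
    omega
  have hc : IsCompl (Set.range g₁) (Set.range g₂) := by
    constructor
    · rw [Set.disjoint_iff]
      rintro ⟨a, b⟩ ⟨⟨⟨c, d⟩, h⟩, ⟨⟨c', d'⟩, h'⟩⟩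
      simp only [g₁, g₂, Prod.mk.injEq] at h h'
      omega
    · rw [codisjoint_iff_le_sup]
      rintro ⟨a, b⟩ -
      rcases Int.even_or_odd' (a + b) with ⟨k, hk | hk⟩
      · exact Or.inr ⟨(k, a - k), by simp only [g₂, Prod.mk.injEq]; omega⟩
      · exact Or.inl ⟨(k + 1, a - k - 1), by simp only [g₁, Prod.mk.injEq]; omega⟩
  rw [sub_eq_add_neg]
  refine hL.unique (HasSum.add_isCompl hc (hg₁.hasSum_range_iff.2 (h1.congr_fun ?_))
    (hg₂.hasSum_range_iff.2 (h2.congr_fun ?_)))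
  · rintro ⟨k, l⟩
    simp only [Function.comp, g₁, jacobiTheta₂_term, ← Complex.exp_add]
    rw [Complex.exp_eq_exp_iff_exists_int]
    refine ⟨k, ?_⟩
    push_cast
    ring
  · rintro ⟨k, l⟩
    simp only [Function.comp, g₂, jacobiTheta₂_term, ← Complex.exp_add]
    rw [← mul_neg_one, ← Complex.exp_pi_mul_I, ← Complex.exp_add, Complex.exp_eq_exp_iff_exists_int]
    refine ⟨k, ?_⟩
    push_cast
    ring

open Complex in
theorem oddTheta_add_one (τ t : ℂ) : oddTheta τ (t + 1) = -oddTheta τ t := by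
  rw [oddTheta, oddTheta, show t + 1 + 1 / 2 + τ / 2 = t + 1 / 2 + τ / 2 + 1 by ring,
    jacobiTheta₂_add_left, show Real.pi * I * (τ / 4 + (t + 1) + 1 / 2) =
      Real.pi * I * (τ / 4 + t + 1 / 2) + Real.pi * I by ring, Complex.exp_add, exp_pi_mul_I]
  ring

open Complex in
theorem oddTheta_add_period (τ t : ℂ) :
    oddTheta τ (t + τ) = -exp (-Real.pi * I * (τ + 2 * t)) * oddTheta τ t := by
  rw [oddTheta, oddTheta, show t + τ + 1 / 2 + τ / 2 = t + 1 / 2 + τ / 2 + τ by ring,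
    jacobiTheta₂_add_left', ← mul_assoc, ← mul_assoc, ← Complex.exp_add,
    ← mul_neg_one (exp (-Real.pi * I * (τ + 2 * t))), ← exp_pi_mul_I, ← Complex.exp_add,
    ← Complex.exp_add]
  congr 1
  rw [Complex.exp_eq_exp_iff_exists_int]
  exact ⟨-1, by push_cast; ring⟩

theorem differentiable_oddTheta {τ : ℂ} (hτ : 0 < τ.im) : Differentiable ℂ (oddTheta τ) := by
  intro t
  have h := differentiableAt_jacobiTheta₂_fst (t + 1 / 2 + τ / 2) hτ
  have h' : DifferentiableAt ℂ (fun t : ℂ => t + 1 / 2 + τ / 2) t := by fun_prop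
  have h'' : DifferentiableAt ℂ
      (fun t : ℂ => Complex.exp (Real.pi * Complex.I * (τ / 4 + t + 1 / 2))) t := by fun_prop
  exact h''.mul (DifferentiableAt.comp (g := fun z => jacobiTheta₂ z τ) t h h')

-- The zeroth Fourier coefficient is 1: integrating over `[0, 1]` kills every other term.
open Complex in
theorem exists_jacobiTheta₂_ne_zero {τ : ℂ} (hτ : 0 < τ.im) : ∃ z, jacobiTheta₂ z τ ≠ 0 := by
  by_contra! h
  have hcont (n : ℤ) : Continuous fun x : ℝ => jacobiTheta₂_term n x τ := by
    unfold jacobiTheta₂_term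
    fun_prop
  have hint := intervalIntegral.hasSum_intervalIntegral_of_summable_norm (a := 0) (b := 1)
    (f := fun n : ℤ => (⟨fun x : ℝ => jacobiTheta₂_term n x τ, hcont n⟩ : C(ℝ, ℂ))) ?_
  · have hz : ∀ n : ℤ, n ≠ 0 → ∫ x : ℝ in (0 : ℝ)..1, jacobiTheta₂_term n x τ = 0 := by
      intro n hn
      have hc : (2 * Real.pi * I * n : ℂ) ≠ 0 := by
        simp [Real.pi_ne_zero, hn]
      simp only [jacobiTheta₂_term, Complex.exp_add]
      rw [intervalIntegral.integral_mul_const, integral_exp_mul_complex hc]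
      have : exp (2 * Real.pi * I * n) = 1 := by
        rw [mul_comm, Complex.exp_int_mul_two_pi_mul_I]
      simp [this]
    have h0 : ∫ x : ℝ in (0 : ℝ)..1, jacobiTheta₂_term 0 x τ = 1 := by
      simp [jacobiTheta₂_term]
    have hs := hasSum_single (f := fun n : ℤ => ∫ x : ℝ in (0 : ℝ)..1, jacobiTheta₂_term n x τ) 0
      (fun n hn => hz n hn)
    have := hint.unique hs
    rw [h0] at this
    have hzero : ∀ x : ℝ, ∑' n : ℤ, jacobiTheta₂_term n x τ = 0 := fun x => h x
    simp [hzero] at this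
  · refine (summable_pow_mul_jacobiTheta₂_term_bound 0 hτ 0).of_nonneg_of_le
      (fun n => norm_nonneg _) fun n => ?_
    rw [ContinuousMap.norm_le _ (by positivity)]
    intro x
    simpa using norm_jacobiTheta₂_term_le (S := 0) hτ (z := ((x : ℝ) : ℂ)) (by simp) le_rfl n

theorem exists_oddTheta_ne_zero {τ : ℂ} (hτ : 0 < τ.im) : ∃ t, oddTheta τ t ≠ 0 := by
  obtain ⟨z, hz⟩ := exists_jacobiTheta₂_ne_zero hτ
  refine ⟨z - 1 / 2 - τ / 2, mul_ne_zero (Complex.exp_ne_zero _) ?_⟩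
  ring_nf
  exact hz

/-- The right side of the addition formula is antisymmetric in its two arguments; exchanging them
fixes their sum, chosen to be a nonzero `s` of theta, and negates their difference. -/
theorem oddTheta_neg {τ : ℂ} (hτ : 0 < τ.im) (t : ℂ) : oddTheta τ (-t) = -oddTheta τ t := by
  obtain ⟨s, hs⟩ := exists_oddTheta_ne_zero hτ
  have h1 := oddTheta_add_mul_sub hτ ((s + t) / 2) ((s - t) / 2)
  have h2 := oddTheta_add_mul_sub hτ ((s - t) / 2) ((s + t) / 2)
  rw [show (s + t) / 2 + (s - t) / 2 = s by ring, show (s + t) / 2 - (s - t) / 2 = t by ring] at h1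
  rw [show (s - t) / 2 + (s + t) / 2 = s by ring, show (s - t) / 2 - (s + t) / 2 = -t by ring] at h2
  apply mul_left_cancel₀ hs
  linear_combination h1 + h2

theorem oddTheta_zero {τ : ℂ} (hτ : 0 < τ.im) : oddTheta τ 0 = 0 := by
  have h := oddTheta_neg hτ 0
  rw [neg_zero] at h
  linear_combination h / 2

/-- If `z` is a zero of the odd theta function `ϑ`, then `ϑ(p + z) / ϑ(p)` is multiplicative
in `p`. -/
theorem oddTheta_mul_of_zero {τ z : ℂ} (hτ : 0 < τ.im) (hz : oddTheta τ z = 0) {p q r s : ℂ}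
    (h : p + q = r + s) :
    oddTheta τ (p + z) * oddTheta τ (q + z) * (oddTheta τ r * oddTheta τ s) =
      oddTheta τ p * oddTheta τ q * (oddTheta τ (r + z) * oddTheta τ (s + z)) := by
  -- Write `[s t]` for the determinant in the addition formula and put `W = z - X`. In this
  -- parametrization the claim becomes `[X Y][Z W] = [X Z][Y W]`. This is the Plücker relation with
  -- its third term removed, since `[X W]` contains the factor `oddTheta τ z = 0`.
  obtain ⟨X, Y, Z, rfl, rfl, rfl, rfl⟩ :
      ∃ X Y Z, p = Z - X ∧ q = -(Z + X) ∧ r = Y - X ∧ s = -(Y + X) :=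
    ⟨-(p + q) / 2, (r - s) / 2, (p - q) / 2, by ring, by ring, by linear_combination -h / 2,
      by linear_combination -h / 2⟩
  have h1 := oddTheta_add_mul_sub hτ X Y
  have h2 := oddTheta_add_mul_sub hτ Z (z - X)
  have h3 := oddTheta_add_mul_sub hτ X Z
  have h4 := oddTheta_add_mul_sub hτ Y (z - X)
  have h5 := oddTheta_add_mul_sub hτ X (z - X)
  rw [show X + (z - X) = z by ring, hz, zero_mul] at h5
  rw [show X - Y = -(Y - X) by ring, oddTheta_neg hτ] at h1
  rw [show X - Z = -(Z - X) by ring, oddTheta_neg hτ] at h3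
  rw [show Z + (z - X) = Z - X + z by ring, show Z - (z - X) = -(-(Z + X) + z) by ring,
    oddTheta_neg hτ] at h2
  rw [show Y + (z - X) = Y - X + z by ring, show Y - (z - X) = -(-(Y + X) + z) by ring,
    oddTheta_neg hτ] at h4
  rw [show X + Y = Y + X by ring] at h1
  rw [show X + Z = Z + X by ring] at h3
  rw [oddTheta_neg hτ (Z + X), oddTheta_neg hτ (Y + X)]
  have e1 := congrArg₂ (· * ·) h1 h2
  have e2 := congrArg₂ (· * ·) h3 h4
  linear_combination -e1 + e2 - (thetaEven τ Y * thetaOdd τ Z - thetaOdd τ Y * thetaEven τ Z) * h5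

/-- By multiplicativity the logarithmic derivative of `ϑ(p + z) / ϑ(p)` is constant, so the ratio is
an exponential near a point where `ϑ` does not vanish; the identity theorem extends this to all `p`.
-/
theorem exists_oddTheta_add_eq_of_zero {τ z : ℂ} (hτ : 0 < τ.im) (hz : oddTheta τ z = 0) :
    ∃ u β C : ℂ, oddTheta τ u ≠ 0 ∧ C ≠ 0 ∧
      ∀ p, oddTheta τ (p + z) = C * Complex.exp (β * p) * oddTheta τ p := by
  set f := oddTheta τ with hf
  have hd : Differentiable ℂ f := differentiable_oddTheta hτ
  have ha : AnalyticOnNhd ℂ f Set.univ := fun t _ => hd.analyticAt t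
  have hdz : Differentiable ℂ fun p => f (p + z) := hd.comp (by fun_prop)
  obtain ⟨t₀, ht₀⟩ := exists_oddTheta_ne_zero hτ
  obtain ⟨u, hu, huz⟩ : ∃ u, f u ≠ 0 ∧ f (u + z) ≠ 0 := by
    have h1 : ∀ᶠ t in nhdsWithin 0 {0}ᶜ, f t ≠ 0 := by
      refine (ha 0 trivial).eventually_eq_zero_or_eventually_ne_zero.resolve_left fun h => ht₀ ?_
      exact congrFun (AnalyticOnNhd.eq_of_eventuallyEq ha (g := 0) (fun _ _ => analyticAt_const) h) t₀
    have h2 : ∀ᶠ t in nhdsWithin 0 {0}ᶜ, f (t + z) ≠ 0 := by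
      refine (hdz.analyticAt 0).eventually_eq_zero_or_eventually_ne_zero.resolve_left
        fun h => ht₀ ?_
      have := congrFun (AnalyticOnNhd.eq_of_eventuallyEq (f := fun p => f (p + z))
        (fun t _ => hdz.analyticAt t) (g := 0) (fun _ _ => analyticAt_const) h) (t₀ - z)
      simpa using this
    exact (h1.and h2).exists
  -- The logarithmic derivative of `f (p + z) / f p` at `p = u`. Next, `hW` states its constancy
  -- with denominators cleared; it comes from differentiating at `t = 0` the product identity for `p
  -- + (u + t) = u + (p + t)`.
  set β := (deriv f (u + z) * f u - f (u + z) * deriv f u) / (f u * f (u + z)) with hβ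
  have hW (p : ℂ) : deriv f (p + z) * f p - f (p + z) * deriv f p = β * (f p * f (p + z)) := by
    have hL : HasDerivAt (fun t : ℂ => f (p + z) * f (u + t + z) * (f u * f (p + t)))
        (f (p + z) * deriv f (u + z) * (f u * f p) +
          f (p + z) * f (u + z) * (f u * deriv f p)) 0 := by
      have e1 : HasDerivAt (fun t : ℂ => f (u + t + z)) (deriv f (u + z)) 0 := by
        have := HasDerivAt.comp_const_add (f := fun t => f (t + z)) u 0
          (HasDerivAt.comp_add_const (f := f) (u + 0) z (hd _).hasDerivAt)
        simpa using this
      have e2 : HasDerivAt (fun t : ℂ => f (p + t)) (deriv f p) 0 := by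
        simpa using HasDerivAt.comp_const_add (f := f) p 0 (hd _).hasDerivAt
      exact ((e1.const_mul (f (p + z))).mul (e2.const_mul (f u))).congr_deriv (by simp)
    have hR : HasDerivAt (fun t : ℂ => f p * f (u + t) * (f (u + z) * f (p + t + z)))
        (f p * deriv f u * (f (u + z) * f (p + z)) +
          f p * f u * (f (u + z) * deriv f (p + z))) 0 := by
      have e1 : HasDerivAt (fun t : ℂ => f (p + t + z)) (deriv f (p + z)) 0 := by
        have := HasDerivAt.comp_const_add (f := fun t => f (t + z)) p 0
          (HasDerivAt.comp_add_const (f := f) (p + 0) z (hd _).hasDerivAt)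
        simpa using this
      have e2 : HasDerivAt (fun t : ℂ => f (u + t)) (deriv f u) 0 := by
        simpa using HasDerivAt.comp_const_add (f := f) u 0 (hd _).hasDerivAt
      exact ((e2.const_mul (f p)).mul (e1.const_mul (f (u + z)))).congr_deriv (by simp)
    have heq : (fun t : ℂ => f (p + z) * f (u + t + z) * (f u * f (p + t))) =
        fun t : ℂ => f p * f (u + t) * (f (u + z) * f (p + t + z)) :=
      funext fun t => oddTheta_mul_of_zero hτ hz (by ring)
    have := (heq ▸ hL).unique hR
    rw [hβ, div_mul_eq_mul_div, eq_div_iff (mul_ne_zero hu huz)]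
    linear_combination -this
  obtain ⟨ε, hε, hball⟩ := Metric.eventually_nhds_iff_ball.1 (hd.continuous.continuousAt.eventually_ne hu)
  have hder (p : ℂ) (hp : p ∈ Metric.ball u ε) :
      HasDerivAt (fun p => f (p + z) * Complex.exp (-β * p) / f p) 0 p := by
    have e1 : HasDerivAt (fun t : ℂ => f (t + z)) (deriv f (p + z)) p :=
      HasDerivAt.comp_add_const (f := f) p z (hd _).hasDerivAt
    have e2 : HasDerivAt (fun t : ℂ => Complex.exp (-β * t)) (Complex.exp (-β * p) * (-β)) p := by
      simpa using ((hasDerivAt_id p).const_mul (-β)).cexp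
    refine ((e1.mul e2).div (hd p).hasDerivAt (hball p hp)).congr_deriv ?_
    rw [div_eq_zero_iff]
    left
    simp only [Pi.mul_apply]
    linear_combination Complex.exp (-β * p) * hW p
  have hconst (p : ℂ) (hp : p ∈ Metric.ball u ε) :=
    Metric.isOpen_ball.is_const_of_deriv_eq_zero (convex_ball u ε).isPreconnected
      (fun q hq => (hder q hq).differentiableAt.differentiableWithinAt)
      (fun q hq => (hder q hq).deriv) hp (Metric.mem_ball_self hε)
  set C := f (u + z) * Complex.exp (-β * u) / f u with hC
  refine ⟨u, β, C, hu, div_ne_zero (mul_ne_zero huz (Complex.exp_ne_zero _)) hu, fun p => ?_⟩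
  have hg : Differentiable ℂ fun p => C * Complex.exp (β * p) * f p := by fun_prop
  refine congrFun (AnalyticOnNhd.eq_of_eventuallyEq (f := fun p => f (p + z))
    (g := fun p => C * Complex.exp (β * p) * f p) (z₀ := u)
    (fun t _ => hdz.analyticAt t) (fun t _ => hg.analyticAt t) ?_) p
  filter_upwards [Metric.ball_mem_nhds u hε] with q hq
  rw [← hconst q hq]
  have := hball q hq
  field_simp
  rw [mul_assoc, ← Complex.exp_add]
  simp

open Complex in
/-- The zeros of the odd theta function are points of the lattice. -/
theorem exists_eq_of_oddTheta_eq_zero {τ z : ℂ} (hτ : 0 < τ.im) (hz : oddTheta τ z = 0) :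
    ∃ m n : ℤ, z = m + n * τ := by
  obtain ⟨u, β, C, hu, hC, h⟩ := exists_oddTheta_add_eq_of_zero hτ hz
  have hE := Complex.exp_ne_zero (β * u)
  have h0 := h u
  have h1 := h (u + 1)
  rw [show u + 1 + z = u + z + 1 by ring, oddTheta_add_one, oddTheta_add_one, h0, mul_add β,
    Complex.exp_add, mul_one] at h1
  -- Translation by 1 has the same multiplier at `u` and `u + z`, whereas for translation by `τ` the
  -- multipliers differ by `exp (-2πiz)`. Comparison with the exponential gives `exp β = 1` and `exp
  -- (βτ) = exp (-2πiz)`, which place `z` in the lattice.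
  have hβ : exp β = 1 := by
    apply mul_left_cancel₀ (mul_ne_zero (mul_ne_zero hC hE) hu)
    linear_combination h1
  have h2 := h (u + τ)
  rw [show u + τ + z = u + z + τ by ring, oddTheta_add_period, oddTheta_add_period, h0, mul_add β,
    Complex.exp_add, show -Real.pi * I * (τ + 2 * (u + z)) =
      -Real.pi * I * (τ + 2 * u) + -2 * Real.pi * I * z by ring, Complex.exp_add] at h2
  have hβτ : exp (-2 * Real.pi * I * z) = exp (β * τ) := by
    apply mul_left_cancel₀ (mul_ne_zero (mul_ne_zero (mul_ne_zero hC hE) hu)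
      (Complex.exp_ne_zero (-Real.pi * I * (τ + 2 * u))))
    linear_combination -h2
  obtain ⟨k, hk⟩ := Complex.exp_eq_one_iff.1 hβ
  obtain ⟨l, hl⟩ := Complex.exp_eq_exp_iff_exists_int.1 hβτ
  refine ⟨-l, -k, ?_⟩
  apply mul_left_cancel₀ (Complex.two_pi_I_ne_zero)
  rw [hk] at hl
  push_cast
  linear_combination -hl

/-- The function `[u - e][u + e - h]`. -/
def pair (br : ℂ → ℂ) (h u e : ℂ) : ℂ := br (u - e) * br (u + e - h)

/-! ### General brackets and the three-term relation. -/

namespace IsBracket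

variable {τ : ℂ} {br : ℂ → ℂ}

protected theorem map_zero (h : IsBracket τ br) (hτ : 0 < τ.im) : br 0 = 0 := by
  obtain ⟨κ, c, -, h⟩ := h
  rw [h, oddTheta_zero hτ, mul_zero]

protected theorem map_neg (h : IsBracket τ br) (hτ : 0 < τ.im) (t : ℂ) : br (-t) = -br t := by
  obtain ⟨κ, c, -, h⟩ := h
  rw [h, h, oddTheta_neg hτ, neg_sq, mul_neg]

theorem ne_zero (h : IsBracket τ br) (hτ : 0 < τ.im) {t : ℂ}
    (ht : ∀ m n : ℤ, t ≠ m + n * τ) : br t ≠ 0 := by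
  obtain ⟨κ, c, hκ, h⟩ := h
  rw [h]
  refine mul_ne_zero (mul_ne_zero hκ (Complex.exp_ne_zero _)) fun h0 => ?_
  obtain ⟨m, n, hmn⟩ := exists_eq_of_oddTheta_eq_zero hτ h0
  exact ht m n hmn

/-- Because `(s + t)² + (s - t)² = 2s² + 2t²`, the Gaussian factor splits and is absorbed into the
two theta halves. -/
theorem add_mul_sub (h : IsBracket τ br) (hτ : 0 < τ.im) :
    ∃ A B : ℂ → ℂ, ∀ s t, br (s + t) * br (s - t) = A s * B t - B s * A t := by
  obtain ⟨κ, c, -, h⟩ := h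
  refine ⟨fun s => κ * Complex.exp (2 * c * s ^ 2) * thetaEven τ s,
    fun s => κ * Complex.exp (2 * c * s ^ 2) * thetaOdd τ s, fun s t => ?_⟩
  have he : Complex.exp (c * (s + t) ^ 2) * Complex.exp (c * (s - t) ^ 2) =
      Complex.exp (2 * c * s ^ 2) * Complex.exp (2 * c * t ^ 2) := by
    rw [← Complex.exp_add, ← Complex.exp_add]
    ring_nf
  rw [h, h]
  linear_combination κ ^ 2 * oddTheta τ (s + t) * oddTheta τ (s - t) * he +
    κ ^ 2 * (Complex.exp (2 * c * s ^ 2) * Complex.exp (2 * c * t ^ 2)) *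
      oddTheta_add_mul_sub hτ s t

theorem pair_self (h : IsBracket τ br) (hτ : 0 < τ.im) (k u : ℂ) : pair br k u u = 0 := by
  rw [pair, sub_self, h.map_zero hτ, zero_mul]

theorem pair_swap (h : IsBracket τ br) (hτ : 0 < τ.im) (k u e : ℂ) :
    pair br k e u = -pair br k u e := by
  rw [pair, pair, ← neg_sub, h.map_neg hτ, add_comm, neg_mul]

/-- The three-term relation of Weierstrass. -/
theorem three_term (h : IsBracket τ br) (hτ : 0 < τ.im) (k u₁ u₂ u₃ u₄ : ℂ) :
    pair br k u₁ u₂ * pair br k u₃ u₄ - pair br k u₁ u₃ * pair br k u₂ u₄ +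
      pair br k u₁ u₄ * pair br k u₂ u₃ = 0 := by
  obtain ⟨A, B, hAB⟩ := h.add_mul_sub hτ
  -- With arguments centred at `k / 2`, each `pair` is a 2 × 2 determinant, and the claim is the
  -- Plücker relation for four vectors in the plane.
  have key (u e : ℂ) : pair br k u e =
      A (u - k / 2) * B (e - k / 2) - B (u - k / 2) * A (e - k / 2) := by
    rw [← hAB, pair, mul_comm]
    ring_nf
  simp only [key]
  ring

end IsBracket

end E8Bir

/-! ### Bihomogeneous polynomials. -/

namespace E8Bir

open MvPolynomial

namespace IsBihomogeneous

variable {P Q : MvPolynomial (Fin 4) ℂ} {m n m' n' : ℕ}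

protected theorem zero (m n : ℕ) : IsBihomogeneous 0 m n := by
  intro d hd
  simp at hd

protected theorem add (hP : IsBihomogeneous P m n) (hQ : IsBihomogeneous Q m n) :
    IsBihomogeneous (P + Q) m n := by
  classical
  intro d hd
  rcases Finset.mem_union.1 (support_add hd) with h | h
  exacts [hP d h, hQ d h]

protected theorem sum {ι : Type*} (s : Finset ι) (f : ι → MvPolynomial (Fin 4) ℂ)
    (h : ∀ i ∈ s, IsBihomogeneous (f i) m n) : IsBihomogeneous (∑ i ∈ s, f i) m n :=
  Finset.sum_induction f (IsBihomogeneous · m n) (fun _ _ => IsBihomogeneous.add) (.zero m n) h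

protected theorem mul (hP : IsBihomogeneous P m n) (hQ : IsBihomogeneous Q m' n') :
    IsBihomogeneous (P * Q) (m + m') (n + n') := by
  classical
  intro d hd
  obtain ⟨a, ha, b, hb, rfl⟩ := Finset.mem_add.1 (support_mul P Q hd)
  have h1 := hP a ha
  have h2 := hQ b hb
  simp only [Finsupp.add_apply]
  omega

protected theorem C (c : ℂ) : IsBihomogeneous (C c) 0 0 := by
  intro d hd
  rw [mem_support_iff, coeff_C] at hd
  obtain rfl : 0 = d := by
    by_contra h
    simp [h] at hd
  simp

theorem X_left {j : Fin 4} (hj : j = 0 ∨ j = 1) : IsBihomogeneous (X j) 1 0 := by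
  intro d hd
  obtain rfl : d = Finsupp.single j 1 := by simpa [support_X] using hd
  rcases hj with rfl | rfl <;> simp

theorem X_right {j : Fin 4} (hj : j = 2 ∨ j = 3) : IsBihomogeneous (X j) 0 1 := by
  intro d hd
  obtain rfl : d = Finsupp.single j 1 := by simpa [support_X] using hd
  rcases hj with rfl | rfl <;> simp

theorem C_mul (c : ℂ) (hP : IsBihomogeneous P m n) :
    IsBihomogeneous (C c * P) m n := by
  simpa using (IsBihomogeneous.C c).mul hP

protected theorem sub (hP : IsBihomogeneous P m n) (hQ : IsBihomogeneous Q m n) :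
    IsBihomogeneous (P - Q) m n := by
  simpa [sub_eq_add_neg] using hP.add (hQ.C_mul (-1))

protected theorem pow (hP : IsBihomogeneous P m n) (k : ℕ) : IsBihomogeneous (P ^ k) (k * m) (k * n) := by
  induction k with
  | zero => simpa using IsBihomogeneous.C 1
  | succ k ih =>
    rw [pow_succ, add_mul, add_mul, one_mul, one_mul]
    exact ih.mul hP

theorem inj (hP : IsBihomogeneous P m n) (h0 : P ≠ 0) (hP' : IsBihomogeneous P m' n') :
    m = m' ∧ n = n' := by
  obtain ⟨d, hd⟩ := support_nonempty.2 h0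
  have h1 := hP d hd
  have h2 := hP' d hd
  omega

/-- Substitution in a bihomogeneous polynomial of polynomials which are themselves
bihomogeneous. -/
protected theorem aeval {v : Fin 4 → MvPolynomial (Fin 4) ℂ} {a b c d : ℕ} (hP : IsBihomogeneous P m n)
    (h0 : IsBihomogeneous (v 0) a b) (h1 : IsBihomogeneous (v 1) a b)
    (h2 : IsBihomogeneous (v 2) c d) (h3 : IsBihomogeneous (v 3) c d) :
    IsBihomogeneous (aeval v P) (m * a + n * c) (m * b + n * d) := by
  rw [aeval_def, eval₂_eq', algebraMap_eq]
  refine .sum _ _ fun e he => ?_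
  rw [Fin.prod_univ_four]
  obtain ⟨rfl, rfl⟩ := hP e he
  convert C_mul (P.coeff e) ((((h0.pow (e 0)).mul (h1.pow (e 1))).mul (h2.pow (e 2))).mul
    (h3.pow (e 3))) using 1 <;> ring

/-- The values of a bihomogeneous polynomial at rescaled arguments. -/
theorem aeval_scale {R : Type*} [CommRing R] [Algebra ℂ R] {v v' : Fin 4 → R} {s t : R}
    (hP : IsBihomogeneous P m n) (h0 : v' 0 = s * v 0) (h1 : v' 1 = s * v 1)
    (h2 : v' 2 = t * v 2) (h3 : v' 3 = t * v 3) :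
    aeval v' P = s ^ m * t ^ n * aeval v P := by
  rw [aeval_def, aeval_def, eval₂_eq', eval₂_eq', Finset.mul_sum]
  refine Finset.sum_congr rfl fun e he => ?_
  rw [Fin.prod_univ_four, Fin.prod_univ_four, h0, h1, h2, h3]
  obtain ⟨rfl, rfl⟩ := hP e he
  ring

end IsBihomogeneous

/-! ### Factors of bihomogeneous polynomials -/

section Weighted

variable {σ : Type*} (ω : σ → ℕ)

/-- The substitution `X j ↦ X j * T ^ ω j`. -/
noncomputable def weightHom : MvPolynomial σ ℂ →ₐ[ℂ] Polynomial (MvPolynomial σ ℂ) :=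
  aeval fun j => Polynomial.C (X j) * Polynomial.X ^ ω j

theorem weightHom_monomial (d : σ →₀ ℕ) (c : ℂ) :
    weightHom ω (monomial d c) =
      Polynomial.C (monomial d c) * Polynomial.X ^ Finsupp.weight ω d := by
  rw [weightHom, aeval_monomial, Finsupp.weight_apply]
  simp only [Finsupp.prod, Finsupp.sum, mul_pow, Finset.prod_mul_distrib, ← pow_mul,
    Finset.prod_pow_eq_pow_sum, smul_eq_mul, mul_comm (ω _)]
  rw [← mul_assoc]
  congr 1
  rw [monomial_eq, Finsupp.prod, map_mul, map_prod]
  simp only [map_pow]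
  rfl

/-- The extra variable records the weight, turning homogeneity into a statement on degrees in one
variable. -/
theorem coeff_weightHom (P : MvPolynomial σ ℂ) (k : ℕ) :
    (weightHom ω P).coeff k = weightedHomogeneousComponent ω k P := by
  classical
  induction P using MvPolynomial.induction_on' with
  | monomial d c =>
    rw [weightHom_monomial, Polynomial.coeff_C_mul, Polynomial.coeff_X_pow]
    ext e
    rw [coeff_weightedHomogeneousComponent]
    by_cases h : k = Finsupp.weight ω d
    · rw [if_pos h, mul_one, coeff_monomial]
      split_ifs <;> simp_all
    · rw [if_neg h, mul_zero, coeff_zero, coeff_monomial]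
      split_ifs with h1 h2
      · subst h2
        exact absurd h1.symm h
      · rfl
      · rfl
  | add p q hp hq => rw [map_add, Polynomial.coeff_add, hp, hq, map_add]

theorem weightHom_injective : Function.Injective (weightHom (σ := σ) ω) := by
  rw [injective_iff_map_eq_zero]
  intro P hP
  ext d
  have := congrArg (coeff d) (coeff_weightHom ω P (Finsupp.weight ω d))
  classical
  rw [hP, coeff_weightedHomogeneousComponent, if_pos rfl] at this
  simpa using this.symm

/-- The product becomes a monomial in the extra variable, with equal degree and trailing degree.
Both are additive over a domain, so they must agree for each factor. -/
theorem isWeightedHomogeneous_of_mul {P Q : MvPolynomial σ ℂ} {k : ℕ}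
    (h : IsWeightedHomogeneous ω (P * Q) k) (h0 : P * Q ≠ 0) :
    ∃ l, IsWeightedHomogeneous ω P l := by
  classical
  have hP : weightHom ω P ≠ 0 := by
    rw [Ne, map_eq_zero_iff _ (weightHom_injective ω)]
    exact left_ne_zero_of_mul h0
  have hQ : weightHom ω Q ≠ 0 := by
    rw [Ne, map_eq_zero_iff _ (weightHom_injective ω)]
    exact right_ne_zero_of_mul h0
  have hPQ : weightHom ω P * weightHom ω Q = Polynomial.C (P * Q) * Polynomial.X ^ k := by
    rw [← map_mul]
    ext1 j
    rw [coeff_weightHom, Polynomial.coeff_C_mul, Polynomial.coeff_X_pow]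
    by_cases hj : j = k
    · rw [if_pos hj, mul_one, hj, h.weightedHomogeneousComponent_same]
    · rw [if_neg hj, mul_zero, h.weightedHomogeneousComponent_ne _ hj]
  have h1 := Polynomial.natDegree_mul hP hQ
  have h2 := Polynomial.natTrailingDegree_mul hP hQ
  rw [hPQ, Polynomial.natDegree_C_mul_X_pow _ _ h0] at h1
  rw [hPQ, Polynomial.C_mul_X_pow_eq_monomial, Polynomial.natTrailingDegree_monomial h0] at h2
  have h3 := Polynomial.natTrailingDegree_le_natDegree (weightHom ω P)
  have h4 := Polynomial.natTrailingDegree_le_natDegree (weightHom ω Q)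
  refine ⟨(weightHom ω P).natDegree, fun d hd => ?_⟩
  by_contra hne
  have hcoeff := congrArg (coeff d) (coeff_weightHom ω P (Finsupp.weight ω d))
  rw [coeff_weightedHomogeneousComponent, if_pos rfl] at hcoeff
  have hz : (weightHom ω P).coeff (Finsupp.weight ω d) = 0 := by
    rcases lt_or_gt_of_ne hne with hlt | hlt
    · exact Polynomial.coeff_eq_zero_of_lt_natTrailingDegree (by omega)
    · exact Polynomial.coeff_eq_zero_of_natDegree_lt hlt
  rw [hz, coeff_zero] at hcoeff
  exact hd hcoeff.symm

end Weighted

theorem isBihomogeneous_iff {P : MvPolynomial (Fin 4) ℂ} {m n : ℕ} :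
    IsBihomogeneous P m n ↔ IsWeightedHomogeneous ![1, 1, 0, 0] P m ∧
      IsWeightedHomogeneous ![0, 0, 1, 1] P n := by
  simp only [IsBihomogeneous, IsWeightedHomogeneous, mem_support_iff, Finsupp.weight_apply]
  have h (d : Fin 4 →₀ ℕ) (w : Fin 4 → ℕ) : (d.sum fun i c => c • w i) =
      d 0 * w 0 + d 1 * w 1 + d 2 * w 2 + d 3 * w 3 := by
    rw [Finsupp.sum_fintype _ _ (by simp), Fin.sum_univ_four]
    simp
  simp only [h]
  simp [forall_and]

theorem IsBihomogeneous.of_mul {P Q : MvPolynomial (Fin 4) ℂ} {m n : ℕ}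
    (h : IsBihomogeneous (P * Q) m n) (h0 : P * Q ≠ 0) : ∃ m' n', IsBihomogeneous P m' n' := by
  rw [isBihomogeneous_iff] at h
  obtain ⟨m', h1⟩ := isWeightedHomogeneous_of_mul _ h.1 h0
  obtain ⟨n', h2⟩ := isWeightedHomogeneous_of_mul _ h.2 h0
  exact ⟨m', n', isBihomogeneous_iff.2 ⟨h1, h2⟩⟩

theorem IsBihomogeneous.of_dvd {P Q : MvPolynomial (Fin 4) ℂ} {m n : ℕ}
    (h : IsBihomogeneous Q m n) (h0 : Q ≠ 0) (hPQ : P ∣ Q) : ∃ m' n', IsBihomogeneous P m' n' := by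
  obtain ⟨R, rfl⟩ := hPQ
  exact h.of_mul h0

/-! ### Homogenization -/

theorem algebraMap_K_injective :
    Function.Injective (algebraMap (MvPolynomial (Fin 2) ℂ) K) :=
  IsFractionRing.injective _ _

theorem dehom_eq (P : MvPolynomial (Fin 4) ℂ) :
    dehom P = algebraMap (MvPolynomial (Fin 2) ℂ) K (aeval ![X 0, 1, X 1, 1] P) := by
  have h : dehom = (IsScalarTower.toAlgHom ℂ (MvPolynomial (Fin 2) ℂ) K).comp
      (aeval ![X 0, 1, X 1, 1]) := by
    ext j
    fin_cases j <;> simp [dehom, x, y]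
  rw [h]
  rfl

/-- Once the bidegree is known, `P` is recovered in the fraction field as `X₁ᵐ X₃ⁿ P(X₀/X₁, 1,
X₂/X₃, 1)`. -/
theorem IsBihomogeneous.eq_zero_of_dehom {P : MvPolynomial (Fin 4) ℂ} {m n : ℕ}
    (hP : IsBihomogeneous P m n) (h : dehom P = 0) : P = 0 := by
  rw [dehom_eq, map_eq_zero_iff _ algebraMap_K_injective] at h
  let R := FractionRing (MvPolynomial (Fin 4) ℂ)
  let ξ : Fin 4 → R := fun j => algebraMap (MvPolynomial (Fin 4) ℂ) R (X j)
  have hξ (j : Fin 4) : ξ j ≠ 0 := by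
    rw [Ne, map_eq_zero_iff _ (IsFractionRing.injective (MvPolynomial (Fin 4) ℂ) R)]
    exact X_ne_zero j
  have h1 : aeval ![ξ 0 / ξ 1, 1, ξ 2 / ξ 3, 1] P = 0 := by
    have : aeval (R := ℂ) ![ξ 0 / ξ 1, 1, ξ 2 / ξ 3, 1] =
        (aeval (R := ℂ) ![ξ 0 / ξ 1, ξ 2 / ξ 3]).comp
          (aeval (![X 0, 1, X 1, 1] : Fin 4 → MvPolynomial (Fin 2) ℂ)) := by
      ext j
      fin_cases j <;> simp
    rw [this, AlgHom.comp_apply, h, map_zero]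
  have h2 : aeval ξ P = ξ 1 ^ m * ξ 3 ^ n * aeval ![ξ 0 / ξ 1, 1, ξ 2 / ξ 3, 1] P := by
    apply hP.aeval_scale
    · simp [mul_div_cancel₀ _ (hξ 1)]
    · simp
    · simp [mul_div_cancel₀ _ (hξ 3)]
    · simp
  have h3 : aeval ξ P = algebraMap (MvPolynomial (Fin 4) ℂ) R P := by
    have : aeval ξ = IsScalarTower.toAlgHom ℂ (MvPolynomial (Fin 4) ℂ) R := by
      ext j
      simp [ξ]
    rw [this]
    rfl
  rw [h1, mul_zero, h3, map_eq_zero_iff _ (IsFractionRing.injective _ _)] at h2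
  exact h2

theorem IsBihomogeneous.eq_of_dehom {P Q : MvPolynomial (Fin 4) ℂ} {m n : ℕ}
    (hP : IsBihomogeneous P m n) (hQ : IsBihomogeneous Q m n) (h : dehom P = dehom Q) : P = Q := by
  rw [← sub_eq_zero]
  exact (hP.sub hQ).eq_zero_of_dehom (by rw [map_sub, h, sub_self])

@[simp] theorem dehom_X_zero : dehom (X 0) = x := by simp [dehom]

@[simp] theorem dehom_X_one : dehom (X 1) = 1 := by simp [dehom]

@[simp] theorem dehom_X_two : dehom (X 2) = y := by simp [dehom]

@[simp] theorem dehom_X_three : dehom (X 3) = 1 := by simp [dehom]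

@[simp] theorem dehom_C (c : ℂ) : dehom (C c) = algebraMap ℂ K c := by
  rw [dehom, aeval_C]

/-- All large bidegrees are allowed, so that a numerator and a denominator can be given a common
one. -/
theorem exists_homogenization (f : MvPolynomial (Fin 2) ℂ) :
    ∃ N : ℕ, ∀ m n, N ≤ m → N ≤ n →
      ∃ A, IsBihomogeneous A m n ∧ dehom A = algebraMap (MvPolynomial (Fin 2) ℂ) K f := by
  induction f using MvPolynomial.induction_on with
  | C c =>
    refine ⟨0, fun m n _ _ => ⟨C c * (X 1 ^ m * X 3 ^ n), ?_, ?_⟩⟩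
    · simpa using (((IsBihomogeneous.X_left (j := 1) (by decide)).pow m).mul
        ((IsBihomogeneous.X_right (j := 3) (by decide)).pow n)).C_mul c
    · simp only [map_mul, map_pow, dehom_X_one, dehom_X_three, one_pow, mul_one, dehom_C]
      exact IsScalarTower.algebraMap_apply ℂ (MvPolynomial (Fin 2) ℂ) K c
  | add p q hp hq =>
    obtain ⟨N, hN⟩ := hp
    obtain ⟨N', hN'⟩ := hq
    refine ⟨max N N', fun m n hm hn => ?_⟩
    obtain ⟨A, hA, hA'⟩ := hN m n (by omega) (by omega)
    obtain ⟨B, hB, hB'⟩ := hN' m n (by omega) (by omega)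
    exact ⟨A + B, hA.add hB, by rw [map_add, map_add, hA', hB']⟩
  | mul_X p j hp =>
    obtain ⟨N, hN⟩ := hp
    refine ⟨N + 1, fun m n hm hn => ?_⟩
    obtain ⟨m, rfl⟩ : ∃ m', m = m' + 1 := ⟨m - 1, by omega⟩
    obtain ⟨n, rfl⟩ : ∃ n', n = n' + 1 := ⟨n - 1, by omega⟩
    obtain ⟨A, hA, hA'⟩ := hN m n (by omega) (by omega)
    fin_cases j
    · refine ⟨A * X 0 * X 3, ?_, ?_⟩
      · exact (hA.mul (.X_left (by decide))).mul (.X_right (by decide))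
      · simp [hA', x]
    · refine ⟨A * X 1 * X 2, ?_, ?_⟩
      · exact (hA.mul (.X_left (by decide))).mul (.X_right (by decide))
      · simp [hA', y]

/-- Every rational function is a quotient of coprime bihomogeneous polynomials. -/
theorem exists_bihomogeneous_fraction (f : K) :
    ∃ (m n : ℕ) (A B : MvPolynomial (Fin 4) ℂ), IsBihomogeneous A m n ∧ IsBihomogeneous B m n ∧
      B ≠ 0 ∧ IsRelPrime A B ∧ f * dehom B = dehom A := by
  obtain ⟨p, q, hq, rfl⟩ := IsFractionRing.div_surjective (A := MvPolynomial (Fin 2) ℂ) f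
  have hq0 : algebraMap (MvPolynomial (Fin 2) ℂ) K q ≠ 0 := by
    rw [Ne, map_eq_zero_iff _ algebraMap_K_injective]
    exact nonZeroDivisors.ne_zero hq
  obtain ⟨N, hN⟩ := exists_homogenization p
  obtain ⟨N', hN'⟩ := exists_homogenization q
  obtain ⟨A, hA, hA'⟩ := hN (max N N') (max N N') (by omega) (by omega)
  obtain ⟨B, hB, hB'⟩ := hN' (max N N') (max N N') (by omega) (by omega)
  have hB0 : B ≠ 0 := by
    rintro rfl
    rw [map_zero] at hB'
    exact hq0 hB'.symm
  have hAB : algebraMap (MvPolynomial (Fin 2) ℂ) K p / algebraMap _ K q * dehom B = dehom A := by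
    rw [hA', hB', div_mul_cancel₀ _ hq0]
  -- Reduction to coprime factors needs a nonzero polynomial; the zero function is written as `0 /
  -- 1` instead.
  obtain rfl | hA0 := eq_or_ne A 0
  · refine ⟨0, 0, 0, 1, .zero 0 0, .C 1, one_ne_zero, isRelPrime_one_right, ?_⟩
    rw [map_zero] at hAB ⊢
    rw [map_one, mul_one]
    exact (mul_eq_zero.1 hAB).resolve_right (by rwa [hB'])
  obtain ⟨A', B', D, hrel, rfl, rfl⟩ := UniqueFactorizationMonoid.exists_reduced_factors A hA0 B
  obtain ⟨m₁, n₁, h₁⟩ := hA.of_mul hA0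
  obtain ⟨m₂, n₂, h₂⟩ := hA.of_dvd hA0 (dvd_mul_left A' D)
  obtain ⟨m₃, n₃, h₃⟩ := hB.of_dvd hB0 (dvd_mul_left B' D)
  have e₁ := (h₁.mul h₂).inj hA0 hA
  have e₂ := (h₁.mul h₃).inj hB0 hB
  obtain ⟨rfl, rfl⟩ : m₂ = m₃ ∧ n₂ = n₃ := by omega
  refine ⟨m₂, n₂, A', B', h₂, h₃, right_ne_zero_of_mul hB0, hrel, ?_⟩
  have hD : dehom D ≠ 0 := fun h => left_ne_zero_of_mul hA0 (h₁.eq_zero_of_dehom h)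
  apply mul_left_cancel₀ hD
  rw [← map_mul, ← hAB, map_mul]
  ring

end E8Bir

namespace E8Bir

open MvPolynomial

/-! ### Multiplicities -/

section Mult

variable {P Q : MvPolynomial (Fin 4) ℂ} {m n : ℕ} {p q : Fin 4 → ℂ}

/-- Translation of the argument by `p`. -/
noncomputable def translate (p : Fin 4 → ℂ) :
    MvPolynomial (Fin 4) ℂ →ₐ[ℂ] MvPolynomial (Fin 4) ℂ :=
  aeval fun j => X j + C (p j)

theorem translate_neg_translate (p : Fin 4 → ℂ) (P : MvPolynomial (Fin 4) ℂ) :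
    translate (-p) (translate p P) = P := by
  have : (translate (-p)).comp (translate p) = AlgHom.id ℂ _ := by
    ext1 j
    simp [translate]
  exact DFunLike.congr_fun this P

theorem constantCoeff_translate (p : Fin 4 → ℂ) (P : MvPolynomial (Fin 4) ℂ) :
    constantCoeff (translate p P) = eval p P := by
  have : (constantCoeff (R := ℂ)).comp (translate p).toRingHom = eval p := by
    ext j <;> simp [translate]
  exact DFunLike.congr_fun this P

theorem mem_pow_of_map_mem {R S : Type*} [CommRing R] [CommRing S] (f : R →+* S) {I : Ideal R}
    {J : Ideal S} (h : ∀ r ∈ I, f r ∈ J) {k : ℕ} {r : R} (hr : r ∈ I ^ k) : f r ∈ J ^ k :=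
  Ideal.le_comap_pow f k (Ideal.pow_right_mono (show I ≤ J.comap f from h) k hr)

theorem le_mult_iff_translate {k : ℕ} :
    (k : ℕ∞) ≤ mult p P ↔ translate p P ∈ idealOfVars (Fin 4) ℂ ^ k := by
  rw [mem_pow_idealOfVars_iff']
  constructor
  · intro h d hd
    have := MvPowerSeries.coeff_of_lt_order (f := (translate p P : MvPowerSeries (Fin 4) ℂ)) (d := d)
      (lt_of_lt_of_le (by exact_mod_cast hd) h)
    simpa using this
  · intro h
    refine MvPowerSeries.nat_le_order fun d hd => ?_
    have := h d hd
    simpa [translate] using this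

/-- Membership in a power of the maximal ideal at `p` is transported by ring homomorphisms, which
makes multiplicities comparable under substitution. -/
theorem le_mult_iff {k : ℕ} : (k : ℕ∞) ≤ mult p P ↔ P ∈ RingHom.ker (eval p) ^ k := by
  rw [le_mult_iff_translate]
  constructor
  · intro h
    rw [← translate_neg_translate p P]
    refine mem_pow_of_map_mem (translate (-p)).toRingHom ?_ h
    suffices idealOfVars (Fin 4) ℂ ≤ (RingHom.ker (eval p)).comap
      (translate (-p)).toRingHom from fun r hr => this hr
    rw [idealOfVars, Ideal.span_le]
    rintro _ ⟨j, rfl⟩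
    simp [translate]
  · intro h
    refine mem_pow_of_map_mem (translate p).toRingHom (fun r hr => ?_) h
    rw [← pow_one (idealOfVars (Fin 4) ℂ), mem_pow_idealOfVars_iff']
    intro d hd
    obtain rfl : d = 0 := by
      rw [← Finsupp.degree_eq_zero_iff]
      omega
    have := constantCoeff_translate p r
    rw [RingHom.mem_ker.1 hr] at this
    exact this

theorem one_le_mult_iff : 1 ≤ mult p P ↔ eval p P = 0 := by
  have := le_mult_iff (P := P) (p := p) (k := 1)
  rwa [pow_one, RingHom.mem_ker, Nat.cast_one] at this

theorem mult_eq_zero (h : eval p P ≠ 0) : mult p P = 0 := by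
  rw [← Order.lt_one_iff, ← not_le, one_le_mult_iff]
  exact h

theorem mult_mul (p : Fin 4 → ℂ) (P Q : MvPolynomial (Fin 4) ℂ) :
    mult p (P * Q) = mult p P + mult p Q := by
  rw [mult, map_mul, MvPolynomial.coe_mul]
  exact MvPowerSeries.weightedOrder_mul _ _ _

theorem mult_ne_top (h : P ≠ 0) : mult p P ≠ ⊤ := by
  intro ht
  have h1 : (translate p P : MvPowerSeries (Fin 4) ℂ) = 0 := MvPowerSeries.order_eq_top_iff.1 ht
  have h2 : translate p P = 0 := by exact_mod_cast h1
  apply h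
  rw [← translate_neg_translate p P, h2, map_zero]

/-- `Φ` is the pull-back by a polynomial map taking `p` to `q`, so it sends the maximal ideal at `q`
into that at `p`. -/
theorem le_mult_map (Φ : MvPolynomial (Fin 4) ℂ →ₐ[ℂ] MvPolynomial (Fin 4) ℂ)
    (h : ∀ j, eval p (Φ (X j)) = q j) (P : MvPolynomial (Fin 4) ℂ) :
    mult q P ≤ mult p (Φ P) := by
  have hc : (eval p).comp Φ.toRingHom = eval q := by
    ext j
    · simp
    · simp [h]
  refine ENat.forall_natCast_le_iff_le.1 fun k hk => ?_
  rw [le_mult_iff] at hk ⊢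
  refine mem_pow_of_map_mem Φ.toRingHom (fun r hr => ?_) hk
  rw [RingHom.mem_ker] at hr ⊢
  rw [← hr, ← hc]
  rfl

/-- Rescaling of homogeneous coordinates. -/
def rescale (s t : ℂ) (p : Fin 4 → ℂ) : Fin 4 → ℂ := ![s * p 0, s * p 1, t * p 2, t * p 3]

theorem IsBihomogeneous.mult_rescale_le (hP : IsBihomogeneous P m n) {s t : ℂ} (hs : s ≠ 0)
    (ht : t ≠ 0) : mult (rescale s t p) P ≤ mult p P := by
  have h := le_mult_map (p := p) (q := rescale s t p)
    (aeval (![C s * X 0, C s * X 1, C t * X 2, C t * X 3] : Fin 4 → MvPolynomial (Fin 4) ℂ))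
    (by intro j; fin_cases j <;> simp [rescale]) P
  rw [hP.aeval_scale (v := X) (s := C s) (t := C t) (by simp) (by simp) (by simp) (by simp),
    aeval_X_left, AlgHom.id_apply, mult_mul, mult_eq_zero (P := C s ^ m * C t ^ n) (by simp [hs, ht]), zero_add] at h
  exact h

theorem IsBihomogeneous.mult_rescale (hP : IsBihomogeneous P m n) {s t : ℂ} (hs : s ≠ 0)
    (ht : t ≠ 0) : mult (rescale s t p) P = mult p P := by
  refine le_antisymm (hP.mult_rescale_le hs ht) ?_
  have h := hP.mult_rescale_le (p := rescale s t p) (inv_ne_zero hs) (inv_ne_zero ht)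
  have e : rescale s⁻¹ t⁻¹ (rescale s t p) = p := by
    ext j
    fin_cases j <;> simp [rescale, hs, ht]
  rwa [e] at h

/-- The multiplicity of a bihomogeneous polynomial at one of the corners `X i = X j = 0`. -/
theorem IsBihomogeneous.le_mult_corner_iff (hP : IsBihomogeneous P m n) {i j : Fin 4}
    (hij : i = 0 ∧ j = 2 ∨ i = 1 ∧ j = 3) (hp : ∀ l, p l = 0 ↔ l = i ∨ l = j) {k : ℕ} :
    (k : ℕ∞) ≤ mult p P ↔ ∀ d ∈ P.support, k ≤ d i + d j := by
  rw [le_mult_iff]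
  constructor
  · intro h d hd
    -- The two nonvanishing coordinates are frozen at their values. For fixed bidegree `d` is
    -- determined by `(d i, d j)`, so distinct monomials of `P` become nonzero multiples of distinct
    -- monomials and nothing cancels.
    let v : Fin 4 → MvPolynomial (Fin 4) ℂ := fun l => if l = i ∨ l = j then X l else C (p l)
    have hmem : aeval v P ∈ idealOfVars (Fin 4) ℂ ^ k := by
      refine mem_pow_of_map_mem (aeval v : _ →ₐ[ℂ] MvPolynomial (Fin 4) ℂ).toRingHom
        (fun r hr => ?_) h
      rw [← pow_one (idealOfVars (Fin 4) ℂ), mem_pow_idealOfVars_iff']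
      intro e he
      obtain rfl : e = 0 := by
        rw [← Finsupp.degree_eq_zero_iff]
        omega
      have hc : (constantCoeff (R := ℂ)).comp
          (aeval v : _ →ₐ[ℂ] MvPolynomial (Fin 4) ℂ).toRingHom = eval p := by
        ext l
        · simp
        · by_cases hl : l = i ∨ l = j
          · simp [v, hl, (hp l).2 hl]
          · simp [v, hl]
      have := DFunLike.congr_fun hc r
      rw [RingHom.mem_ker.1 hr] at this
      exact this
    rw [mem_pow_idealOfVars_iff'] at hmem
    by_contra! hlt
    have hdeg : (Finsupp.single i (d i) + Finsupp.single j (d j)).degree = d i + d j := by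
      simp [Finsupp.degree_single]
    have hz := hmem (Finsupp.single i (d i) + Finsupp.single j (d j)) (by rwa [hdeg])
    have hterm (e : Fin 4 →₀ ℕ) : ∃ c : ℂ, c ≠ 0 ∧
        algebraMap ℂ (MvPolynomial (Fin 4) ℂ) (coeff e P) * ∏ l, v l ^ e l =
          monomial (Finsupp.single i (e i) + Finsupp.single j (e j)) (coeff e P * c) := by
      have hv (l : Fin 4) (h : ¬(l = i ∨ l = j)) : p l ^ e l ≠ 0 :=
        pow_ne_zero _ (by rwa [Ne, hp])
      have hm (c : ℂ) : monomial (Finsupp.single i (e i) + Finsupp.single j (e j)) c =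
          X i ^ e i * X j ^ e j * C c := by
        rw [monomial_single_add, ← C_mul_X_pow_eq_monomial]
        ring
      simp only [Fin.prod_univ_four, hm, v, algebraMap_eq, map_mul]
      rcases hij with ⟨rfl, rfl⟩ | ⟨rfl, rfl⟩
      · refine ⟨p 1 ^ e 1 * p 3 ^ e 3, mul_ne_zero (hv 1 (by simp)) (hv 3 (by simp)), ?_⟩
        simp
        ring
      · refine ⟨p 0 ^ e 0 * p 2 ^ e 2, mul_ne_zero (hv 0 (by simp)) (hv 2 (by simp)), ?_⟩
        simp
        ring
    rw [aeval_def, eval₂_eq', coeff_sum, Finset.sum_eq_single d] at hz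
    · obtain ⟨c, hc, he⟩ := hterm d
      rw [he, coeff_monomial, if_pos rfl] at hz
      exact mul_ne_zero (mem_support_iff.1 hd) hc hz
    · intro e he hne
      obtain ⟨c, -, he'⟩ := hterm e
      rw [he', coeff_monomial, if_neg]
      intro heq
      have hPd := hP d hd
      have hPe := hP e he
      have h0 := DFunLike.congr_fun heq i
      have h2 := DFunLike.congr_fun heq j
      apply hne
      rcases hij with ⟨rfl, rfl⟩ | ⟨rfl, rfl⟩ <;>
      · simp at h0 h2
        ext l
        fin_cases l <;> simp <;> omega
    · exact fun h => absurd hd h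
  · intro h
    rw [P.as_sum]
    refine Ideal.sum_mem _ fun d hd => ?_
    have hX (l : Fin 4) (hl : l = i ∨ l = j) : (X l : MvPolynomial (Fin 4) ℂ) ∈
        RingHom.ker (eval p) := by
      rw [RingHom.mem_ker, eval_X, (hp l).2 hl]
    have hne : i ≠ j := by
      rcases hij with ⟨rfl, rfl⟩ | ⟨rfl, rfl⟩ <;> decide
    have hle : Finsupp.single i (d i) + Finsupp.single j (d j) ≤ d := by
      intro l
      simp only [Finsupp.add_apply, Finsupp.single_apply]
      split_ifs <;> simp_all
    obtain ⟨r, hr⟩ := le_iff_exists_add.1 hle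
    have : monomial d (coeff d P) =
        X i ^ d i * X j ^ d j * monomial r (coeff d P) := by
      rw [mul_assoc, ← monomial_single_add, ← monomial_single_add, ← add_assoc, ← hr]
    rw [this]
    refine Ideal.mul_mem_right _ _ (Ideal.pow_le_pow_right (h d hd) ?_)
    rw [pow_add]
    exact Ideal.mul_mem_mul (Ideal.pow_mem_pow (hX i (Or.inl rfl)) _)
      (Ideal.pow_mem_pow (hX j (Or.inr rfl)) _)

end Mult

end E8Bir

namespace E8Bir

/-! ### Real roots and generic parameters -/

theorem refl_apply (i : Fin 9) (D : Pic) :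
    refl i D = D + inter (simpleRoot i) D • simpleRoot i := rfl

theorem refl_refl (i : Fin 9) (D : Pic) : refl i (refl i D) = D := reflFun_involutive i D

protected theorem IsRealRoot.refl {D : Pic} (h : IsRealRoot D) (i : Fin 9) : IsRealRoot (refl i D) := by
  obtain ⟨g, hg, j, rfl⟩ := h
  exact ⟨E8Bir.refl i * g, mul_mem (Subgroup.subset_closure ⟨i, rfl⟩) hg, j, rfl⟩

theorem isRealRoot_simpleRoot (i : Fin 9) : IsRealRoot (simpleRoot i) :=
  ⟨1, one_mem _, i, rfl⟩

/-- The reflections `w₃, …, w₈` fix `D` and carry `E 1` successively to `E 2, …, E 7`. -/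
theorem isRealRoot_sub_E {D : Pic} (h : IsRealRoot (D - E 1))
    (hD : ∀ i : Fin 9, 3 ≤ i → inter (simpleRoot i) D = 0) {k : Fin 8} (hk : k ≠ 0) :
    IsRealRoot (D - E k) := by
  have step (i : Fin 9) (hi : 3 ≤ i) (k l : Fin 8) (hkl : refl i (E k) = E l)
      (h : IsRealRoot (D - E k)) : IsRealRoot (D - E l) := by
    have := h.refl i
    rwa [map_sub, hkl, refl_apply, hD i hi, zero_smul, add_zero] at this
  have h2 := step 3 (by decide) 1 2 (by decide) h
  have h3 := step 4 (by decide) 2 3 (by decide) h2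
  have h4 := step 5 (by decide) 3 4 (by decide) h3
  have h5 := step 6 (by decide) 4 5 (by decide) h4
  have h6 := step 7 (by decide) 5 6 (by decide) h5
  have h7 := step 8 (by decide) 6 7 (by decide) h6
  fin_cases k
  exacts [absurd rfl hk, h, h2, h3, h4, h5, h6, h7]

theorem isRealRoot_E_zero_sub {k : Fin 8} (hk : k ≠ 0) : IsRealRoot (E 0 - E k) :=
  isRealRoot_sub_E (isRealRoot_simpleRoot 0) (by decide) hk

theorem isRealRoot_Hy_sub_E_zero_sub {k : Fin 8} (hk : k ≠ 0) : IsRealRoot (Hy - E 0 - E k) :=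
  isRealRoot_sub_E (isRealRoot_simpleRoot 2) (by decide) hk

theorem isRealRoot_E_sub {i k : Fin 8} (hi : i = 0 ∨ i = 1) (hk : k ≠ i) :
    IsRealRoot (E i - E k) := by
  rcases hi with rfl | rfl
  · exact isRealRoot_E_zero_sub hk
  · have e1 : refl 0 (E 0 - E 1) = E 1 - E 0 := by decide
    obtain rfl | hk0 := eq_or_ne k 0
    · exact e1 ▸ (isRealRoot_simpleRoot 0).refl 0
    · have e2 : refl 0 (E 0 - E k) = E 1 - E k := by
        revert k
        decide
      exact e2 ▸ (isRealRoot_E_zero_sub hk0).refl 0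

theorem isRealRoot_Hy_sub {i k : Fin 8} (hi : i = 0 ∨ i = 1) (hk : k ≠ i) :
    IsRealRoot (Hy - E i - E k) := by
  rcases hi with rfl | rfl
  · exact isRealRoot_Hy_sub_E_zero_sub hk
  · obtain rfl | hk0 := eq_or_ne k 0
    · rw [sub_right_comm]
      exact isRealRoot_simpleRoot 2
    · have e2 : refl 0 (Hy - E 0 - E k) = Hy - E 1 - E k := by
        revert k
        decide
      exact e2 ▸ (isRealRoot_Hy_sub_E_zero_sub hk0).refl 0

theorem isRealRoot_Hx_sub {i k : Fin 8} (hi : i = 0 ∨ i = 1) (hk : k ≠ i) :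
    IsRealRoot (Hx - E i - E k) := by
  have e : refl 1 (Hy - E i - E k) = Hx - E i - E k := by
    revert i k
    decide
  exact e ▸ (isRealRoot_Hy_sub hi hk).refl 1

theorem period_add (a : Param) (D D' : Pic) : period a (D + D') = period a D + period a D' := by
  simp only [period, Prod.fst_add, Prod.snd_add, Pi.add_apply, Int.cast_add, add_mul,
    Finset.sum_add_distrib]
  ring

theorem period_smul (a : Param) (c : ℤ) (D : Pic) : period a (c • D) = c * period a D := by
  simp only [period, Prod.smul_fst, Prod.smul_snd, Pi.smul_apply, smul_eq_mul, Int.cast_mul,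
    mul_assoc, mul_add, Finset.mul_sum]

theorem period_sub (a : Param) (D D' : Pic) : period a (D - D') = period a D - period a D' := by
  rw [sub_eq_add_neg, ← neg_one_zsmul, period_add, period_smul]
  push_cast
  ring

@[simp] theorem period_Hx (a : Param) : period a Hx = a.hx := by simp [period, Hx]

@[simp] theorem period_Hy (a : Param) : period a Hy = a.hy := by simp [period, Hy]

@[simp] theorem period_E (a : Param) (k : Fin 8) : period a (E k) = a.e k := by
  simp [period, E, Pi.single_apply]

theorem param_ext_of_period {a b : Param} (h : ∀ D, period a D = period b D) : a = b :=
  Param.ext (by simpa using h Hx) (by simpa using h Hy) (funext fun k => by simpa using h (E k))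

theorem period_paramMap (i : Fin 9) (a : Param) (D : Pic) :
    period (paramMap i a) (refl i D) = period a D := by
  obtain ⟨l, l', m⟩ := D
  rw [refl_apply, period_add, period_smul]
  fin_cases i <;>
  · simp [period, paramMap, simpleRoot, inter, Fin.sum_univ_eight, E, Hx, Hy, Pi.single_apply,
      Equiv.swap_apply_def, Function.update_apply]
    ring

theorem paramMap_paramMap (i : Fin 9) (a : Param) : paramMap i (paramMap i a) = a :=
  param_ext_of_period fun D => by
    have h := period_paramMap i (paramMap i a) (refl i D)
    rw [refl_refl, period_paramMap] at h
    exact h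

protected theorem IsGeneric.paramMap {τ : ℂ} {a : Param} (h : IsGeneric τ a) (i : Fin 9) :
    IsGeneric τ (paramMap i a) := by
  intro α hα m n
  have := h _ (hα.refl i) m n
  rwa [← period_paramMap i, refl_refl] at this

section Generic

variable {τ : ℂ} {br : ℂ → ℂ} {a : Param} (ha : IsGeneric τ a) (hbr : IsBracket τ br)
  (hτ : 0 < τ.im) {i k : Fin 8}

include ha hbr hτ

theorem IsGeneric.br_period_ne_zero {D : Pic} (hD : IsRealRoot D) : br (period a D) ≠ 0 :=
  hbr.ne_zero hτ (ha D hD)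

/-- Up to sign the two factors are brackets of the periods of `E i - E k` and `Hx - E i - E k`, both
real roots. -/
theorem IsGeneric.pair_hx_ne_zero (hi : i = 0 ∨ i = 1) (hk : k ≠ i) :
    pair br a.hx (a.e i) (a.e k) ≠ 0 := by
  have h1 := ha.br_period_ne_zero hbr hτ (isRealRoot_E_sub hi hk)
  have h2 := ha.br_period_ne_zero hbr hτ (isRealRoot_Hx_sub hi hk)
  simp only [period_sub, period_E, period_Hx] at h1 h2
  refine mul_ne_zero h1 ?_
  rw [← neg_ne_zero, ← hbr.map_neg hτ]
  convert h2 using 2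
  ring

theorem IsGeneric.pair_hy_ne_zero (hi : i = 0 ∨ i = 1) (hk : k ≠ i) :
    pair br a.hy (a.e i) (a.e k) ≠ 0 := by
  have h1 := ha.br_period_ne_zero hbr hτ (isRealRoot_E_sub hi hk)
  have h2 := ha.br_period_ne_zero hbr hτ (isRealRoot_Hy_sub hi hk)
  simp only [period_sub, period_E, period_Hy] at h1 h2
  refine mul_ne_zero h1 ?_
  rw [← neg_ne_zero, ← hbr.map_neg hτ]
  convert h2 using 2
  ring

theorem IsGeneric.pair_hx_ne_zero' (hi : i = 0 ∨ i = 1) (hk : k ≠ i) :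
    pair br a.hx (a.e k) (a.e i) ≠ 0 := by
  rw [hbr.pair_swap hτ]
  exact neg_ne_zero.2 (ha.pair_hx_ne_zero hbr hτ hi hk)

theorem IsGeneric.pair_hy_ne_zero' (hi : i = 0 ∨ i = 1) (hk : k ≠ i) :
    pair br a.hy (a.e k) (a.e i) ≠ 0 := by
  rw [hbr.pair_swap hτ]
  exact neg_ne_zero.2 (ha.pair_hy_ne_zero hbr hτ hi hk)

theorem IsGeneric.embed_apply_zero_eq_zero : embed br a (a.e k) 0 = 0 ↔ k = 1 := by
  refine ⟨fun h => by_contra fun hk => ha.pair_hx_ne_zero' hbr hτ (Or.inr rfl) hk h, ?_⟩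
  rintro rfl
  exact hbr.pair_self hτ _ _

theorem IsGeneric.embed_apply_one_eq_zero : embed br a (a.e k) 1 = 0 ↔ k = 0 := by
  refine ⟨fun h => by_contra fun hk => ha.pair_hx_ne_zero' hbr hτ (Or.inl rfl) hk h, ?_⟩
  rintro rfl
  exact hbr.pair_self hτ _ _

theorem IsGeneric.embed_apply_two_eq_zero : embed br a (a.e k) 2 = 0 ↔ k = 1 := by
  refine ⟨fun h => by_contra fun hk => ha.pair_hy_ne_zero' hbr hτ (Or.inr rfl) hk h, ?_⟩
  rintro rfl
  exact hbr.pair_self hτ _ _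

theorem IsGeneric.embed_apply_three_eq_zero : embed br a (a.e k) 3 = 0 ↔ k = 0 := by
  refine ⟨fun h => by_contra fun hk => ha.pair_hy_ne_zero' hbr hτ (Or.inl rfl) hk h, ?_⟩
  rintro rfl
  exact hbr.pair_self hτ _ _

/-- The point of `E 0` is the corner `(∞, ∞)` and that of `E 1` is `(0, 0)`; these two corners are
the base points of the quadratic map of `w₂`. -/
theorem IsGeneric.embed_zero_eq_zero_iff (l : Fin 4) :
    embed br a (a.e 0) l = 0 ↔ l = 1 ∨ l = 3 := by
  fin_cases l
  · simpa using mt (ha.embed_apply_zero_eq_zero hbr hτ (k := 0)).1 (by decide)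
  · simpa using (ha.embed_apply_one_eq_zero hbr hτ (k := 0)).2 rfl
  · simpa using mt (ha.embed_apply_two_eq_zero hbr hτ (k := 0)).1 (by decide)
  · simpa using (ha.embed_apply_three_eq_zero hbr hτ (k := 0)).2 rfl

theorem IsGeneric.embed_one_eq_zero_iff (l : Fin 4) :
    embed br a (a.e 1) l = 0 ↔ l = 0 ∨ l = 2 := by
  fin_cases l
  · simpa using (ha.embed_apply_zero_eq_zero hbr hτ (k := 1)).2 rfl
  · simpa using mt (ha.embed_apply_one_eq_zero hbr hτ (k := 1)).1 (by decide)
  · simpa using (ha.embed_apply_two_eq_zero hbr hτ (k := 1)).2 rfl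
  · simpa using mt (ha.embed_apply_three_eq_zero hbr hτ (k := 1)).1 (by decide)

end Generic

end E8Bir

namespace E8Bir

open MvPolynomial

/-! ### Lifting the explicit maps to homogeneous coordinates -/

/-- `Φ` is a lift of the birational map with pull-back `φ` to homogeneous coordinates. -/
def IsLift (Φ : MvPolynomial (Fin 4) ℂ →ₐ[ℂ] MvPolynomial (Fin 4) ℂ) (φ : K →ₐ[ℂ] K) : Prop :=
  ∀ ⦃m n : ℕ⦄ ⦃A B : MvPolynomial (Fin 4) ℂ⦄ ⦃f : K⦄, IsBihomogeneous A m n →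
    IsBihomogeneous B m n → f * dehom B = dehom A → φ f * dehom (Φ B) = dehom (Φ A)

theorem dehom_map_eq {Φ : MvPolynomial (Fin 4) ℂ →ₐ[ℂ] MvPolynomial (Fin 4) ℂ} {v : K × K}
    {s t : K} (h0 : dehom (Φ (X 0)) = s * v.1) (h1 : dehom (Φ (X 1)) = s)
    (h2 : dehom (Φ (X 2)) = t * v.2) (h3 : dehom (Φ (X 3)) = t) {P : MvPolynomial (Fin 4) ℂ}
    {m n : ℕ} (hP : IsBihomogeneous P m n) :
    dehom (Φ P) = s ^ m * t ^ n * aeval ![v.1, v.2]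
      (aeval (![X 0, 1, X 1, 1] : Fin 4 → MvPolynomial (Fin 2) ℂ) P) := by
  have e1 : dehom (Φ P) = aeval (fun j => dehom (Φ (X j))) P := by
    have : dehom.comp Φ = aeval fun j => dehom (Φ (X j)) := by
      ext j
      simp
    rw [← this]
    rfl
  have e2 : aeval ![v.1, v.2] (aeval (![X 0, 1, X 1, 1] : Fin 4 → MvPolynomial (Fin 2) ℂ) P) =
      aeval ![v.1, 1, v.2, 1] P := by
    have : (aeval (R := ℂ) ![v.1, v.2]).comp
        (aeval (![X 0, 1, X 1, 1] : Fin 4 → MvPolynomial (Fin 2) ℂ)) =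
        aeval ![v.1, 1, v.2, 1] := by
      ext j
      fin_cases j <;> simp
    rw [← this]
    rfl
  rw [e1, e2]
  exact hP.aeval_scale (by simpa using h0) (by simpa using h1) (by simpa using h2)
    (by simpa using h3)

/-- A relation between the two components, once homogenized, would be killed by `Φ`. Their algebraic
independence is what lets the substitution extend to the field `K`. -/
theorem aeval_injective_of_lift {Φ : MvPolynomial (Fin 4) ℂ →ₐ[ℂ] MvPolynomial (Fin 4) ℂ}
    {v : K × K} {s t : K} (h0 : dehom (Φ (X 0)) = s * v.1) (h1 : dehom (Φ (X 1)) = s)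
    (h2 : dehom (Φ (X 2)) = t * v.2) (h3 : dehom (Φ (X 3)) = t)
    (hΦ : ∀ P m n, IsBihomogeneous P m n →
      (∃ m' n', IsBihomogeneous (Φ P) m' n') ∧ (Φ P = 0 → P = 0)) :
    Function.Injective (aeval (R := ℂ) ![v.1, v.2]) := by
  rw [injective_iff_map_eq_zero]
  intro f hf
  obtain ⟨N, hN⟩ := exists_homogenization f
  obtain ⟨A, hA, hAf⟩ := hN N N le_rfl le_rfl
  have hAf' : aeval (![X 0, 1, X 1, 1] : Fin 4 → MvPolynomial (Fin 2) ℂ) A = f := by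
    rw [dehom_eq] at hAf
    exact algebraMap_K_injective hAf
  have h := dehom_map_eq h0 h1 h2 h3 hA
  rw [hAf', hf, mul_zero] at h
  obtain ⟨⟨m', n', hb⟩, hz⟩ := hΦ A N N hA
  rw [hz (hb.eq_zero_of_dehom h), map_zero] at hAf'
  exact hAf'.symm

theorem isLift_of_eq {Φ : MvPolynomial (Fin 4) ℂ →ₐ[ℂ] MvPolynomial (Fin 4) ℂ} {φ : K →ₐ[ℂ] K}
    {s t : K} (h0 : dehom (Φ (X 0)) = s * φ x) (h1 : dehom (Φ (X 1)) = s)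
    (h2 : dehom (Φ (X 2)) = t * φ y) (h3 : dehom (Φ (X 3)) = t) : IsLift Φ φ := by
  intro m n A B f hA hB hf
  have key {P : MvPolynomial (Fin 4) ℂ} (hP : IsBihomogeneous P m n) :
      dehom (Φ P) = s ^ m * t ^ n * φ (dehom P) := by
    rw [dehom_map_eq (v := (φ x, φ y)) h0 h1 h2 h3 hP, dehom_eq]
    congr 1
    have : aeval (R := ℂ) ![φ x, φ y] =
        φ.comp (IsScalarTower.toAlgHom ℂ (MvPolynomial (Fin 2) ℂ) K) := by
      ext j
      fin_cases j <;> simp [x, y]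
    rw [this]
    rfl
  rw [key hA, key hB, ← hf, map_mul]
  ring

theorem K_algHom_ext {φ ψ : K →ₐ[ℂ] K} (hx : φ x = ψ x) (hy : φ y = ψ y) : φ = ψ := by
  have h : φ.comp (IsScalarTower.toAlgHom ℂ (MvPolynomial (Fin 2) ℂ) K) =
      ψ.comp (IsScalarTower.toAlgHom ℂ (MvPolynomial (Fin 2) ℂ) K) := by
    ext j
    fin_cases j
    · exact hx
    · exact hy
  refine AlgHom.ext fun f => ?_
  obtain ⟨p, q, -, rfl⟩ := IsFractionRing.div_surjective (A := MvPolynomial (Fin 2) ℂ) f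
  rw [map_div₀, map_div₀]
  exact congrArg₂ (· / ·) (DFunLike.congr_fun h p) (DFunLike.congr_fun h q)

theorem x_ne_zero : x ≠ 0 := by
  rw [x, Ne, map_eq_zero_iff _ algebraMap_K_injective]
  exact X_ne_zero 0

theorem y_ne_zero : y ≠ 0 := by
  rw [y, Ne, map_eq_zero_iff _ algebraMap_K_injective]
  exact X_ne_zero 1

/-- The lifts of the generators to homogeneous coordinates. -/
noncomputable def polyMap (br : ℂ → ℂ) (i : Fin 9) (a : Param) :
    MvPolynomial (Fin 4) ℂ →ₐ[ℂ] MvPolynomial (Fin 4) ℂ :=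
  match i with
  | 0 => aeval ![X 1, X 0, X 3, X 2]
  | 1 => aeval ![X 2, X 3, X 0, X 1]
  | 2 => aeval ![X 0 * X 3, X 1 * X 2, X 3, X 2]
  | 3 => aeval ![C (F br a 1 2 (a.e 0)) * (X 0 - C (F br a 0 1 (a.e 2)) * X 1), X 1,
      C (G br a 1 2 (a.e 0)) * (X 2 - C (G br a 0 1 (a.e 2)) * X 3), X 3]
  | 4 => AlgHom.id ℂ _
  | 5 => AlgHom.id ℂ _
  | 6 => AlgHom.id ℂ _
  | 7 => AlgHom.id ℂ _
  | 8 => AlgHom.id ℂ _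

theorem dehom_polyMap (br : ℂ → ℂ) (i : Fin 9) (a : Param) :
    ∃ s t : K, dehom (polyMap br i a (X 0)) = s * (xyMap br K i a x y).1 ∧
      dehom (polyMap br i a (X 1)) = s ∧
      dehom (polyMap br i a (X 2)) = t * (xyMap br K i a x y).2 ∧
      dehom (polyMap br i a (X 3)) = t := by
  have hx := x_ne_zero
  have hy := y_ne_zero
  fin_cases i
  · exact ⟨x, y, by simp [polyMap, xyMap, hx], by simp [polyMap], by simp [polyMap, xyMap, hy],
      by simp [polyMap]⟩
  · exact ⟨1, 1, by simp [polyMap, xyMap], by simp [polyMap], by simp [polyMap, xyMap],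
      by simp [polyMap]⟩
  · exact ⟨y, y, by simp [polyMap, xyMap, mul_div_cancel₀ _ hy], by simp [polyMap],
      by simp [polyMap, xyMap, hy], by simp [polyMap]⟩
  all_goals exact ⟨1, 1, by simp [polyMap, xyMap], by simp [polyMap], by simp [polyMap, xyMap],
      by simp [polyMap]⟩

/-- The action of a linear generator on bidegrees. -/
def bidegree (i : Fin 9) (m n : ℕ) : ℕ × ℕ :=
  match i with
  | 1 => (n, m)
  | 2 => (m, m + n)
  | _ => (m, n)

protected theorem IsBihomogeneous.polyMap {P : MvPolynomial (Fin 4) ℂ} {m n : ℕ}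
    (hP : IsBihomogeneous P m n) (br : ℂ → ℂ) (i : Fin 9) (a : Param) :
    IsBihomogeneous (polyMap br i a P) (bidegree i m n).1 (bidegree i m n).2 := by
  have h0 := IsBihomogeneous.X_left (j := 0) (by decide)
  have h1 := IsBihomogeneous.X_left (j := 1) (by decide)
  have h2 := IsBihomogeneous.X_right (j := 2) (by decide)
  have h3 := IsBihomogeneous.X_right (j := 3) (by decide)
  fin_cases i
  · simpa [bidegree, E8Bir.polyMap] using hP.aeval (v := ![X 1, X 0, X 3, X 2]) h1 h0 h3 h2
  · simpa [bidegree, E8Bir.polyMap] using hP.aeval (v := ![X 2, X 3, X 0, X 1]) h2 h3 h0 h1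
  · simpa [bidegree, E8Bir.polyMap] using hP.aeval (v := ![X 0 * X 3, X 1 * X 2, X 3, X 2]) (h0.mul h3)
      (h1.mul h2) h3 h2
  · simpa [bidegree, E8Bir.polyMap] using hP.aeval
      (v := ![C (F br a 1 2 (a.e 0)) * (X 0 - C (F br a 0 1 (a.e 2)) * X 1), X 1,
        C (G br a 1 2 (a.e 0)) * (X 2 - C (G br a 0 1 (a.e 2)) * X 3), X 3])
      ((h0.sub (h1.C_mul _)).C_mul _) h1 ((h2.sub (h3.C_mul _)).C_mul _) h3
  all_goals exact hP

/-! ### The generators as birational maps of the family. -/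

section

variable {τ : ℂ} {br : ℂ → ℂ}

theorem F_eq (br : ℂ → ℂ) (a : Param) (i j : Fin 8) (u : ℂ) :
    F br a i j u = pair br a.hx u (a.e j) / pair br a.hx u (a.e i) := rfl

theorem G_eq (br : ℂ → ℂ) (a : Param) (i j : Fin 8) (u : ℂ) :
    G br a i j u = pair br a.hy u (a.e j) / pair br a.hy u (a.e i) := rfl

/-- The affine maps of the generator `w₃` at `a` and `ā` are inverse to each other. -/
theorem IsGeneric.F_paramMap_three {a : Param} (ha : IsGeneric τ a) (hbr : IsBracket τ br)
    (hτ : 0 < τ.im) :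
    F br (paramMap 3 a) 1 2 (a.e 0) * F br a 1 2 (a.e 0) = 1 ∧
      F br a 1 2 (a.e 0) * F br a 0 1 (a.e 2) + F br (paramMap 3 a) 0 1 (a.e 1) = 0 := by
  have h1 := ha.pair_hx_ne_zero hbr hτ (i := 0) (k := 1) (Or.inl rfl) (by decide)
  have h2 := ha.pair_hx_ne_zero hbr hτ (i := 0) (k := 2) (Or.inl rfl) (by decide)
  have e1 := hbr.pair_swap hτ a.hx (a.e 0) (a.e 1)
  have e2 := hbr.pair_swap hτ a.hx (a.e 0) (a.e 2)
  have e3 := hbr.pair_swap hτ a.hx (a.e 1) (a.e 2)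
  simp only [F_eq, paramMap, Function.comp, Equiv.swap_apply_left, Equiv.swap_apply_right,
    Equiv.swap_apply_of_ne_of_ne (show (0 : Fin 8) ≠ 1 by decide) (show (0 : Fin 8) ≠ 2 by decide)]
  rw [e1, e2, e3]
  constructor <;> field_simp
  ring

theorem IsGeneric.G_paramMap_three {a : Param} (ha : IsGeneric τ a) (hbr : IsBracket τ br)
    (hτ : 0 < τ.im) :
    G br (paramMap 3 a) 1 2 (a.e 0) * G br a 1 2 (a.e 0) = 1 ∧
      G br a 1 2 (a.e 0) * G br a 0 1 (a.e 2) + G br (paramMap 3 a) 0 1 (a.e 1) = 0 := by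
  have h1 := ha.pair_hy_ne_zero hbr hτ (i := 0) (k := 1) (Or.inl rfl) (by decide)
  have h2 := ha.pair_hy_ne_zero hbr hτ (i := 0) (k := 2) (Or.inl rfl) (by decide)
  have e1 := hbr.pair_swap hτ a.hy (a.e 0) (a.e 1)
  have e2 := hbr.pair_swap hτ a.hy (a.e 0) (a.e 2)
  have e3 := hbr.pair_swap hτ a.hy (a.e 1) (a.e 2)
  simp only [G_eq, paramMap, Function.comp, Equiv.swap_apply_left, Equiv.swap_apply_right,
    Equiv.swap_apply_of_ne_of_ne (show (0 : Fin 8) ≠ 1 by decide) (show (0 : Fin 8) ≠ 2 by decide)]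
  rw [e1, e2, e3]
  constructor <;> field_simp
  ring

theorem IsGeneric.polyMap_comp {a : Param} (ha : IsGeneric τ a) (hbr : IsBracket τ br)
    (hτ : 0 < τ.im) {i : Fin 9} (hi : i ≠ 2) :
    (polyMap br i a).comp (polyMap br i (paramMap i a)) = AlgHom.id ℂ _ := by
  have e0 : (paramMap 3 a).e 0 = a.e 0 := rfl
  have e2 : (paramMap 3 a).e 2 = a.e 1 := rfl
  obtain ⟨f1, f2⟩ := ha.F_paramMap_three hbr hτ
  obtain ⟨g1, g2⟩ := ha.G_paramMap_three hbr hτ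
  fin_cases i
  · ext1 j
    fin_cases j <;> simp [polyMap]
  · ext1 j
    fin_cases j <;> simp [polyMap]
  · exact absurd rfl hi
  · ext1 j
    have f1' := congrArg (C (σ := Fin 4)) f1
    have f2' := congrArg (C (σ := Fin 4)) f2
    have g1' := congrArg (C (σ := Fin 4)) g1
    have g2' := congrArg (C (σ := Fin 4)) g2
    simp only [map_mul, map_add, map_one, map_zero] at f1' f2' g1' g2'
    fin_cases j
    · simp [polyMap, e0, e2, algHom_C, algebraMap_eq]
      linear_combination X 0 * f1' - C (F br (paramMap 3 a) 1 2 (a.e 0)) * X 1 * f2'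
    · simp [polyMap]
    · simp [polyMap, e0, e2, algHom_C, algebraMap_eq]
      linear_combination X 2 * g1' - C (G br (paramMap 3 a) 1 2 (a.e 0)) * X 3 * g2'
    · simp [polyMap]
  all_goals rfl

theorem IsGeneric.polyMap_comp' {a : Param} (ha : IsGeneric τ a) (hbr : IsBracket τ br)
    (hτ : 0 < τ.im) {i : Fin 9} (hi : i ≠ 2) :
    (polyMap br i (paramMap i a)).comp (polyMap br i a) = AlgHom.id ℂ _ := by
  have := (ha.paramMap i).polyMap_comp hbr hτ hi
  rwa [paramMap_paramMap] at this

/-- The double substitution multiplies `X 0` and `X 1` by `X 2 * X 3` and fixes the other two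
variables. The lift of `w₂` is thus an involution only up to a monomial equation of the contracted
lines. -/
theorem polyMap_two_polyMap_two (br : ℂ → ℂ) (a b : Param) {P : MvPolynomial (Fin 4) ℂ}
    {m n : ℕ} (hP : IsBihomogeneous P m n) :
    polyMap br 2 a (polyMap br 2 b P) = (X 2 * X 3) ^ m * P := by
  have e : (polyMap br 2 a).comp (polyMap br 2 b) =
      aeval ![X 0 * X 3 * X 2, X 1 * X 2 * X 3, X 2, X 3] := by
    ext1 j
    fin_cases j <;> simp [polyMap]
  rw [← AlgHom.comp_apply, e, hP.aeval_scale (v := X) (s := X 2 * X 3) (t := 1) (by simp; ring)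
    (by simp; ring) (by simp) (by simp), aeval_X_left, AlgHom.id_apply, one_pow, mul_one]

theorem IsGeneric.eq_zero_of_polyMap {a : Param} (ha : IsGeneric τ a) (hbr : IsBracket τ br)
    (hτ : 0 < τ.im) (i : Fin 9) {P : MvPolynomial (Fin 4) ℂ} {m n : ℕ}
    (hP : IsBihomogeneous P m n) (h : polyMap br i a P = 0) : P = 0 := by
  by_cases hi : i = 2
  · subst hi
    have := polyMap_two_polyMap_two br a a hP
    rw [h, map_zero] at this
    simpa [X_ne_zero] using this
  · have := DFunLike.congr_fun (ha.polyMap_comp' hbr hτ hi) P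
    rw [AlgHom.comp_apply, h, map_zero] at this
    exact this.symm

theorem IsGeneric.aeval_xyMap_injective {a : Param} (ha : IsGeneric τ a) (hbr : IsBracket τ br)
    (hτ : 0 < τ.im) (i : Fin 9) :
    Function.Injective (aeval (R := ℂ) ![(xyMap br K i a x y).1, (xyMap br K i a x y).2]) := by
  obtain ⟨s, t, h0, h1, h2, h3⟩ := dehom_polyMap br i a
  exact aeval_injective_of_lift h0 h1 h2 h3 fun P m n hP =>
    ⟨⟨_, _, hP.polyMap br i a⟩, ha.eq_zero_of_polyMap hbr hτ i hP⟩

/-- The pull-back of the generator `wᵢ`, as an endomorphism of `ℂ(x, y)`. -/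
noncomputable def pullHom (hbr : IsBracket τ br) (hτ : 0 < τ.im) (i : Fin 9)
    (a : GenericParam τ) : K →ₐ[ℂ] K :=
  IsFractionRing.liftAlgHom (a.2.aeval_xyMap_injective hbr hτ i)

theorem pullHom_x (hbr : IsBracket τ br) (hτ : 0 < τ.im) (i : Fin 9) (a : GenericParam τ) :
    pullHom hbr hτ i a x = (xyMap br K i a x y).1 := by
  refine (IsFractionRing.lift_algebraMap (K := K) (a.2.aeval_xyMap_injective hbr hτ i) _).trans ?_
  simp

theorem pullHom_y (hbr : IsBracket τ br) (hτ : 0 < τ.im) (i : Fin 9) (a : GenericParam τ) :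
    pullHom hbr hτ i a y = (xyMap br K i a x y).2 := by
  refine (IsFractionRing.lift_algebraMap (K := K) (a.2.aeval_xyMap_injective hbr hτ i) _).trans ?_
  simp

theorem isLift_pullHom (hbr : IsBracket τ br) (hτ : 0 < τ.im) (i : Fin 9) (a : GenericParam τ) :
    IsLift (polyMap br i a) (pullHom hbr hτ i a) := by
  obtain ⟨s, t, h0, h1, h2, h3⟩ := dehom_polyMap br i a
  rw [← pullHom_x hbr hτ] at h0
  rw [← pullHom_y hbr hτ] at h2
  exact isLift_of_eq h0 h1 h2 h3

/-- The generator `wᵢ` on generic parameters. -/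
def baseMap (i : Fin 9) (a : GenericParam τ) : GenericParam τ :=
  ⟨paramMap i a, a.2.paramMap i⟩

theorem baseMap_involutive (i : Fin 9) : Function.Involutive (baseMap (τ := τ) i) :=
  fun a => Subtype.ext (paramMap_paramMap i a)

theorem pullHom_comp (hbr : IsBracket τ br) (hτ : 0 < τ.im) (i : Fin 9) (a : GenericParam τ) :
    (pullHom hbr hτ i a).comp (pullHom hbr hτ i (baseMap i a)) = AlgHom.id ℂ K := by
  have hx := x_ne_zero
  have hy := y_ne_zero
  have ex := pullHom_x hbr hτ i a
  have ey := pullHom_y hbr hτ i a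
  have e0 : (paramMap 3 a).e 0 = (a : Param).e 0 := rfl
  have e2 : (paramMap 3 a).e 2 = (a : Param).e 1 := rfl
  obtain ⟨f1, f2⟩ := a.2.F_paramMap_three hbr hτ
  obtain ⟨g1, g2⟩ := a.2.G_paramMap_three hbr hτ
  apply K_algHom_ext
  · rw [AlgHom.comp_apply, pullHom_x]
    obtain rfl | hi := eq_or_ne i 3
    · have f1' := congrArg (algebraMap ℂ K) f1
      have f2' := congrArg (algebraMap ℂ K) f2
      simp only [map_mul, map_add, map_one, map_zero] at f1' f2'
      simp [xyMap, baseMap, e0, e2] at ex ⊢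
      rw [ex]
      linear_combination x * f1' - algebraMap ℂ K (F br (paramMap 3 a) 1 2 ((a : Param).e 0)) * f2'
    fin_cases i <;> first | exact absurd rfl hi | simp [xyMap, ex, ey] at ex ey ⊢
    all_goals simp [ex, ey, hy]
  · rw [AlgHom.comp_apply, pullHom_y]
    obtain rfl | hi := eq_or_ne i 3
    · have f1' := congrArg (algebraMap ℂ K) g1
      have f2' := congrArg (algebraMap ℂ K) g2
      simp only [map_mul, map_add, map_one, map_zero] at f1' f2'
      simp [xyMap, baseMap, e0, e2] at ey ⊢
      rw [ey]
      linear_combination y * f1' - algebraMap ℂ K (G br (paramMap 3 a) 1 2 ((a : Param).e 0)) * f2'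
    fin_cases i <;> first | exact absurd rfl hi | simp [xyMap, ex, ey] at ex ey ⊢
    all_goals simp [ey]

/-- The generator `wᵢ` as a birational map of the family. -/
noncomputable def generator (hbr : IsBracket τ br) (hτ : 0 < τ.im) (i : Fin 9) : FamilyBir τ where
  base := (baseMap_involutive i).toPerm
  pullback a := AlgEquiv.ofAlgHom (pullHom hbr hτ i a) (pullHom hbr hτ i (baseMap i a))
    (pullHom_comp hbr hτ i a) (by
      have := pullHom_comp hbr hτ i (baseMap i a)
      rwa [baseMap_involutive i a] at this)

end

end E8Bir

namespace E8Bir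

open MvPolynomial

/-! ### The generators on the embedded curve -/

section Embed

variable {τ : ℂ} {br : ℂ → ℂ}

/-- The three-term relation at `e₁, e₂, u, e₃` makes `F₁₃(u)` an affine function of `F₁₂(u)`: this
is the formula of `w₃`. With denominators cleared it holds for all `u`. -/
theorem IsGeneric.pair_hx_three {a : Param} (ha : IsGeneric τ a) (hbr : IsBracket τ br)
    (hτ : 0 < τ.im) (u : ℂ) :
    pair br a.hx u (a.e 2) = F br a 1 2 (a.e 0) *
      (pair br a.hx u (a.e 1) - F br a 0 1 (a.e 2) * pair br a.hx u (a.e 0)) := by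
  have h1 := ha.pair_hx_ne_zero hbr hτ (i := 0) (k := 1) (Or.inl rfl) (by decide)
  have h2 := ha.pair_hx_ne_zero hbr hτ (i := 0) (k := 2) (Or.inl rfl) (by decide)
  have e1 := hbr.pair_swap hτ a.hx (a.e 0) u
  have e2 := hbr.pair_swap hτ a.hx (a.e 0) (a.e 2)
  have e3 := hbr.pair_swap hτ a.hx (a.e 1) (a.e 2)
  have e4 := hbr.pair_swap hτ a.hx (a.e 1) u
  have h := hbr.three_term hτ a.hx (a.e 0) (a.e 1) u (a.e 2)
  rw [F_eq, F_eq, e2, e3]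
  rw [e1, e4]
  field_simp
  linear_combination h

theorem IsGeneric.pair_hy_three {a : Param} (ha : IsGeneric τ a) (hbr : IsBracket τ br)
    (hτ : 0 < τ.im) (u : ℂ) :
    pair br a.hy u (a.e 2) = G br a 1 2 (a.e 0) *
      (pair br a.hy u (a.e 1) - G br a 0 1 (a.e 2) * pair br a.hy u (a.e 0)) := by
  have h1 := ha.pair_hy_ne_zero hbr hτ (i := 0) (k := 1) (Or.inl rfl) (by decide)
  have h2 := ha.pair_hy_ne_zero hbr hτ (i := 0) (k := 2) (Or.inl rfl) (by decide)
  have e1 := hbr.pair_swap hτ a.hy (a.e 0) u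
  have e2 := hbr.pair_swap hτ a.hy (a.e 0) (a.e 2)
  have e3 := hbr.pair_swap hτ a.hy (a.e 1) (a.e 2)
  have e4 := hbr.pair_swap hτ a.hy (a.e 1) u
  have h := hbr.three_term hτ a.hy (a.e 0) (a.e 1) u (a.e 2)
  rw [G_eq, G_eq, e2, e3]
  rw [e1, e4]
  field_simp
  linear_combination h

theorem embed_eq (br : ℂ → ℂ) (a : Param) (u : ℂ) :
    embed br a u = ![pair br a.hx u (a.e 1), pair br a.hx u (a.e 0), pair br a.hy u (a.e 1),
      pair br a.hy u (a.e 0)] := rfl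

/-- The permutation of the exceptional curves by a linear generator. -/
def expPerm (i : Fin 9) : Equiv.Perm (Fin 8) :=
  match i with
  | 0 => Equiv.swap 0 1
  | 1 => 1
  | 2 => 1
  | 3 => Equiv.swap 1 2
  | 4 => Equiv.swap 2 3
  | 5 => Equiv.swap 3 4
  | 6 => Equiv.swap 4 5
  | 7 => Equiv.swap 5 6
  | 8 => Equiv.swap 6 7

theorem expPerm_expPerm (i : Fin 9) (k : Fin 8) : expPerm i (expPerm i k) = k := by
  revert i k
  decide

theorem paramMap_e {i : Fin 9} (hi : i ≠ 2) (a : Param) (k : Fin 8) :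
    (paramMap i a).e k = a.e (expPerm i k) := by
  fin_cases i <;> first | rfl | exact absurd rfl hi

theorem refl_E {i : Fin 9} (hi : i ≠ 2) (k : Fin 8) : refl i (E k) = E (expPerm i k) := by
  revert i k
  decide

theorem refl_bidegree {i : Fin 9} (hi : i ≠ 2) (m n : ℕ) (c : Fin 8 → ℤ) :
    refl i (m, n, c) = (((bidegree i m n).1 : ℤ), ((bidegree i m n).2 : ℤ), c ∘ expPerm i) := by
  rw [refl_apply]
  refine Prod.ext ?_ (Prod.ext ?_ (funext fun k => ?_))
  · fin_cases i <;> first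
      | exact absurd rfl hi
      | simp [bidegree, simpleRoot, inter, E, Hx, Hy]
  · fin_cases i <;> first
      | exact absurd rfl hi
      | simp [bidegree, simpleRoot, inter, E, Hx, Hy]
  · fin_cases i <;> first
      | exact absurd rfl hi
      | (fin_cases k <;> simp [simpleRoot, inter, E, Hx, Hy, expPerm, Fin.sum_univ_eight,
          Pi.single_apply, Equiv.swap_apply_def])

theorem IsGeneric.embed_paramMap {a : Param} (ha : IsGeneric τ a) (hbr : IsBracket τ br)
    (hτ : 0 < τ.im) {i : Fin 9} (hi : i ≠ 2) (u : ℂ) (j : Fin 4) :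
    eval (embed br a u) (polyMap br i a (X j)) = embed br (paramMap i a) u j := by
  fin_cases i
  · fin_cases j <;> simp [polyMap, embed_eq, paramMap]
  · fin_cases j <;> simp [polyMap, embed_eq, paramMap]
  · exact absurd rfl hi
  · have e0 : Equiv.swap (1 : Fin 8) 2 0 = 0 := by decide
    fin_cases j <;>
      simp [polyMap, embed_eq, paramMap, e0, ha.pair_hx_three hbr hτ u, ha.pair_hy_three hbr hτ u]
  all_goals
    fin_cases j <;> simp [polyMap, embed_eq, paramMap, Equiv.swap_apply_def]

/-- No bracket identity is needed: `u - ē₁ = u + e₂ - h_y`, `u + ē₁ - h̄ₓ = u + e₁ - hₓ`, and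
likewise for `ē₂`, so the factors agree one by one and the first pair of coordinates keeps `[u -
e₁][u - e₂]` in common. -/
theorem embed_paramMap_two (br : ℂ → ℂ) (a : Param) (u : ℂ) (j : Fin 4) :
    eval (embed br a u) (polyMap br 2 a (X j)) =
      rescale (br (u - a.e 0) * br (u - a.e 1)) 1 (embed br (paramMap 2 a) u) j := by
  fin_cases j <;> simp [polyMap, embed, paramMap, rescale] <;> ring_nf

theorem IsGeneric.xyMap_F_G {a : Param} (ha : IsGeneric τ a) (hbr : IsBracket τ br)
    (hτ : 0 < τ.im) (i : Fin 9) {u : ℂ} (hu : ∀ j, embed br a u j ≠ 0) :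
    xyMap br ℂ i a (F br a 0 1 u) (G br a 0 1 u) =
      (F br (paramMap i a) 0 1 u, G br (paramMap i a) 0 1 u) := by
  have hF (b : Param) : F br b 0 1 u = embed br b u 0 / embed br b u 1 := rfl
  have hG (b : Param) : G br b 0 1 u = embed br b u 2 / embed br b u 3 := rfl
  have h0 := hu 0
  have h1 := hu 1
  have h2 := hu 2
  have h3 := hu 3
  by_cases hi : i = 2
  · subst hi
    have e (j : Fin 4) := embed_paramMap_two br a u j
    have hs : br (u - a.e 0) * br (u - a.e 1) ≠ 0 := by
      simp only [embed, Matrix.cons_val] at h0 h1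
      exact mul_ne_zero (left_ne_zero_of_mul h1) (left_ne_zero_of_mul h0)
    have e0 := e 0
    have e1 := e 1
    have e2 := e 2
    have e3 := e 3
    simp only [polyMap, rescale, aeval_X, Matrix.cons_val, map_mul, eval_X, one_mul] at e0 e1 e2 e3
    rw [hF, hG, hF, hG, ← e2, ← e3, ← mul_div_mul_left (embed br (paramMap 2 a) u 0) _ hs, ← e0, ← e1, xyMap, Prod.mk.injEq]
    constructor <;> field_simp
  · have e (j : Fin 4) := ha.embed_paramMap hbr hτ hi u j
    rw [hF (paramMap i a), hG (paramMap i a), ← e, ← e, ← e, ← e, hF, hG]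
    fin_cases i
    · simp [xyMap, polyMap]
    · simp [xyMap, polyMap]
    · exact absurd rfl hi
    · simp only [xyMap, polyMap, Prod.mk.injEq, aeval_X, Algebra.algebraMap_self, RingHom.id_apply,
        Matrix.cons_val, map_mul, map_sub, eval_C, eval_X]
      constructor <;> field_simp
    all_goals simp [xyMap, polyMap]

end Embed

/-! ### The linear generators on prime divisors -/

section Linear

variable {τ : ℂ} {br : ℂ → ℂ} (hbr : IsBracket τ br) (hτ : 0 < τ.im) (i : Fin 9)
  (a : GenericParam τ)

theorem pullHom_baseMap_pullHom (z : K) :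
    pullHom hbr hτ i (baseMap i a) (pullHom hbr hτ i a z) = z := by
  have := pullHom_comp hbr hτ i (baseMap i a)
  rw [baseMap_involutive i a] at this
  exact DFunLike.congr_fun this z

theorem isLift_pullHom_baseMap :
    IsLift (polyMap br i (paramMap i a)) (pullHom hbr hτ i (baseMap i a)) :=
  isLift_pullHom hbr hτ i (baseMap i a)

variable {i}

include hbr hτ

theorem polyMap_polyMap (hi : i ≠ 2) (P : MvPolynomial (Fin 4) ℂ) :
    polyMap br i a (polyMap br i (paramMap i a) P) = P :=
  DFunLike.congr_fun (a.2.polyMap_comp hbr hτ hi) P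

theorem polyMap_polyMap' (hi : i ≠ 2) (P : MvPolynomial (Fin 4) ℂ) :
    polyMap br i (paramMap i a) (polyMap br i a P) = P :=
  DFunLike.congr_fun (a.2.polyMap_comp' hbr hτ hi) P

theorem mult_polyMap (hi : i ≠ 2) (u : ℂ) (P : MvPolynomial (Fin 4) ℂ) :
    mult (embed br (paramMap i a) u) (polyMap br i (paramMap i a) P) = mult (embed br a u) P := by
  apply le_antisymm
  · have h := le_mult_map (polyMap br i a) (a.2.embed_paramMap hbr hτ hi u)
      (polyMap br i (paramMap i a) P)
    rwa [polyMap_polyMap hbr hτ a hi] at h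
  · have h := (a.2.paramMap i).embed_paramMap hbr hτ hi u
    rw [paramMap_paramMap] at h
    exact le_mult_map _ h P

/-- The image curve is cut out by `Q` composed with the inverse map, whose lift is `polyMap` at the
new parameter. -/
theorem preimage_curveRing (hi : i ≠ 2) (Q : MvPolynomial (Fin 4) ℂ) :
    pullHom hbr hτ i a ⁻¹' curveRing Q = curveRing (polyMap br i (paramMap i a) Q) := by
  ext f
  constructor
  · rintro ⟨m, n, A, B, hA, hB, hQ, hf⟩
    refine ⟨_, _, _, _, hA.polyMap br i (paramMap i a), hB.polyMap br i (paramMap i a),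
      fun hdvd => hQ ?_, ?_⟩
    · have := map_dvd (polyMap br i a) hdvd
      rwa [polyMap_polyMap hbr hτ a hi, polyMap_polyMap hbr hτ a hi] at this
    · have := isLift_pullHom_baseMap hbr hτ i a hA hB hf
      rwa [pullHom_baseMap_pullHom] at this
  · rintro ⟨m, n, A, B, hA, hB, hQ, hf⟩
    refine ⟨_, _, _, _, hA.polyMap br i a, hB.polyMap br i a, fun hdvd => hQ ?_,
      isLift_pullHom hbr hτ i a hA hB hf⟩
    have := map_dvd (polyMap br i (paramMap i a)) hdvd
    rwa [polyMap_polyMap' hbr hτ a hi] at this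

theorem preimage_exceptionalRing (hi : i ≠ 2) (u : ℂ) :
    pullHom hbr hτ i a ⁻¹' exceptionalRing (embed br a u) =
      exceptionalRing (embed br (paramMap i a) u) := by
  ext f
  constructor
  · rintro ⟨m, n, A, B, hA, hB, hB0, hAB, hf⟩
    refine ⟨_, _, _, _, hA.polyMap br i (paramMap i a), hB.polyMap br i (paramMap i a),
      fun h0 => hB0 ((a.2.paramMap i).eq_zero_of_polyMap hbr hτ i hB h0), ?_, ?_⟩
    · rwa [mult_polyMap hbr hτ a hi, mult_polyMap hbr hτ a hi]
    · have := isLift_pullHom_baseMap hbr hτ i a hA hB hf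
      rwa [pullHom_baseMap_pullHom] at this
  · rintro ⟨m, n, A, B, hA, hB, hB0, hAB, hf⟩
    refine ⟨_, _, _, _, hA.polyMap br i a, hB.polyMap br i a,
      fun h0 => hB0 (a.2.eq_zero_of_polyMap hbr hτ i hB h0), ?_,
      isLift_pullHom hbr hτ i a hA hB hf⟩
    rwa [← mult_polyMap hbr hτ a hi, ← mult_polyMap hbr hτ a hi, polyMap_polyMap' hbr hτ a hi,
      polyMap_polyMap' hbr hτ a hi]

theorem irreducible_polyMap (hi : i ≠ 2) {Q : MvPolynomial (Fin 4) ℂ} (hQ : Irreducible Q) :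
    Irreducible (polyMap br i (paramMap i a) Q) :=
  (MulEquiv.irreducible_iff (AlgEquiv.ofAlgHom (polyMap br i (paramMap i a)) (polyMap br i a)
    (a.2.polyMap_comp' hbr hτ hi) (a.2.polyMap_comp hbr hτ hi))).2 hQ

theorem isPrimeDivisor_preimage_of_ne_two (hi : i ≠ 2) {R : Set K} {D : Pic}
    (h : IsPrimeDivisor br a R D) :
    IsPrimeDivisor br (paramMap i a) (pullHom hbr hτ i a ⁻¹' R) (refl i D) := by
  rcases h with ⟨Q, m, n, hQ, hmn⟩ | k
  · rw [preimage_curveRing hbr hτ a hi, refl_bidegree hi]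
    have := IsPrimeDivisor.curve (br := br) (a := paramMap i a) _ _ _
      (irreducible_polyMap hbr hτ a hi hQ) (hmn.polyMap br i (paramMap i a))
    convert this using 4
    rw [paramMap_e hi, mult_polyMap hbr hτ a hi]
    rfl
  · rw [preimage_exceptionalRing hbr hτ a hi, refl_E hi]
    have := IsPrimeDivisor.exceptional (br := br) (a := paramMap i a) (expPerm i k)
    rwa [paramMap_e hi, expPerm_expPerm] at this

end Linear

end E8Bir

namespace E8Bir

open MvPolynomial

/-! ### Associated curves and lines -/

theorem curveRing_congr {Q Q' : MvPolynomial (Fin 4) ℂ} (h : Associated Q Q') :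
    curveRing Q = curveRing Q' := by
  simp only [curveRing, h.dvd_iff_dvd_left]

theorem mult_congr {Q Q' : MvPolynomial (Fin 4) ℂ} (h : Associated Q Q') (p : Fin 4 → ℂ) :
    mult p Q = mult p Q' := by
  obtain ⟨U, rfl⟩ := h
  have h1 : mult p (U : MvPolynomial (Fin 4) ℂ) + mult p (↑U⁻¹ : MvPolynomial (Fin 4) ℂ) = 0 := by
    rw [← mult_mul, Units.mul_inv]
    exact mult_eq_zero (by simp)
  rw [mult_mul, (add_eq_zero.1 h1).1, add_zero]

theorem IsBihomogeneous.of_associated {Q Q' : MvPolynomial (Fin 4) ℂ} {m n : ℕ}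
    (h : IsBihomogeneous Q m n) (h0 : Q ≠ 0) (hQ : Associated Q Q') : IsBihomogeneous Q' m n := by
  obtain ⟨m', n', h'⟩ := h.of_dvd h0 hQ.symm.dvd
  obtain ⟨U, rfl⟩ := hQ
  obtain ⟨m'', n'', hU⟩ := h'.of_dvd (by simpa using h0) (dvd_mul_left _ Q)
  have hU1 : IsBihomogeneous ((U : MvPolynomial (Fin 4) ℂ) * ↑U⁻¹) 0 0 := by
    simpa using IsBihomogeneous.C 1
  obtain ⟨m₃, n₃, hV⟩ := hU1.of_dvd (by simp) (dvd_mul_left _ _)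
  have e1 := (hU.mul hV).inj (by simp) hU1
  have e2 := (h.mul hU).inj (by simpa using h0) h'
  obtain ⟨rfl, rfl⟩ : m' = m ∧ n' = n := by omega
  exact h'

theorem IsBihomogeneous.of_X_pow_mul {P : MvPolynomial (Fin 4) ℂ} {j : Fin 4}
    (hj : j = 2 ∨ j = 3) {k m n : ℕ} (h : IsBihomogeneous (X j ^ k * P) m n) :
    IsBihomogeneous P m (n - k) := by
  obtain rfl | h0 := eq_or_ne P 0
  · exact .zero _ _
  have hne : X j ^ k * P ≠ 0 := mul_ne_zero (pow_ne_zero _ (X_ne_zero j)) h0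
  obtain ⟨m', n', h'⟩ := h.of_dvd hne (dvd_mul_left _ _)
  have := ((((IsBihomogeneous.X_right hj).pow k).mul h').inj hne h)
  obtain ⟨rfl, rfl⟩ : m' = m ∧ n' = n - k := by omega
  exact h'

/-! ### The quadratic transformation `(x, y) ↦ (x / y, 1 / y)` -/

/-- The lift of the generator `w₂` to homogeneous coordinates. -/
noncomputable def quadMap : MvPolynomial (Fin 4) ℂ →ₐ[ℂ] MvPolynomial (Fin 4) ℂ :=
  aeval ![X 0 * X 3, X 1 * X 2, X 3, X 2]

theorem quadMap_X_two : quadMap (X 2) = X 3 := by simp [quadMap]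

theorem quadMap_X_three : quadMap (X 3) = X 2 := by simp [quadMap]

section Quad

variable {P Q : MvPolynomial (Fin 4) ℂ} {m n : ℕ}

theorem IsBihomogeneous.quadMap_quadMap (hP : IsBihomogeneous P m n) :
    quadMap (quadMap P) = (X 2 * X 3) ^ m * P :=
  -- The lift of `w₂` depends neither on the bracket nor on the parameters, so these arguments are
  -- dummies.
  polyMap_two_polyMap_two (fun _ => 0) ⟨0, 0, 0⟩ ⟨0, 0, 0⟩ hP

theorem IsBihomogeneous.quadMap (hP : IsBihomogeneous P m n) :
    IsBihomogeneous (quadMap P) m (m + n) :=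
  hP.polyMap (fun _ => 0) 2 ⟨0, 0, 0⟩

theorem IsBihomogeneous.quadMap_ne_zero (hP : IsBihomogeneous P m n) (h0 : P ≠ 0) :
    E8Bir.quadMap P ≠ 0 := by
  intro h
  have := hP.quadMap_quadMap
  rw [h, map_zero] at this
  simp [X_ne_zero, h0] at this

/-- The action of `quadMap` on exponents. -/
noncomputable def quadExp (d : Fin 4 →₀ ℕ) : Fin 4 →₀ ℕ :=
  Finsupp.single 0 (d 0) + (Finsupp.single 1 (d 1) + (Finsupp.single 2 (d 1 + d 3) +
    Finsupp.single 3 (d 0 + d 2)))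

/-- Since monomials do not merge under `quadMap`, divisibility of the image by a power of a variable
can be read off the support of `P`. -/
theorem quadExp_injective : Function.Injective quadExp := by
  intro d e h
  have h0 := DFunLike.congr_fun h 0
  have h1 := DFunLike.congr_fun h 1
  have h2 := DFunLike.congr_fun h 2
  have h3 := DFunLike.congr_fun h 3
  simp [quadExp] at h0 h1 h2 h3
  ext l
  fin_cases l <;> simp <;> omega

theorem quadMap_eq (P : MvPolynomial (Fin 4) ℂ) :
    quadMap P = ∑ d ∈ P.support, monomial (quadExp d) (P.coeff d) := by
  rw [quadMap, aeval_def, eval₂_eq']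
  refine Finset.sum_congr rfl fun d _ => ?_
  rw [quadExp, monomial_single_add, monomial_single_add, monomial_single_add,
    ← C_mul_X_pow_eq_monomial, Fin.prod_univ_four]
  simp only [algebraMap_eq, Matrix.cons_val]
  ring

theorem coeff_quadMap (P : MvPolynomial (Fin 4) ℂ) (d : Fin 4 →₀ ℕ) :
    coeff (quadExp d) (quadMap P) = coeff d P := by
  rw [quadMap_eq, coeff_sum, Finset.sum_eq_single d]
  · rw [coeff_monomial, if_pos rfl]
  · intro e _ hne
    rw [coeff_monomial, if_neg fun h => hne (quadExp_injective h)]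
  · intro h
    rw [coeff_monomial, if_pos rfl, notMem_support_iff.1 h]

theorem X_pow_dvd_quadMap_iff {j : Fin 4} {k : ℕ} :
    X j ^ k ∣ quadMap P ↔ ∀ d ∈ P.support, k ≤ quadExp d j := by
  constructor
  · rintro ⟨R, hR⟩ d hd
    by_contra hlt
    rw [mem_support_iff, ← coeff_quadMap, hR, mul_comm, X_pow_eq_monomial, coeff_mul_monomial',
      if_neg] at hd
    · exact hd rfl
    · intro hle
      have := hle j
      simp at this
      exact hlt this
  · intro h
    rw [quadMap_eq]
    refine Finset.dvd_sum fun d hd => ?_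
    rw [X_pow_eq_monomial, monomial_dvd_monomial]
    refine ⟨Or.inr fun l => ?_, one_dvd _⟩
    obtain rfl | hl := eq_or_ne l j
    · simpa using h d hd
    · simp [hl.symm]

/-- The multiplicity at this corner is the least `d 1 + d 3`, and that sum is the exponent of `X 2`
after `quadMap`. Geometrically, the exceptional curve of the corner becomes the line `X 2 = 0`. -/
theorem IsBihomogeneous.mult_corner_zero (hP : IsBihomogeneous P m n) {p : Fin 4 → ℂ}
    (hp : ∀ l, p l = 0 ↔ l = 1 ∨ l = 3) : mult p P = emultiplicity (X 2) (E8Bir.quadMap P) := by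
  refine ENat.eq_of_forall_natCast_le_iff fun k => ?_
  rw [← pow_dvd_iff_le_emultiplicity, X_pow_dvd_quadMap_iff,
    hP.le_mult_corner_iff (Or.inr ⟨rfl, rfl⟩) hp]
  simp [quadExp]

theorem IsBihomogeneous.mult_corner_one (hP : IsBihomogeneous P m n) {p : Fin 4 → ℂ}
    (hp : ∀ l, p l = 0 ↔ l = 0 ∨ l = 2) : mult p P = emultiplicity (X 3) (E8Bir.quadMap P) := by
  refine ENat.eq_of_forall_natCast_le_iff fun k => ?_
  rw [← pow_dvd_iff_le_emultiplicity, X_pow_dvd_quadMap_iff,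
    hP.le_mult_corner_iff (Or.inl ⟨rfl, rfl⟩) hp]
  simp [quadExp]

theorem emultiplicity_X_self (j : Fin 4) (k : ℕ) :
    emultiplicity (X j : MvPolynomial (Fin 4) ℂ) (X j ^ k) = k :=
  emultiplicity_pow_self (X_ne_zero j) X_prime.not_isUnit k

theorem not_X_dvd_X_pow {i j : Fin 4} (h : i ≠ j) (k : ℕ) :
    ¬ (X i : MvPolynomial (Fin 4) ℂ) ∣ X j ^ k := fun hd =>
  h (X_dvd_X.1 (X_prime.dvd_of_dvd_pow hd))

theorem isUnit_of_dvd_X_mul_X_pow {B : MvPolynomial (Fin 4) ℂ} {k : ℕ}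
    (h : B ∣ (X 2 * X 3) ^ k) (h2 : ¬ X 2 ∣ B) (h3 : ¬ X 3 ∣ B) : IsUnit B := by
  have r2 := ((X_prime (R := ℂ) (i := (2 : Fin 4))).irreducible.isRelPrime_iff_not_dvd).2 h2
  have r3 := ((X_prime (R := ℂ) (i := (3 : Fin 4))).irreducible.isRelPrime_iff_not_dvd).2 h3
  exact ((r2.mul_left r3).pow_left (m := k)) h dvd_rfl

/-- Data of an irreducible curve `Q` and its strict transform `Q'`. -/
structure IsTransform (Q Q' : MvPolynomial (Fin 4) ℂ) (m n a b : ℕ) : Prop where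
  irreducible : Irreducible Q
  bihom : IsBihomogeneous Q m n
  not_dvd_two : ¬ X 2 ∣ Q
  not_dvd_three : ¬ X 3 ∣ Q
  eq : quadMap Q = X 2 ^ a * (X 3 ^ b * Q')
  not_dvd_two' : ¬ X 2 ∣ Q'
  not_dvd_three' : ¬ X 3 ∣ Q'

theorem exists_isTransform (hQ : Irreducible Q) (hmn : IsBihomogeneous Q m n) (h2 : ¬ X 2 ∣ Q)
    (h3 : ¬ X 3 ∣ Q) : ∃ Q' a b, IsTransform Q Q' m n a b := by
  have h0 := hmn.quadMap_ne_zero hQ.ne_zero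
  have f2 : FiniteMultiplicity (X 2) (quadMap Q) := .of_prime_left X_prime h0
  obtain ⟨R, hR, hR2⟩ := f2.exists_eq_pow_mul_and_not_dvd
  have hR0 : R ≠ 0 := by
    rintro rfl
    exact h0 (by rw [hR, mul_zero])
  have f3 : FiniteMultiplicity (X 3) R := .of_prime_left X_prime hR0
  obtain ⟨Q', hQ', hQ3⟩ := f3.exists_eq_pow_mul_and_not_dvd
  exact ⟨Q', _, _, hQ, hmn, h2, h3, by rw [hR]; congr 1,
    fun h => hR2 (hQ' ▸ dvd_mul_of_dvd_right h _), hQ3⟩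

namespace IsTransform

variable {Q' : MvPolynomial (Fin 4) ℂ} {a b : ℕ} (h : IsTransform Q Q' m n a b)

include h

theorem prime : Prime Q := h.irreducible.prime

theorem ne_zero' : Q' ≠ 0 := by
  intro h0
  have := h.not_dvd_two'
  simp [h0] at this

theorem not_dvd_X {j : Fin 4} (hj : j = 2 ∨ j = 3) : ¬ Q ∣ X j := by
  intro hd
  have hs := h.irreducible.dvd_symm (X_prime (R := ℂ) (i := j)).irreducible hd
  rcases hj with rfl | rfl
  exacts [h.not_dvd_two hs, h.not_dvd_three hs]

theorem not_dvd_X_mul_X_pow (k l : ℕ) : ¬ Q ∣ X 2 ^ k * X 3 ^ l := by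
  intro hd
  rcases h.prime.dvd_or_dvd hd with hd | hd
  · exact h.not_dvd_X (Or.inl rfl) (h.prime.dvd_of_dvd_pow hd)
  · exact h.not_dvd_X (Or.inr rfl) (h.prime.dvd_of_dvd_pow hd)

theorem bihom' : IsBihomogeneous Q' m (m + n - a - b) := by
  have := h.bihom.quadMap
  rw [h.eq] at this
  exact (this.of_X_pow_mul (Or.inl rfl)).of_X_pow_mul (Or.inr rfl)

theorem add_le : a + b ≤ m + n := by
  have h1 := h.bihom.quadMap
  rw [h.eq] at h1
  have h2 := ((IsBihomogeneous.X_right (j := 2) (by decide)).pow a).mul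
    (((IsBihomogeneous.X_right (j := 3) (by decide)).pow b).mul h.bihom')
  have := h1.inj (by rw [← h.eq]; exact h.bihom.quadMap_ne_zero h.irreducible.ne_zero) h2
  omega

/-- A second application of `quadMap` to `eq` exchanges `X 2` and `X 3`, so `Q` is in turn the
strict transform of `Q'`. -/
theorem quadMap_eq' : X 2 ^ b * X 3 ^ a * quadMap Q' = (X 2 * X 3) ^ m * Q := by
  rw [← h.bihom.quadMap_quadMap, h.eq, map_mul, map_mul, map_pow, map_pow, quadMap_X_two,
    quadMap_X_three]
  ring

theorem dvd_quadMap : Q ∣ quadMap Q' := by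
  have : Q ∣ X 2 ^ b * X 3 ^ a * quadMap Q' := by
    rw [h.quadMap_eq']
    exact dvd_mul_left _ _
  exact (h.prime.dvd_or_dvd this).resolve_left (h.not_dvd_X_mul_X_pow _ _)

/-- Cancelling `Q` leaves `quadMap B` dividing a power of `X 2 * X 3`, hence so does `B` after
another `quadMap`; but neither variable divides `Q'`. -/
theorem isUnit_of_dvd {A B : MvPolynomial (Fin 4) ℂ} (hAB : Q' = A * B) (hA : Q ∣ quadMap A) :
    IsUnit B := by
  obtain ⟨C, hC⟩ := hA
  obtain ⟨m', n', hB⟩ := h.bihom'.of_dvd h.ne_zero' (hAB ▸ dvd_mul_left B A)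
  have h1 := h.quadMap_eq'
  rw [hAB, map_mul, hC, mul_comm ((X 2 * X 3) ^ m)] at h1
  have h2 : quadMap B ∣ (X 2 * X 3) ^ m := by
    refine ⟨X 2 ^ b * X 3 ^ a * C, mul_left_cancel₀ h.irreducible.ne_zero ?_⟩
    rw [← h1]
    ring
  have h3 := map_dvd quadMap h2
  rw [hB.quadMap_quadMap, map_pow, map_mul, quadMap_X_two, quadMap_X_three,
    mul_comm (X 3) (X 2)] at h3
  exact isUnit_of_dvd_X_mul_X_pow (dvd_of_mul_left_dvd h3)
    (fun hd => h.not_dvd_two' (hAB ▸ dvd_mul_of_dvd_right hd A))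
    (fun hd => h.not_dvd_three' (hAB ▸ dvd_mul_of_dvd_right hd A))

theorem irreducible' : Irreducible Q' := by
  refine ⟨fun hu => ?_, fun A B hAB => ?_⟩
  · exact h.prime.not_isUnit (isUnit_of_dvd_unit h.dvd_quadMap (hu.map quadMap))
  · have := h.dvd_quadMap
    rw [hAB, map_mul] at this
    rcases h.prime.dvd_or_dvd this with hd | hd
    · exact Or.inr (h.isUnit_of_dvd hAB hd)
    · exact Or.inl (h.isUnit_of_dvd (hAB.trans (mul_comm A B)) hd)

theorem not_dvd_X' {j : Fin 4} (hj : j = 2 ∨ j = 3) : ¬ Q' ∣ X j := by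
  intro hd
  have hs := h.irreducible'.dvd_symm (X_prime (R := ℂ) (i := j)).irreducible hd
  rcases hj with rfl | rfl
  exacts [h.not_dvd_two' hs, h.not_dvd_three' hs]

theorem mult_corner_zero {p : Fin 4 → ℂ} (hp : ∀ l, p l = 0 ↔ l = 1 ∨ l = 3) : mult p Q = a := by
  rw [h.bihom.mult_corner_zero hp, h.eq, emultiplicity_mul X_prime, emultiplicity_mul X_prime,
    emultiplicity_X_self, emultiplicity_eq_zero.2 (not_X_dvd_X_pow (by decide) b),
    emultiplicity_eq_zero.2 h.not_dvd_two', add_zero, add_zero]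

theorem mult_corner_one {p : Fin 4 → ℂ} (hp : ∀ l, p l = 0 ↔ l = 0 ∨ l = 2) : mult p Q = b := by
  rw [h.bihom.mult_corner_one hp, h.eq, emultiplicity_mul X_prime, emultiplicity_mul X_prime,
    emultiplicity_X_self, emultiplicity_eq_zero.2 (not_X_dvd_X_pow (by decide) a),
    emultiplicity_eq_zero.2 h.not_dvd_three', add_zero, zero_add]

/-- Compare powers of `X 2` in `quadMap_eq'`. The exponents trade places: the new multiplicity at
one corner is `m` minus the old one at the other, as the reflection prescribes. -/
theorem mult_corner_zero' {p : Fin 4 → ℂ} (hp : ∀ l, p l = 0 ↔ l = 1 ∨ l = 3) :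
    b + mult p Q' = m := by
  have := congrArg (emultiplicity (X 2)) h.quadMap_eq'
  rwa [mul_pow, emultiplicity_mul X_prime, emultiplicity_mul X_prime, emultiplicity_mul X_prime,
    emultiplicity_mul X_prime, emultiplicity_X_self, emultiplicity_X_self,
    emultiplicity_eq_zero.2 (not_X_dvd_X_pow (by decide) a),
    emultiplicity_eq_zero.2 (not_X_dvd_X_pow (by decide) m),
    emultiplicity_eq_zero.2 h.not_dvd_two, add_zero, add_zero, add_zero,
    ← h.bihom'.mult_corner_zero hp] at this

theorem mult_corner_one' {p : Fin 4 → ℂ} (hp : ∀ l, p l = 0 ↔ l = 0 ∨ l = 2) :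
    a + mult p Q' = m := by
  have := congrArg (emultiplicity (X 3)) h.quadMap_eq'
  rwa [mul_pow, emultiplicity_mul X_prime, emultiplicity_mul X_prime, emultiplicity_mul X_prime,
    emultiplicity_mul X_prime, emultiplicity_X_self, emultiplicity_X_self,
    emultiplicity_eq_zero.2 (not_X_dvd_X_pow (by decide) b),
    emultiplicity_eq_zero.2 (not_X_dvd_X_pow (by decide) m),
    emultiplicity_eq_zero.2 h.not_dvd_three, zero_add, zero_add, add_zero,
    ← h.bihom'.mult_corner_one hp] at this

end IsTransform

end Quad

end E8Bir

/-! ### The quadratic generator on prime divisors. -/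

namespace E8Bir

open MvPolynomial

section Quadratic

variable {τ : ℂ} {br : ℂ → ℂ} (hbr : IsBracket τ br) (hτ : 0 < τ.im) (a : GenericParam τ)

theorem isLift_quadMap : IsLift quadMap (pullHom hbr hτ 2 a) :=
  isLift_pullHom hbr hτ 2 a

theorem quadMap_lift_of_pullHom {m n : ℕ} {A B : MvPolynomial (Fin 4) ℂ} {f : K}
    (hA : IsBihomogeneous A m n) (hB : IsBihomogeneous B m n)
    (h : pullHom hbr hτ 2 a f * dehom B = dehom A) :
    f * dehom (quadMap B) = dehom (quadMap A) := by
  have := isLift_quadMap hbr hτ (baseMap 2 a) hA hB h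
  rwa [pullHom_baseMap_pullHom] at this

theorem preimage_curveRing_two {Q Q' : MvPolynomial (Fin 4) ℂ} {m n c d : ℕ}
    (h : IsTransform Q Q' m n c d) :
    pullHom hbr hτ 2 a ⁻¹' curveRing Q = curveRing Q' := by
  have h' := h.irreducible'.prime
  have key {P R : MvPolynomial (Fin 4) ℂ} {k : ℕ} (hP : Prime P) (h2 : ¬ P ∣ X 2)
      (h3 : ¬ P ∣ X 3) (hR : P ∣ (X 2 * X 3) ^ k * R) : P ∣ R := by
    refine (hP.dvd_or_dvd hR).resolve_left fun hd => ?_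
    rcases hP.dvd_or_dvd (hP.dvd_of_dvd_pow hd) with hd | hd
    exacts [h2 hd, h3 hd]
  ext f
  constructor
  · rintro ⟨k, l, A, B, hA, hB, hQ, hf⟩
    refine ⟨_, _, _, _, hA.quadMap, hB.quadMap, fun hdvd => hQ ?_,
      quadMap_lift_of_pullHom hbr hτ a hA hB hf⟩
    have h1 := h.dvd_quadMap.trans (map_dvd quadMap hdvd)
    rw [hB.quadMap_quadMap] at h1
    exact key h.prime (h.not_dvd_X (Or.inl rfl)) (h.not_dvd_X (Or.inr rfl)) h1
  · rintro ⟨k, l, A, B, hA, hB, hQ, hf⟩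
    refine ⟨_, _, _, _, hA.quadMap, hB.quadMap, fun hdvd => hQ ?_,
      isLift_quadMap hbr hτ a hA hB hf⟩
    have h1 := map_dvd quadMap hdvd
    rw [hB.quadMap_quadMap, h.eq] at h1
    exact key h' (h.not_dvd_X' (Or.inl rfl)) (h.not_dvd_X' (Or.inr rfl))
      ((dvd_mul_of_dvd_right (dvd_mul_left _ _) _).trans h1)

theorem dehom_X_pow_ne_zero {j : Fin 4} (hj : j = 2 ∨ j = 3) (k : ℕ) : dehom (X j ^ k) ≠ 0 := by
  rw [map_pow]
  refine pow_ne_zero _ ?_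
  rcases hj with rfl | rfl
  · rw [dehom_X_two]
    exact y_ne_zero
  · rw [dehom_X_three]
    exact one_ne_zero

/-- The exceptional curve at a corner is the image of a line. -/
theorem preimage_exceptionalRing_corner {p : Fin 4 → ℂ} {j : Fin 4} (hj : j = 2 ∨ j = 3)
    (hp : ∀ ⦃P m n⦄, IsBihomogeneous P m n → mult p P = emultiplicity (X j) (quadMap P)) :
    pullHom hbr hτ 2 a ⁻¹' exceptionalRing p = curveRing (X j) := by
  ext f
  constructor
  · rintro ⟨m, n, A, B, hA, hB, hB0, hAB, hf⟩
    -- The multiplicity of `B` at the corner is the exact power of `X j` in `quadMap B`. It also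
    -- divides `quadMap A`, and cancelling it leaves a denominator prime to `X j`.
    have hfin : FiniteMultiplicity (X j) (quadMap B) :=
      .of_prime_left X_prime (hB.quadMap_ne_zero hB0)
    obtain ⟨B', hB', hXB⟩ := hfin.exists_eq_pow_mul_and_not_dvd
    obtain ⟨A', hA'⟩ : X j ^ multiplicity (X j) (quadMap B) ∣ quadMap A := by
      rw [pow_dvd_iff_le_emultiplicity, ← hfin.emultiplicity_eq_multiplicity, ← hp hA, ← hp hB]
      exact hAB
    refine ⟨_, _, A', B', IsBihomogeneous.of_X_pow_mul hj (hA' ▸ hA.quadMap),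
      IsBihomogeneous.of_X_pow_mul hj (hB' ▸ hB.quadMap), hXB, ?_⟩
    have h1 := quadMap_lift_of_pullHom hbr hτ a hA hB hf
    rw [(congrArg dehom hA').trans (map_mul _ _ _), (congrArg dehom hB').trans (map_mul _ _ _)] at h1
    apply mul_left_cancel₀ (dehom_X_pow_ne_zero hj (multiplicity (X j) (quadMap B)))
    rw [← h1]
    ring
  · rintro ⟨m, n, A, B, hA, hB, hQ, hf⟩
    have hB0 : B ≠ 0 := by
      rintro rfl
      exact hQ (dvd_zero _)
    refine ⟨_, _, _, _, hA.quadMap, hB.quadMap, hB.quadMap_ne_zero hB0, ?_,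
      isLift_quadMap hbr hτ a hA hB hf⟩
    -- At the corner `quadMap B` has multiplicity exactly `m`, because `X j` does not divide `B`,
    -- while `quadMap A` has at least `m`.
    have hm : emultiplicity (X j) ((X 2 * X 3 : MvPolynomial (Fin 4) ℂ) ^ m) = m := by
      rw [mul_pow, emultiplicity_mul X_prime]
      rcases hj with rfl | rfl
      · rw [emultiplicity_X_self, emultiplicity_eq_zero.2 (not_X_dvd_X_pow (by decide) m),
          add_zero]
      · rw [emultiplicity_X_self, emultiplicity_eq_zero.2 (not_X_dvd_X_pow (by decide) m),
          zero_add]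
    rw [hp hA.quadMap, hp hB.quadMap, hA.quadMap_quadMap, hB.quadMap_quadMap,
      emultiplicity_mul X_prime, emultiplicity_mul X_prime, hm, emultiplicity_eq_zero.2 hQ]
    gcongr
    exact zero_le

/-- Off the lines `y = 0` and `y = ∞` the map is a local isomorphism: going back by `quadMap` costs
only a power of `X 2 * X 3`, which does not vanish at the point. -/
theorem mult_embed_quadMap {u : ℂ} (h2 : embed br a u 2 ≠ 0) (h3 : embed br a u 3 ≠ 0)
    {P : MvPolynomial (Fin 4) ℂ} {m n : ℕ} (hP : IsBihomogeneous P m n) :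
    mult (embed br a u) (quadMap P) = mult (embed br (paramMap 2 a) u) P := by
  have hs : br (u - (a : Param).e 0) * br (u - (a : Param).e 1) ≠ 0 := by
    simp only [embed, Matrix.cons_val] at h2 h3
    exact mul_ne_zero (left_ne_zero_of_mul h3) (left_ne_zero_of_mul h2)
  set p := embed br a u
  set q := rescale (br (u - (a : Param).e 0) * br (u - (a : Param).e 1)) 1
    (embed br (paramMap 2 a) u)
  have hq : ∀ j, eval p (quadMap (X j)) = q j := embed_paramMap_two br a u
  rw [← hP.mult_rescale (p := embed br (paramMap 2 a) u) hs one_ne_zero]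
  apply le_antisymm _ (le_mult_map quadMap hq P)
  have hpq : ∀ j, eval q (quadMap (X j)) = rescale (p 2 * p 3) 1 p j := by
    have h0 := hq 0
    have h1 := hq 1
    have h2' := hq 2
    have h3' := hq 3
    simp [quadMap] at h0 h1 h2' h3'
    intro j
    fin_cases j <;> simp [quadMap, rescale, ← h0, ← h1, ← h2', ← h3'] <;> ring
  have h := le_mult_map quadMap hpq (quadMap P)
  have hq2 : eval q (X 2 * X 3) ≠ 0 := by
    have h2' := hq 2
    have h3' := hq 3
    simp [quadMap] at h2' h3'
    simp [← h2', ← h3', h2, h3]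
  rwa [hP.quadMap.mult_rescale (mul_ne_zero h2 h3) one_ne_zero, hP.quadMap_quadMap, mult_mul,
    mult_eq_zero (P := (X 2 * X 3) ^ m) (by rw [map_pow]; exact pow_ne_zero _ hq2), zero_add] at h

theorem preimage_exceptionalRing_two {u : ℂ} (h2 : embed br a u 2 ≠ 0) (h3 : embed br a u 3 ≠ 0) :
    pullHom hbr hτ 2 a ⁻¹' exceptionalRing (embed br a u) =
      exceptionalRing (embed br (paramMap 2 a) u) := by
  ext f
  constructor
  · rintro ⟨m, n, A, B, hA, hB, hB0, hAB, hf⟩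
    refine ⟨_, _, _, _, hA.quadMap, hB.quadMap, hB.quadMap_ne_zero hB0, ?_,
      quadMap_lift_of_pullHom hbr hτ a hA hB hf⟩
    have hX : eval (embed br a u) ((X 2 * X 3) ^ m) ≠ 0 := by
      rw [map_pow, map_mul, eval_X, eval_X]
      exact pow_ne_zero _ (mul_ne_zero h2 h3)
    rwa [← mult_embed_quadMap a h2 h3 hA.quadMap, ← mult_embed_quadMap a h2 h3 hB.quadMap,
      hA.quadMap_quadMap, hB.quadMap_quadMap, mult_mul, mult_mul, mult_eq_zero hX, zero_add,
      zero_add]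
  · rintro ⟨m, n, A, B, hA, hB, hB0, hAB, hf⟩
    refine ⟨_, _, _, _, hA.quadMap, hB.quadMap, hB.quadMap_ne_zero hB0, ?_,
      isLift_quadMap hbr hτ a hA hB hf⟩
    rwa [mult_embed_quadMap a h2 h3 hA, mult_embed_quadMap a h2 h3 hB]

include hbr hτ

theorem mult_embed_X_two (k : Fin 8) :
    mult (embed br a ((a : Param).e k)) (X 2) = if k = 1 then 1 else 0 := by
  split_ifs with hk
  · subst hk
    rw [(IsBihomogeneous.X_right (Or.inl rfl)).mult_corner_one
      (a.2.embed_one_eq_zero_iff hbr hτ), quadMap_X_two]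
    simpa using emultiplicity_X_self 3 1
  · apply mult_eq_zero
    rw [eval_X]
    exact mt (a.2.embed_apply_two_eq_zero hbr hτ).1 hk

theorem mult_embed_X_three (k : Fin 8) :
    mult (embed br a ((a : Param).e k)) (X 3) = if k = 0 then 1 else 0 := by
  split_ifs with hk
  · subst hk
    rw [(IsBihomogeneous.X_right (Or.inr rfl)).mult_corner_zero
      (a.2.embed_zero_eq_zero_iff hbr hτ), quadMap_X_three]
    simpa using emultiplicity_X_self 2 1
  · apply mult_eq_zero
    rw [eval_X]
    exact mt (a.2.embed_apply_three_eq_zero hbr hτ).1 hk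

theorem class_X_two : (((0 : ℕ) : ℤ), ((1 : ℕ) : ℤ), fun k =>
    -((mult (embed br a ((a : Param).e k)) (X 2)).toNat : ℤ)) = Hy - E 1 := by
  refine Prod.ext rfl (Prod.ext rfl (funext fun k => ?_))
  simp only [mult_embed_X_two hbr hτ]
  revert k
  decide

theorem class_X_three : (((0 : ℕ) : ℤ), ((1 : ℕ) : ℤ), fun k =>
    -((mult (embed br a ((a : Param).e k)) (X 3)).toNat : ℤ)) = Hy - E 0 := by
  refine Prod.ext rfl (Prod.ext rfl (funext fun k => ?_))
  simp only [mult_embed_X_three hbr hτ]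
  revert k
  decide

theorem isPrimeDivisor_X_two : IsPrimeDivisor br a (curveRing (X 2)) (Hy - E 1) := by
  rw [← class_X_two hbr hτ a]
  exact .curve _ _ _ X_prime.irreducible (.X_right (Or.inl rfl))

theorem isPrimeDivisor_X_three : IsPrimeDivisor br a (curveRing (X 3)) (Hy - E 0) := by
  rw [← class_X_three hbr hτ a]
  exact .curve _ _ _ X_prime.irreducible (.X_right (Or.inr rfl))

theorem preimage_exceptionalRing_zero :
    pullHom hbr hτ 2 a ⁻¹' exceptionalRing (embed br a ((a : Param).e 0)) = curveRing (X 2) :=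
  preimage_exceptionalRing_corner hbr hτ a (Or.inl rfl) fun _ _ _ hP =>
    hP.mult_corner_zero (a.2.embed_zero_eq_zero_iff hbr hτ)

theorem preimage_exceptionalRing_one :
    pullHom hbr hτ 2 a ⁻¹' exceptionalRing (embed br a ((a : Param).e 1)) = curveRing (X 3) :=
  preimage_exceptionalRing_corner hbr hτ a (Or.inr rfl) fun _ _ _ hP =>
    hP.mult_corner_one (a.2.embed_one_eq_zero_iff hbr hτ)

/-- The map is inverse to the one at the transformed parameter, where the exceptional curve of the
corner becomes this line. -/
theorem preimage_curveRing_X_two : pullHom hbr hτ 2 a ⁻¹' curveRing (X 2) =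
    exceptionalRing (embed br (paramMap 2 a) ((paramMap 2 a).e 0)) := by
  rw [← preimage_exceptionalRing_zero hbr hτ (baseMap 2 a)]
  ext f
  rw [Set.mem_preimage, Set.mem_preimage, pullHom_baseMap_pullHom]
  rfl

theorem preimage_curveRing_X_three : pullHom hbr hτ 2 a ⁻¹' curveRing (X 3) =
    exceptionalRing (embed br (paramMap 2 a) ((paramMap 2 a).e 1)) := by
  rw [← preimage_exceptionalRing_one hbr hτ (baseMap 2 a)]
  ext f
  rw [Set.mem_preimage, Set.mem_preimage, pullHom_baseMap_pullHom]
  rfl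

omit hbr hτ in
theorem refl_two_apply (l l' : ℤ) (c : Fin 8 → ℤ) :
    refl 2 (l, l', c) = (l, l + l' + c 0 + c 1, fun k =>
      if k = 0 then -l - c 1 else if k = 1 then -l - c 0 else c k) := by
  rw [refl_apply]
  refine Prod.ext ?_ (Prod.ext ?_ (funext fun k => ?_))
  · simp [simpleRoot, inter, E, Hy]
  · simp [simpleRoot, inter, E, Hy, Fin.sum_univ_eight, Pi.single_apply]
    ring
  · fin_cases k <;>
      simp [simpleRoot, inter, E, Hy, Fin.sum_univ_eight, Pi.single_apply] <;> ring

/-- The two contracted lines and the two corner exceptional curves are exchanged; every other curve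
goes to its strict transform, and the six remaining exceptional curves correspond to each other. -/
theorem isPrimeDivisor_preimage_two {R : Set K} {D : Pic} (h : IsPrimeDivisor br a R D) :
    IsPrimeDivisor br (paramMap 2 a) (pullHom hbr hτ 2 a ⁻¹' R) (refl 2 D) := by
  have hk01 {k : Fin 8} (h0 : k ≠ 0) (h1 : k ≠ 1) : (paramMap 2 a).e k = (a : Param).e k := by
    simp [paramMap, Function.update_of_ne, h0, h1]
  have he2 {k : Fin 8} (h1 : k ≠ 1) : embed br a ((a : Param).e k) 2 ≠ 0 :=
    mt (a.2.embed_apply_two_eq_zero hbr hτ).1 h1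
  have he3 {k : Fin 8} (h0 : k ≠ 0) : embed br a ((a : Param).e k) 3 ≠ 0 :=
    mt (a.2.embed_apply_three_eq_zero hbr hτ).1 h0
  rcases h with ⟨Q, m, n, hQ, hmn⟩ | k
  · by_cases h2 : X 2 ∣ Q
    · have hass : Associated (X 2) Q := (X_prime (R := ℂ)).irreducible.associated_of_dvd hQ h2
      obtain ⟨rfl, rfl⟩ := hmn.inj hQ.ne_zero
        ((IsBihomogeneous.X_right (Or.inl rfl)).of_associated (X_ne_zero 2) hass)
      simp only [← mult_congr hass]
      rw [class_X_two hbr hτ, ← curveRing_congr hass, preimage_curveRing_X_two,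
        show refl 2 (Hy - E 1) = E 0 by decide]
      exact .exceptional 0
    by_cases h3 : X 3 ∣ Q
    · have hass : Associated (X 3) Q := (X_prime (R := ℂ)).irreducible.associated_of_dvd hQ h3
      obtain ⟨rfl, rfl⟩ := hmn.inj hQ.ne_zero
        ((IsBihomogeneous.X_right (Or.inr rfl)).of_associated (X_ne_zero 3) hass)
      simp only [← mult_congr hass]
      rw [class_X_three hbr hτ, ← curveRing_congr hass, preimage_curveRing_X_three,
        show refl 2 (Hy - E 0) = E 1 by decide]
      exact .exceptional 1
    obtain ⟨Q', c, d, hT⟩ := exists_isTransform hQ hmn h2 h3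
    rw [preimage_curveRing_two hbr hτ a hT, refl_two_apply]
    have hb := (baseMap 2 a).2
    have m0 := hT.mult_corner_zero (a.2.embed_zero_eq_zero_iff hbr hτ)
    have m1 := hT.mult_corner_one (a.2.embed_one_eq_zero_iff hbr hτ)
    have m0' := hT.mult_corner_zero' (hb.embed_zero_eq_zero_iff hbr hτ)
    have m1' := hT.mult_corner_one' (hb.embed_one_eq_zero_iff hbr hτ)
    have mk (k : Fin 8) (h0 : k ≠ 0) (h1 : k ≠ 1) :
        mult (embed br (paramMap 2 a) ((paramMap 2 a).e k)) Q' =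
          mult (embed br a ((a : Param).e k)) Q := by
      have hX : eval (embed br a ((a : Param).e k)) (X 2 ^ d * X 3 ^ c) ≠ 0 := by
        simp [he2 h1, he3 h0]
      have hX' : eval (embed br a ((a : Param).e k)) ((X 2 * X 3) ^ m) ≠ 0 := by
        simp [he2 h1, he3 h0]
      have := congrArg (mult (embed br a ((a : Param).e k))) hT.quadMap_eq'
      rw [mult_mul _ (X 2 ^ d * X 3 ^ c), mult_mul _ ((X 2 * X 3) ^ m), mult_eq_zero hX,
        mult_eq_zero hX', zero_add, zero_add,
        mult_embed_quadMap a (he2 h1) (he3 h0) hT.bihom'] at this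
      rw [hk01 h0 h1, this]
    have := IsPrimeDivisor.curve (br := br) (a := paramMap 2 a) _ _ _ hT.irreducible' hT.bihom'
    convert this using 3
    -- The bidegree of the strict transform was computed with truncated subtraction; `add_le` turns
    -- it into the integer `m + n - c - d`.
    · have := hT.add_le
      simp only [m0, m1, ENat.toNat_natCast]
      omega
    · funext k
      split_ifs with h0 h1
      · subst h0
        have h := mult_ne_top (p := embed br (paramMap 2 a) ((paramMap 2 a).e 0)) hT.ne_zero'
        rw [m1]
        change _ + mult (embed br (paramMap 2 a) ((paramMap 2 a).e 0)) Q' = _ at m0'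
        lift mult (embed br (paramMap 2 a) ((paramMap 2 a).e 0)) Q' to ℕ using h with r
        norm_cast at m0'
        simp only [ENat.toNat_natCast]
        omega
      · subst h1
        have h := mult_ne_top (p := embed br (paramMap 2 a) ((paramMap 2 a).e 1)) hT.ne_zero'
        rw [m0]
        change _ + mult (embed br (paramMap 2 a) ((paramMap 2 a).e 1)) Q' = _ at m1'
        lift mult (embed br (paramMap 2 a) ((paramMap 2 a).e 1)) Q' to ℕ using h with r
        norm_cast at m1'
        simp only [ENat.toNat_natCast]
        omega
      · rw [mk k h0 h1]
  · by_cases h0 : k = 0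
    · subst h0
      rw [preimage_exceptionalRing_zero, show refl 2 (E 0) = Hy - E 1 by decide]
      exact isPrimeDivisor_X_two hbr hτ (baseMap 2 a)
    by_cases h1 : k = 1
    · subst h1
      rw [preimage_exceptionalRing_one, show refl 2 (E 1) = Hy - E 0 by decide]
      exact isPrimeDivisor_X_three hbr hτ (baseMap 2 a)
    have hE : refl 2 (E k) = E k := by
      revert k
      decide
    rw [preimage_exceptionalRing_two hbr hτ a (he2 h1) (he3 h0), hE, ← hk01 h0 h1]
    exact .exceptional k

end Quadratic

/-- One implication suffices: the converse is the same implication at the transformed parameter,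
`wᵢ` being an involution of the family. -/
theorem isIsoWithPushforward_generator {τ : ℂ} {br : ℂ → ℂ} (hbr : IsBracket τ br)
    (hτ : 0 < τ.im) (i : Fin 9) (a : GenericParam τ) :
    IsIsoWithPushforward br a ((generator hbr hτ i).base a) ((generator hbr hτ i).pullback a)
      (refl i) := by
  have forward (a : GenericParam τ) (R : Set K) (D : Pic) (h : IsPrimeDivisor br a R D) :
      IsPrimeDivisor br (paramMap i a) (pullHom hbr hτ i a ⁻¹' R) (refl i D) := by
    by_cases hi : i = 2
    · subst hi
      exact isPrimeDivisor_preimage_two hbr hτ a h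
    · exact isPrimeDivisor_preimage_of_ne_two hbr hτ a hi h
  refine fun R D => ⟨forward a R D, fun h => ?_⟩
  have h' := forward (baseMap i a) _ _ h
  have e : pullHom hbr hτ i (baseMap i a) ⁻¹' ((generator hbr hτ i).pullback a ⁻¹' R) = R := by
    ext z
    have := pullHom_comp hbr hτ i a
    change pullHom hbr hτ i a (pullHom hbr hτ i (baseMap i a) z) ∈ R ↔ _
    rw [← AlgHom.comp_apply, this, AlgHom.id_apply]
  rw [e, refl_refl] at h'
  have e' : paramMap i (baseMap i a : GenericParam τ) = a := paramMap_paramMap i a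
  rwa [e'] at h'

end E8Bir

namespace E8Bir

open MvPolynomial

/-! ### Rational functions without poles are constant -/

theorem IsBihomogeneous.eq_C {P : MvPolynomial (Fin 4) ℂ} (h : IsBihomogeneous P 0 0) :
    P = C (coeff 0 P) := by
  ext d
  rw [coeff_C]
  split_ifs with hd
  · rw [hd]
  · by_contra hne
    have := h d (mem_support_iff.2 hne)
    apply hd
    ext l
    fin_cases l <;> simp <;> omega

/-- In a coprime fraction every irreducible factor of the denominator is a pole, so the denominator
is a unit and both bidegrees are zero. -/
theorem exists_eq_algebraMap_of_mem_curveRing {f : K}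
    (h : ∀ Q m n, Irreducible Q → IsBihomogeneous Q m n → f ∈ curveRing Q) :
    ∃ c : ℂ, f = algebraMap ℂ K c := by
  obtain ⟨m, n, A, B, hA, hB, hB0, hrel, hf⟩ := exists_bihomogeneous_fraction f
  by_cases hu : IsUnit B
  · have h1 : IsBihomogeneous (1 : MvPolynomial (Fin 4) ℂ) 0 0 := by
      simpa using IsBihomogeneous.C 1
    obtain ⟨rfl, rfl⟩ := hB.inj hB0
      (h1.of_associated one_ne_zero (associated_one_iff_isUnit.2 hu).symm)
    rw [hA.eq_C, hB.eq_C, dehom_C, dehom_C] at hf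
    have hb : coeff 0 B ≠ 0 := by
      intro h0
      rw [hB.eq_C, h0, map_zero] at hB0
      exact hB0 rfl
    refine ⟨coeff 0 A / coeff 0 B, ?_⟩
    rw [map_div₀, ← hf, mul_div_cancel_right₀]
    simpa using hb
  · obtain ⟨Q, hQ, hQB⟩ := WfDvdMonoid.exists_irreducible_factor hu hB0
    obtain ⟨k, l, hkl⟩ := hB.of_dvd hB0 hQB
    obtain ⟨m', n', A', B', hA', hB', hQB', hf'⟩ := h Q k l hQ hkl
    have heq : A * B' = A' * B := by
      refine (hA.mul hB').eq_of_dehom (add_comm m' m ▸ add_comm n' n ▸ hA'.mul hB) ?_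
      rw [map_mul, map_mul, ← hf, ← hf']
      ring
    have hdvd : Q ∣ A * B' := heq ▸ dvd_mul_of_dvd_right hQB _
    exact absurd (hrel ((hQ.prime.dvd_or_dvd hdvd).resolve_right hQB') hQB) hQ.not_isUnit

/-! ### The local rings of curves -/

section CurveRing

variable {Q L₀ L₁ : MvPolynomial (Fin 4) ℂ} {m n : ℕ}

theorem mul_mem_curveRing (hQ : Prime Q) {f g : K} (hf : f ∈ curveRing Q) (hg : g ∈ curveRing Q) :
    f * g ∈ curveRing Q := by
  obtain ⟨m, n, A, B, hA, hB, hQB, h⟩ := hf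
  obtain ⟨m', n', A', B', hA', hB', hQB', h'⟩ := hg
  refine ⟨_, _, _, _, hA.mul hA', hB.mul hB', fun hd => ?_, ?_⟩
  · rcases hQ.dvd_or_dvd hd with hd | hd
    exacts [hQB hd, hQB' hd]
  · rw [map_mul, map_mul, ← h, ← h']
    ring

theorem IsBihomogeneous.dehom_ne_zero (h : IsBihomogeneous Q m n) (h0 : Q ≠ 0) : dehom Q ≠ 0 :=
  fun hd => h0 (h.eq_zero_of_dehom hd)

theorem div_mem_curveRing (h0 : IsBihomogeneous L₀ m n) (h1 : IsBihomogeneous L₁ m n)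
    (hQ : ¬ Q ∣ L₁) : dehom L₀ / dehom L₁ ∈ curveRing Q := by
  have hne : L₁ ≠ 0 := by
    rintro rfl
    exact hQ (dvd_zero _)
  exact ⟨m, n, L₀, L₁, h0, h1, hQ, div_mul_cancel₀ _ (h1.dehom_ne_zero hne)⟩

theorem div_notMem_curveRing (h0 : IsBihomogeneous L₀ m n) (h1 : IsBihomogeneous L₁ m n)
    (hP : Prime L₀) (hd : ¬ L₀ ∣ L₁) : dehom L₁ / dehom L₀ ∉ curveRing L₀ := by
  rintro ⟨k, l, A, B, hA, hB, hQB, hf⟩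
  have heq : L₁ * B = L₀ * A := by
    refine (h1.mul hB).eq_of_dehom (h0.mul hA) ?_
    rw [map_mul, map_mul, ← hf]
    have := h0.dehom_ne_zero hP.ne_zero
    field_simp
  have : L₀ ∣ L₁ * B := heq ▸ dvd_mul_right _ _
  rcases hP.dvd_or_dvd this with h | h
  exacts [hd h, hQB h]

/-- The quotient `L₀ / L₁` is a uniformizer of the local ring of `L₀ = 0`. -/
theorem div_uniformizer_mem (h0 : IsBihomogeneous L₀ m n) (h1 : IsBihomogeneous L₁ m n)
    (hP : Prime L₀) {z : K} (hz : z ∈ curveRing L₀) (hz' : z⁻¹ ∉ curveRing L₀) :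
    z * (dehom L₁ / dehom L₀) ∈ curveRing L₀ := by
  obtain ⟨k, l, A, B, hA, hB, hQB, hf⟩ := hz
  have hB0 : B ≠ 0 := by
    rintro rfl
    exact hQB (dvd_zero _)
  -- Otherwise `B / A` would exhibit `z⁻¹` in the local ring.
  obtain ⟨A', rfl⟩ : L₀ ∣ A := by
    by_contra hd
    refine hz' ⟨k, l, B, A, hB, hA, hd, ?_⟩
    have hA0 : A ≠ 0 := by
      rintro rfl
      exact hd (dvd_zero _)
    have hz0 : z ≠ 0 := by
      rintro rfl
      rw [zero_mul] at hf
      exact hA.dehom_ne_zero hA0 hf.symm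
    rw [← hf, inv_mul_cancel_left₀ hz0]
  refine ⟨k, l, L₁ * A', B, ?_, hB, hQB, ?_⟩
  · obtain rfl | hne := eq_or_ne A' 0
    · simpa using IsBihomogeneous.zero k l
    · have hne' := mul_ne_zero hP.ne_zero hne
      obtain ⟨k', l', hA'⟩ := hA.of_dvd hne' (dvd_mul_left _ _)
      obtain ⟨rfl, rfl⟩ := (h0.mul hA').inj hne' hA
      exact h1.mul hA'
  · rw [map_mul] at hf ⊢
    have := h0.dehom_ne_zero hP.ne_zero
    rw [mul_right_comm, hf]
    field_simp

end CurveRing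

theorem IsPrimeDivisor.cases {br : ℂ → ℂ} {a : Param} {R : Set K} {D : Pic}
    (h : IsPrimeDivisor br a R D) :
    (∃ Q m n, Irreducible Q ∧ IsBihomogeneous Q m n ∧ R = curveRing Q ∧
      D = ((m : ℤ), (n : ℤ), fun k => -((mult (embed br a (a.e k)) Q).toNat : ℤ))) ∨
    ∃ k, D = E k := by
  rcases h with ⟨Q, m, n, hQ, hmn⟩ | k
  · exact Or.inl ⟨Q, m, n, hQ, hmn, rfl, rfl⟩
  · exact Or.inr ⟨k, rfl⟩

/-- A curve which is determined by its class. -/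
structure IsRigid (br : ℂ → ℂ) (a : Param) (L : MvPolynomial (Fin 4) ℂ) (m n : ℕ) : Prop where
  irreducible : Irreducible L
  bihom : IsBihomogeneous L m n
  unique : ∃ D, IsPrimeDivisor br a (curveRing L) D ∧
    ∀ R, IsPrimeDivisor br a R D → R = curveRing L

section Rigid

variable {br : ℂ → ℂ} {a : Param} {φ : K ≃ₐ[ℂ] K}
  (h : IsIsoWithPushforward br a a φ (LinearEquiv.refl ℤ Pic))

include h

theorem IsRigid.mem_iff {L : MvPolynomial (Fin 4) ℂ} {m n : ℕ} (hL : IsRigid br a L m n) (z : K) :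
    φ z ∈ curveRing L ↔ z ∈ curveRing L := by
  obtain ⟨D, hD, huniq⟩ := hL.unique
  rw [← Set.mem_preimage, huniq _ ((h _ _).1 hD)]

/-- The quotient `f = L₀ / L₁` has its zero along `L₀` and its pole along `L₁`, and both curves are
preserved. Hence `φ f / f` has no pole on any curve and is constant. -/
theorem IsRigid.exists_eq {L₀ L₁ : MvPolynomial (Fin 4) ℂ} {m n : ℕ} (h₀ : IsRigid br a L₀ m n)
    (h₁ : IsRigid br a L₁ m n) (hd : ¬ L₀ ∣ L₁) :
    ∃ c : ℂ, φ (dehom L₀ / dehom L₁) = algebraMap ℂ K c * (dehom L₀ / dehom L₁) := by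
  have hd' : ¬ L₁ ∣ L₀ := fun h' => hd (h₁.irreducible.dvd_symm h₀.irreducible h')
  have n₀ := h₀.bihom.dehom_ne_zero h₀.irreducible.ne_zero
  have n₁ := h₁.bihom.dehom_ne_zero h₁.irreducible.ne_zero
  suffices ∃ c : ℂ, φ (dehom L₀ / dehom L₁) * (dehom L₁ / dehom L₀) = algebraMap ℂ K c by
    obtain ⟨c, hc⟩ := this
    refine ⟨c, ?_⟩
    rw [← hc]
    field_simp
  refine exists_eq_algebraMap_of_mem_curveRing fun Q k l hQ hkl => ?_
  by_cases c₀ : curveRing Q = curveRing L₀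
  · rw [c₀]
    refine div_uniformizer_mem h₀.bihom h₁.bihom h₀.irreducible.prime
      ((h₀.mem_iff h _).2 (div_mem_curveRing h₀.bihom h₁.bihom hd)) ?_
    rw [← map_inv₀, h₀.mem_iff h, inv_div]
    exact div_notMem_curveRing h₀.bihom h₁.bihom h₀.irreducible.prime hd
  by_cases c₁ : curveRing Q = curveRing L₁
  · rw [c₁]
    -- Along `L₁` the uniformizer argument is applied to `φ.symm` and `L₁ / L₀`, and the result is
    -- carried back by `φ`, which preserves this local ring.
    have hs (z : K) : φ.symm z ∈ curveRing L₁ ↔ z ∈ curveRing L₁ := by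
      rw [← h₁.mem_iff h, φ.apply_symm_apply]
    have key := div_uniformizer_mem (z := φ.symm (dehom L₁ / dehom L₀)) h₁.bihom h₀.bihom
      h₁.irreducible.prime ((hs _).2 (div_mem_curveRing h₁.bihom h₀.bihom hd')) (by
        rw [← map_inv₀, hs, inv_div]
        exact div_notMem_curveRing h₁.bihom h₀.bihom h₁.irreducible.prime hd')
    rw [← h₁.mem_iff h, map_mul, φ.apply_symm_apply, mul_comm] at key
    exact key
  · have hQ₀ : ¬ Q ∣ L₀ := fun hq =>
      c₀ (curveRing_congr (hQ.associated_of_dvd h₀.irreducible hq))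
    refine mul_mem_curveRing hQ.prime ?_ (div_mem_curveRing h₁.bihom h₀.bihom hQ₀)
    rw [← Set.mem_preimage (f := φ)]
    rcases ((h _ _).1 (IsPrimeDivisor.curve Q k l hQ hkl)).cases with
      ⟨Q', k', l', hQ', -, hR, -⟩ | ⟨j, hj⟩
    · rw [hR]
      refine div_mem_curveRing h₀.bihom h₁.bihom fun hq => c₁ ?_
      have hcongr := curveRing_congr (hQ'.associated_of_dvd h₁.irreducible hq)
      apply φ.surjective.preimage_injective
      rw [hR, hcongr]
      ext z
      exact (h₁.mem_iff h z).symm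
    -- An exceptional class would force bidegree `(0, 0)`, making the irreducible `Q` a constant.
    · have e1 : (k : ℤ) = 0 := congrArg Prod.fst hj
      have e2 : (l : ℤ) = 0 := congrArg (fun D : Pic => D.2.1) hj
      obtain rfl : k = 0 := by exact_mod_cast e1
      obtain rfl : l = 0 := by exact_mod_cast e2
      refine absurd ?_ hQ.not_isUnit
      have h0 := hQ.ne_zero
      rw [hkl.eq_C] at h0 ⊢
      exact (IsUnit.mk0 _ fun hc => h0 (by rw [hc, map_zero])).map C

end Rigid

/-! ### Lines through the points -/

theorem IsBihomogeneous.irreducible_of_add_eq_one {P : MvPolynomial (Fin 4) ℂ} {m n : ℕ}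
    (h : IsBihomogeneous P m n) (h0 : P ≠ 0) (hmn : m + n = 1) : Irreducible P := by
  have hu {Q : MvPolynomial (Fin 4) ℂ} (hQ : IsBihomogeneous Q 0 0) (h0 : Q ≠ 0) : IsUnit Q := by
    rw [hQ.eq_C] at h0 ⊢
    exact (IsUnit.mk0 _ fun hc => h0 (by rw [hc, map_zero])).map C
  refine ⟨fun hP => ?_, fun A B hAB => ?_⟩
  · have h1 : IsBihomogeneous (1 : MvPolynomial (Fin 4) ℂ) 0 0 := by
      simpa using IsBihomogeneous.C 1
    have := h.inj h0 (h1.of_associated one_ne_zero (associated_one_iff_isUnit.2 hP).symm)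
    omega
  · subst hAB
    obtain ⟨k, l, hA⟩ := h.of_mul h0
    obtain ⟨k', l', hB⟩ := h.of_dvd h0 (dvd_mul_left B A)
    have := (hA.mul hB).inj h0 h
    have : (k = 0 ∧ l = 0) ∨ (k' = 0 ∧ l' = 0) := by omega
    rcases this with ⟨rfl, rfl⟩ | ⟨rfl, rfl⟩
    · exact Or.inl (hu hA (left_ne_zero_of_mul h0))
    · exact Or.inr (hu hB (right_ne_zero_of_mul h0))

/-- `X i`, `X j` are the homogeneous coordinates of one of the two factors `ℙ¹`. -/
def IsFactor (i j : Fin 4) (m n : ℕ) : Prop :=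
  i = 0 ∧ j = 1 ∧ m = 1 ∧ n = 0 ∨ i = 2 ∧ j = 3 ∧ m = 0 ∧ n = 1

/-- The equation of the line through `p`. -/
noncomputable def line (p : Fin 4 → ℂ) (i j : Fin 4) : MvPolynomial (Fin 4) ℂ :=
  C (p j) * X i - C (p i) * X j

section Line

variable {i j : Fin 4} {m n : ℕ} (hij : IsFactor i j m n)

include hij

theorem IsFactor.bihom_left : IsBihomogeneous (X i) m n := by
  rcases hij with ⟨rfl, rfl, rfl, rfl⟩ | ⟨rfl, rfl, rfl, rfl⟩
  · exact .X_left (by decide)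
  · exact .X_right (by decide)

theorem IsFactor.bihom_right : IsBihomogeneous (X j) m n := by
  rcases hij with ⟨rfl, rfl, rfl, rfl⟩ | ⟨rfl, rfl, rfl, rfl⟩
  · exact .X_left (by decide)
  · exact .X_right (by decide)

theorem IsFactor.add_eq_one : m + n = 1 := by
  rcases hij with ⟨rfl, rfl, rfl, rfl⟩ | ⟨rfl, rfl, rfl, rfl⟩ <;> rfl

theorem IsFactor.ne : i ≠ j := by
  rcases hij with ⟨rfl, rfl, rfl, rfl⟩ | ⟨rfl, rfl, rfl, rfl⟩ <;> decide

theorem IsFactor.eq_add {Q : MvPolynomial (Fin 4) ℂ} (hQ : IsBihomogeneous Q m n) :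
    Q = C (coeff (Finsupp.single i 1) Q) * X i + C (coeff (Finsupp.single j 1) Q) * X j := by
  have hne := hij.ne
  ext d
  rw [coeff_add, coeff_C_mul, coeff_C_mul, coeff_X, coeff_X]
  by_cases hd : coeff d Q = 0
  · rw [hd]
    split_ifs with h1 h2 h2
    · exact absurd (Finsupp.single_left_injective one_ne_zero (h1.trans h2.symm)) hne
    · rw [h1, hd]; ring
    · rw [h2, hd]; ring
    · ring
  · have h1 := hQ d (mem_support_iff.2 hd)
    have : d = Finsupp.single i 1 ∨ d = Finsupp.single j 1 := by
      rcases hij with ⟨rfl, rfl, rfl, rfl⟩ | ⟨rfl, rfl, rfl, rfl⟩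
      · rcases Nat.eq_zero_or_pos (d 0) with h | h
        · right
          ext l
          fin_cases l <;> simp <;> omega
        · left
          ext l
          fin_cases l <;> simp <;> omega
      · rcases Nat.eq_zero_or_pos (d 2) with h | h
        · right
          ext l
          fin_cases l <;> simp <;> omega
        · left
          ext l
          fin_cases l <;> simp <;> omega
    have hs : Finsupp.single i 1 ≠ Finsupp.single j 1 := fun h =>
      hne (Finsupp.single_left_injective one_ne_zero h)
    rcases this with rfl | rfl
    · simp [hs.symm]
    · simp [hs]

theorem IsFactor.bihom_line (p : Fin 4 → ℂ) : IsBihomogeneous (line p i j) m n :=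
  (hij.bihom_left.C_mul _).sub (hij.bihom_right.C_mul _)

theorem IsFactor.line_ne_zero {p : Fin 4 → ℂ} (hp : p i ≠ 0 ∨ p j ≠ 0) : line p i j ≠ 0 := by
  have hne := hij.ne
  intro h
  have h1 := congrArg (coeff (Finsupp.single i 1)) h
  have h2 := congrArg (coeff (Finsupp.single j 1)) h
  have hs : Finsupp.single i 1 ≠ Finsupp.single j 1 := fun h =>
    hne (Finsupp.single_left_injective one_ne_zero h)
  simp [line, coeff_X, hs, hs.symm] at h1 h2
  rcases hp with hp | hp
  exacts [hp h2, hp h1]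

/-- A prime divisor of the same class is a curve of the same bidegree whose multiplicity at the
`k`-th point is again positive, and a ruling has only one line through a given point. -/
theorem IsFactor.isRigid_line {br : ℂ → ℂ} {a : Param} {k : Fin 8}
    (hp : embed br a (a.e k) i ≠ 0 ∨ embed br a (a.e k) j ≠ 0) :
    IsRigid br a (line (embed br a (a.e k)) i j) m n := by
  set p := embed br a (a.e k) with hpdef
  have h0 := hij.line_ne_zero hp
  have hirr := (hij.bihom_line p).irreducible_of_add_eq_one h0 hij.add_eq_one
  refine ⟨hirr, hij.bihom_line p, _, .curve _ m n hirr (hij.bihom_line p), fun R hR => ?_⟩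
  rcases hR.cases with ⟨Q, m', n', hQ, hQb, rfl, hD⟩ | ⟨l, hl⟩
  · have e1 : (m : ℤ) = m' := congrArg Prod.fst hD
    have e2 : (n : ℤ) = n' := congrArg (fun D : Pic => D.2.1) hD
    have e3 := congrArg (fun D : Pic => D.2.2 k) hD
    obtain rfl : m = m' := by exact_mod_cast e1
    obtain rfl : n = n' := by exact_mod_cast e2
    simp only [neg_inj, Nat.cast_inj, ← hpdef] at e3
    have hl1 : 1 ≤ mult p (line p i j) := by
      rw [one_le_mult_iff]
      simp [line]
      ring
    have hQ1 : eval p Q = 0 := by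
      rw [← one_le_mult_iff]
      have ht := mult_ne_top (p := p) h0
      have ht' := mult_ne_top (p := p) hQ.ne_zero
      lift mult p (line p i j) to ℕ using ht with r
      lift mult p Q to ℕ using ht' with r'
      simp only [ENat.toNat_natCast] at e3
      rwa [← e3]
    rw [hij.eq_add hQb] at hQ1
    set α := coeff (Finsupp.single i 1) Q
    set β := coeff (Finsupp.single j 1) Q
    simp only [map_add, map_mul, eval_C, eval_X] at hQ1
    obtain ⟨c, hc⟩ : ∃ c : ℂ, Q = C c * line p i j := by
      rcases hp with hp | hp
      · refine ⟨-β / p i, ?_⟩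
        have e4 : α = -β / p i * p j := by
          field_simp
          linear_combination hQ1
        have e5 : β = -(-β / p i * p i) := by field_simp
        rw [hij.eq_add hQb, line]
        change C α * X i + C β * X j = _
        rw [mul_sub, ← mul_assoc, ← mul_assoc, ← C_mul, ← C_mul, ← e4, sub_eq_add_neg, ← neg_mul,
          ← C_neg, ← e5]
      · refine ⟨α / p j, ?_⟩
        have e4 : α = α / p j * p j := by field_simp
        have e5 : β = -(α / p j * p i) := by
          field_simp
          linear_combination hQ1
        rw [hij.eq_add hQb, line]
        change C α * X i + C β * X j = _
        rw [mul_sub, ← mul_assoc, ← mul_assoc, ← C_mul, ← C_mul, ← e4, sub_eq_add_neg, ← neg_mul,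
          ← C_neg, ← e5]
    exact (curveRing_congr (hirr.associated_of_dvd hQ ⟨C c, by rw [hc, mul_comm]⟩)).symm
  · have e1 : (m : ℤ) = 0 := congrArg Prod.fst hl
    have e2 : (n : ℤ) = 0 := congrArg (fun D : Pic => D.2.1) hl
    have := hij.add_eq_one
    omega

end Line

theorem eq_zero_of_algebraMap_mul_eq {s : Fin 2} {α β : ℂ}
    (h : algebraMap ℂ K α * algebraMap (MvPolynomial (Fin 2) ℂ) K (X s) = algebraMap ℂ K β) :
    α = 0 ∧ β = 0 := by
  rw [IsScalarTower.algebraMap_apply ℂ (MvPolynomial (Fin 2) ℂ) K α,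
    IsScalarTower.algebraMap_apply ℂ (MvPolynomial (Fin 2) ℂ) K β, ← map_mul] at h
  have h' := algebraMap_K_injective h
  rw [algebraMap_eq] at h'
  have h1 := congrArg (coeff (Finsupp.single s 1)) h'
  have h2 := congrArg (coeff 0) h'
  simp [coeff_C, (Finsupp.single_ne_zero.2 one_ne_zero : Finsupp.single s 1 ≠ 0).symm] at h1 h2
  exact ⟨h1, h2.symm⟩

/-- Let `t` be the affine coordinate. The lines through the first two points are `t = ∞` and `t =
0`, so `φ t = c t`. The line `t = t₃` through the third point gives `φ (t - t₃) = c' (t - t₃)`, and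
`t₃ ≠ 0` forces `c = c' = 1`. -/
theorem IsFactor.map_eq {i j : Fin 4} {m n : ℕ} (hij : IsFactor i j m n) {br : ℂ → ℂ} {a : Param}
    (h0 : embed br a (a.e 0) i ≠ 0) (h0' : embed br a (a.e 0) j = 0)
    (h1 : embed br a (a.e 1) i = 0) (h1' : embed br a (a.e 1) j ≠ 0)
    (h2 : embed br a (a.e 2) i ≠ 0) (h2' : embed br a (a.e 2) j ≠ 0) {φ : K ≃ₐ[ℂ] K}
    (h : IsIsoWithPushforward br a a φ (LinearEquiv.refl ℤ Pic)) {s : Fin 2}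
    (hi : dehom (X i) = algebraMap (MvPolynomial (Fin 2) ℂ) K (X s)) (hj : dehom (X j) = 1) :
    φ (dehom (X i)) = dehom (X i) := by
  have hd {k : Fin 8} (hk : embed br a (a.e k) j ≠ 0) :
      ¬ line (embed br a (a.e k)) i j ∣ line (embed br a (a.e 0)) i j := by
    intro hd
    have := map_dvd (eval (embed br a (a.e k))) hd
    simp [line, h0', mul_comm (embed br a (a.e k) j), h0, hk] at this
  have r0 := hij.isRigid_line (br := br) (a := a) (k := 0) (Or.inl h0)
  obtain ⟨c, hc⟩ := (hij.isRigid_line (br := br) (a := a) (k := 1) (Or.inr h1')).exists_eq h r0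
    (hd h1')
  obtain ⟨c', hc'⟩ := (hij.isRigid_line (br := br) (a := a) (k := 2) (Or.inl h2)).exists_eq h r0
    (hd h2')
  have inj {z : ℂ} (hz : z ≠ 0) : algebraMap ℂ K z ≠ 0 := by simpa using hz
  have n0 := inj h0
  have n1 := inj h1'
  simp only [line, h0', h1, map_sub, map_mul, map_zero, map_zero, zero_mul, sub_zero, zero_sub,
    dehom_C, hj, mul_one, map_div₀, map_neg, AlgEquiv.commutes] at hc hc'
  have e1 : φ (dehom (X i)) = algebraMap ℂ K c * dehom (X i) := by
    field_simp at hc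
    linear_combination -hc
  rw [e1] at hc'
  have e2 : algebraMap ℂ K (embed br a (a.e 2) j * (c - c')) * dehom (X i) =
      algebraMap ℂ K (embed br a (a.e 2) i * (1 - c')) := by
    field_simp at hc'
    simp only [map_mul, map_sub, map_one]
    linear_combination -hc'
  rw [hi] at e2
  obtain ⟨e3, e4⟩ := eq_zero_of_algebraMap_mul_eq e2
  have e5 := (mul_eq_zero.1 e3).resolve_left h2'
  have e6 := (mul_eq_zero.1 e4).resolve_left h2
  have e7 : c = 1 := by linear_combination e5 - e6
  rw [e1, e7, map_one, one_mul]

/-- An automorphism of the blown-up surface which acts trivially on the Picard lattice is the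
identity. -/
theorem IsGeneric.eq_refl {τ : ℂ} {br : ℂ → ℂ} {a : Param} (ha : IsGeneric τ a)
    (hbr : IsBracket τ br) (hτ : 0 < τ.im) {φ : K ≃ₐ[ℂ] K}
    (h : IsIsoWithPushforward br a a φ (LinearEquiv.refl ℤ Pic)) : φ = AlgEquiv.refl := by
  have z0 := ha.embed_zero_eq_zero_iff hbr hτ
  have z1 := ha.embed_one_eq_zero_iff hbr hτ
  have hx : φ x = x := by
    have := IsFactor.map_eq (i := 0) (j := 1) (m := 1) (n := 0) (s := 0)
      (Or.inl ⟨rfl, rfl, rfl, rfl⟩) (by simp [z0]) (by simp [z0]) (by simp [z1]) (by simp [z1])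
      (by simp [ha.embed_apply_zero_eq_zero hbr hτ]) (by simp [ha.embed_apply_one_eq_zero hbr hτ])
      h dehom_X_zero dehom_X_one
    rwa [dehom_X_zero] at this
  have hy : φ y = y := by
    have := IsFactor.map_eq (i := 2) (j := 3) (m := 0) (n := 1) (s := 1)
      (Or.inr ⟨rfl, rfl, rfl, rfl⟩) (by simp [z0]) (by simp [z0]) (by simp [z1]) (by simp [z1])
      (by simp [ha.embed_apply_two_eq_zero hbr hτ])
      (by simp [ha.embed_apply_three_eq_zero hbr hτ]) h dehom_X_two dehom_X_three
    rwa [dehom_X_two] at this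
  have : (φ : K →ₐ[ℂ] K) = AlgHom.id ℂ K := K_algHom_ext hx hy
  exact AlgEquiv.ext fun z => DFunLike.congr_fun this z

end E8Bir

/-! ### Assembly of the representation. -/

namespace E8Bir

/-- The pairs of a Weyl group element and a birational map of the family which acts on the
parameters and on the Picard lattices by this element. -/
def compatiblePairs (τ : ℂ) (br : ℂ → ℂ) : Subgroup (affineWeylE8 × FamilyBir τ) where
  carrier := {q | ∀ a : GenericParam τ, (∀ D, period (q.2.base a) (q.1.1 D) = period a D) ∧
    IsIsoWithPushforward br a (q.2.base a) (q.2.pullback a) q.1.1}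
  mul_mem' {q r} hq hr a :=
    ⟨fun D => ((hq (r.2.base a)).1 (r.1.1 D)).trans ((hr a).1 D),
      fun R D => ((hr a).2 R D).trans ((hq (r.2.base a)).2 _ _)⟩
  one_mem' _ := ⟨fun _ => rfl, fun _ _ => Iff.rfl⟩
  inv_mem' {q} hq a := by
    obtain ⟨b, rfl⟩ := q.2.base.surjective a
    have hb : q.2⁻¹.base (q.2.base b) = b := q.2.base.symm_apply_apply b
    have hφ : q.2⁻¹.pullback (q.2.base b) = (q.2.pullback b).symm := by
      change (q.2.pullback (q.2⁻¹.base (q.2.base b))).symm = _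
      rw [hb]
    have hg (D : Pic) : q.1.1 (q.1.1⁻¹ D) = D := q.1.1.apply_symm_apply D
    change (∀ D, period (q.2⁻¹.base (q.2.base b)) (q.1.1⁻¹ D) = period (q.2.base b) D) ∧
      IsIsoWithPushforward br (q.2.base b) (q.2⁻¹.base (q.2.base b))
        (q.2⁻¹.pullback (q.2.base b)) q.1.1⁻¹
    rw [hb, hφ]
    refine ⟨fun D => ?_, fun R D => ?_⟩
    · rw [← (hq b).1, hg]
    · have h := (hq b).2 ((q.2.pullback b).symm ⁻¹' R) (q.1.1⁻¹ D)
      have hR : q.2.pullback b ⁻¹' ((q.2.pullback b).symm ⁻¹' R) = R := by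
        ext z
        simp
      rw [hg, hR] at h
      exact h.symm

theorem generator_mem_compatiblePairs {τ : ℂ} {br : ℂ → ℂ} (hbr : IsBracket τ br) (hτ : 0 < τ.im)
    (i : Fin 9) : (w i, generator hbr hτ i) ∈ compatiblePairs τ br :=
  fun a => ⟨fun D => period_paramMap i a D, isIsoWithPushforward_generator hbr hτ i a⟩

theorem exists_mem_compatiblePairs {τ : ℂ} {br : ℂ → ℂ} (hbr : IsBracket τ br) (hτ : 0 < τ.im)
    (g : affineWeylE8) : ∃ f, (g, f) ∈ compatiblePairs τ br := by
  have hle : affineWeylE8 ≤ (compatiblePairs τ br).map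
      (affineWeylE8.subtype.comp (MonoidHom.fst affineWeylE8 (FamilyBir τ))) := by
    refine (Subgroup.closure_le _).2 ?_
    rintro _ ⟨i, rfl⟩
    exact Subgroup.mem_map.2 ⟨(w i, generator hbr hτ i), generator_mem_compatiblePairs hbr hτ i, rfl⟩
  obtain ⟨⟨g', f⟩, hf, hg⟩ := Subgroup.mem_map.1 (hle g.2)
  exact ⟨f, (Subtype.ext hg : g' = g) ▸ hf⟩

/-- The periods determine the parameters, so the base map is trivial; each fibre map is then an
automorphism to which rigidity applies. -/
theorem eq_one_of_mem_compatiblePairs {τ : ℂ} {br : ℂ → ℂ} (hbr : IsBracket τ br) (hτ : 0 < τ.im)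
    {f : FamilyBir τ} (hf : ((1 : affineWeylE8), f) ∈ compatiblePairs τ br) : f = 1 := by
  have hbase (a : GenericParam τ) : f.base a = a :=
    Subtype.ext (param_ext_of_period fun D => (hf a).1 D)
  refine FamilyBir.ext (Equiv.ext hbase) (funext fun a => ?_)
  have h := (hf a).2
  change IsIsoWithPushforward br a (f.base a) (f.pullback a) (LinearEquiv.refl ℤ Pic) at h
  rw [hbase] at h
  exact a.2.eq_refl hbr hτ h

/-- This replaces the check of the defining relations: a relation among the `wᵢ` gives a compatible
pair over 1, whose second component is trivial. -/
theorem bijective_fst_compatiblePairs {τ : ℂ} {br : ℂ → ℂ} (hbr : IsBracket τ br) (hτ : 0 < τ.im) :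
    Function.Bijective ((MonoidHom.fst affineWeylE8 (FamilyBir τ)).comp
      (compatiblePairs τ br).subtype) := by
  refine ⟨(injective_iff_map_eq_one _).2 ?_, fun g => ?_⟩
  · rintro ⟨⟨g, f⟩, hq⟩ (rfl : g = 1)
    exact Subtype.ext (Prod.ext rfl (eq_one_of_mem_compatiblePairs hbr hτ hq))
  · obtain ⟨f, hf⟩ := exists_mem_compatiblePairs hbr hτ g
    exact ⟨⟨(g, f), hf⟩, rfl⟩

/-- The birational representation of the affine Weyl group. -/
noncomputable def representation {τ : ℂ} {br : ℂ → ℂ} (hbr : IsBracket τ br) (hτ : 0 < τ.im) :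
    affineWeylE8 →* FamilyBir τ :=
  ((MonoidHom.snd affineWeylE8 (FamilyBir τ)).comp (compatiblePairs τ br).subtype).comp
    (MulEquiv.ofBijective _ (bijective_fst_compatiblePairs hbr hτ)).symm.toMonoidHom

theorem representation_eq {τ : ℂ} {br : ℂ → ℂ} (hbr : IsBracket τ br) (hτ : 0 < τ.im)
    {g : affineWeylE8} {f : FamilyBir τ} (h : (g, f) ∈ compatiblePairs τ br) :
    representation hbr hτ g = f := by
  have : (MulEquiv.ofBijective _ (bijective_fst_compatiblePairs hbr hτ)).symm g = ⟨(g, f), h⟩ :=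
    (MulEquiv.symm_apply_eq _).2 rfl
  change ((MulEquiv.ofBijective _ (bijective_fst_compatiblePairs hbr hτ)).symm g).1.2 = f
  rw [this]

theorem representation_mem {τ : ℂ} {br : ℂ → ℂ} (hbr : IsBracket τ br) (hτ : 0 < τ.im)
    (g : affineWeylE8) : (g, representation hbr hτ g) ∈ compatiblePairs τ br := by
  obtain ⟨f, hf⟩ := exists_mem_compatiblePairs hbr hτ g
  rwa [representation_eq hbr hτ hf]

theorem representation_w {τ : ℂ} {br : ℂ → ℂ} (hbr : IsBracket τ br) (hτ : 0 < τ.im) (i : Fin 9) :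
    representation hbr hτ (w i) = generator hbr hτ i :=
  representation_eq hbr hτ (generator_mem_compatiblePairs hbr hτ i)

end E8Bir

theorem mainTheorem6 (τ : ℂ) (hτ : 0 < τ.im) (br : ℂ → ℂ) (hbr : E8Bir.IsBracket τ br) :
    ∃ ρ : E8Bir.affineWeylE8 →* E8Bir.FamilyBir τ,
      -- the generators act by the explicit maps
      (∀ (i : Fin 9) (a : E8Bir.GenericParam τ),
        ((ρ (E8Bir.w i)).base a : E8Bir.Param) = E8Bir.paramMap i a ∧
        ((ρ (E8Bir.w i)).pullback a E8Bir.x, (ρ (E8Bir.w i)).pullback a E8Bir.y) =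
          E8Bir.xyMap br E8Bir.K i a E8Bir.x E8Bir.y) ∧
      -- every `g` acts on the parameters through its action on the Picard lattice
      (∀ (g : E8Bir.affineWeylE8) (a : E8Bir.GenericParam τ) (D : E8Bir.Pic),
        E8Bir.period ((ρ g).base a) (g.1 D) = E8Bir.period a D) ∧
      -- every `g` acts by isomorphisms of the blown-up surfaces, inducing `g` on the Picard lattice
      (∀ (g : E8Bir.affineWeylE8) (a : E8Bir.GenericParam τ),
        E8Bir.IsIsoWithPushforward br a ((ρ g).base a) ((ρ g).pullback a) g.1) ∧
      -- the maps of the generators carry `ι(u)` to `ῑ(u)`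
      (∀ (i : Fin 9) (a : E8Bir.GenericParam τ) (u : ℂ),
        (∀ j, E8Bir.embed br a u j ≠ 0) →
        E8Bir.xyMap br ℂ i a (E8Bir.F br a 0 1 u) (E8Bir.G br a 0 1 u) =
          (E8Bir.F br (E8Bir.paramMap i a) 0 1 u, E8Bir.G br (E8Bir.paramMap i a) 0 1 u)) := by
  refine ⟨E8Bir.representation hbr hτ, fun i a => ?_,
    fun g a => (E8Bir.representation_mem hbr hτ g a).1,
    fun g a => (E8Bir.representation_mem hbr hτ g a).2,
    fun i a u hu => a.2.xyMap_F_G hbr hτ i hu⟩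
  rw [E8Bir.representation_w]
  exact ⟨rfl, Prod.ext (E8Bir.pullHom_x hbr hτ i a) (E8Bir.pullHom_y hbr hτ i a)⟩
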